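/- **Setting.** Let $0<S\le\infty$. Functions of $x$ are identified when they agree a.e., and pointwise bounds in $x$ are meant for a.e. $x$. Let $\Gamma(x,t)=(4\pi t)^{-3/2}e^{-|x|^2/(4t)}$, and let $K_{ij}(x,t)=\delta_{ij}\Gamma(x,t)+\int_t^\infty\partial_i\partial_j\Gamma(x,s)\,ds$ be the Oseen tensor, i.e. the kernel of $e^{t\Delta}\mathbb P$ with $\mathbb P$ the Leray projection. A *mild solution* of the Navier–Stokes equations (with unit viscosity) on $\mathbb R^3\times(0,S)$ with initial data $u_0$ (a vector-valued distribution) is a measurable vector field $u\in L^\infty_{\rm loc}((0,S);L^\infty(\mathbb R^3))$ which is divergence free in the sense of distributions at each time, converges to $u_0$ in the sense of distributions as $t\to0^+$, and satisfies, for all $0<s<t<S$, $$u(t)=e^{(t-s)\Delta}u(s)-\int_s^t e^{(t-r)\Delta}\mathbb P\nabla\cdot(u\otimes u)(r)\,dr ,$$ that is, for $i=1,2,3$ and a.e. $x$, $$u_i(x,t)=\int\Gamma(x-y,t-s)u_i(y,s)\,dy-\int_s^t\!\int\sum_{j,k}\partial_kK_{ij}(x-y,t-r)\,u_j(y,r)u_k(y,r)\,dy\,dr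 .$$ For mild solutions $u,v$ on $\mathbb R^3\times(0,S)$ with the same initial data put $w=u-v$, and consider the conditions $$\text{(A1')}\quad |u(x,t)|+|v(x,t)|\le\frac{c_1}{|x|+\sqrt t}\quad(0<t<S),\qquad\qquad \text{(A2)}\quad \|w(t)\|_{L^p}\,t^{\frac12-\frac3{2p}}\ge c_2\quad(0<t<S),$$ with $c_1,c_2>0$ and, in (A2), $3<p\le\infty$. Let $M_0(t)=2\max\{\|u(t)\|_{L^\infty},\|v(t)\|_{L^\infty}\}$, and let $B_r$ be the ball of radius $r$ centered at the origin. **Theorem 1.** (1) (Uniqueness criterion) For all $c_1>0$ and $3\le p<\infty$ there is $\epsilon_1=\epsilon_1(c_1,p)\in(0,c_1)$ such that, with $\eta=\epsilon_1/(c_1-\epsilon_1)$, the following holds for every $S$ and all mild solutions $u,v$ on $\mathbb R^3\times(0,S)$ with the same initial data that satisfy (A1') with constant $c_1$: if there is $T>0$ such that $$\|w(t)\chi_{B_{\eta^{-1}\sqrt t}}\|_{L^p}\le\frac{\epsilon_1}2\,\|w(t)\chi_{B^c_{\eta^{-1}\sqrt t}}\|_{L^p}\qquad\text{for all }0<t<\min\{T,S\},$$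 then $w=0$ on $\mathbb R^3\times(0,S)$. (2) (Lower bound on the error) Let $0<S\le\infty$, $3<p\le\infty$, $c_2>0$, $0<t<S$, $a\ge0$, $c_3>0$ and $0\le M<\infty$. There is $b>1$, depending only on these quantities, such that no pair of mild solutions $u,v$ on $\mathbb R^3\times(0,S)$ with the same initial data, with (A2) for $p$ and $c_2$, and with $M_0(t)=M$, satisfies $$|w(x,t)|<c_3\,\frac{\sqrt t^{\,a}}{(b|x|+\sqrt t)^{a+1}}\qquad\text{for a.e. }x\in\mathbb R^3 .$$ (3) (Upper bound on the error) For every $c_1>0$ there is a constant $C=C(c_1)$ such that, for every $S$ and all mild solutions $u,v$ on $\mathbb R^3\times(0,S)$ with the same initial data that satisfy (A1') with constant $c_1$, $$|w(x,t)|\,\frac{(|x|+\sqrt t)^4}{\sqrt t^{\,3}}\le C\qquad\text{for all }0<t<S\text{ and a.e. }x\in\mathbb R^3 .$$ -/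

import Mathlib

open MeasureTheory Filter Topology
open scoped ENNReal NNReal Distributions

namespace NSError

/-- The space `ℝ³` with its Euclidean norm. -/
abbrev R3 : Type := EuclideanSpace ℝ (Fin 3)

/-- The partial derivative `∂ᵢ f` of a real function on `ℝ³`. -/
noncomputable def pd (i : Fin 3) (f : R3 → ℝ) (x : R3) : ℝ :=
  fderiv ℝ f x (EuclideanSpace.single i 1)

/-- The heat kernel `Γ(x,t) = (4πt)^{-3/2} exp(-|x|²/(4t))` on `ℝ³`, the kernel of `e^{tΔ}`. -/
noncomputable def heatKernel (t : ℝ) (x : R3) : ℝ :=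
  (4 * Real.pi * t) ^ (-(3 / 2) : ℝ) * Real.exp (-‖x‖ ^ 2 / (4 * t))

/-- The Oseen tensor `K(x,t)`, the matrix-valued convolution kernel of `e^{tΔ} ℙ` for `t > 0`.
As `ℙ = Id + ∇ (-Δ)⁻¹ ∇·` and `e^{tΔ} (-Δ)⁻¹ = ∫ₜ^∞ e^{sΔ} ds`, it is
`Kᵢⱼ(x,t) = δᵢⱼ Γ(x,t) + ∫ₜ^∞ ∂ᵢ∂ⱼΓ(x,s) ds`. -/
noncomputable def oseenTensor (i j : Fin 3) (t : ℝ) (x : R3) : ℝ :=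
  (if i = j then heatKernel t x else 0) + ∫ s in Set.Ioi t, pd i (pd j (heatKernel s)) x

/-- The caloric extension `e^{tΔ} f`, for `t > 0`. -/
noncomputable def heatFlow (t : ℝ) (f : R3 → R3) (x : R3) : R3 :=
  ∫ y, heatKernel t (x - y) • f y

/-- The `i`-th component of `e^{tΔ} ℙ ∇·(f ⊗ f)`, for `t > 0`; the divergence is carried by
the kernel. -/
noncomputable def oseenDiv (t : ℝ) (f : R3 → R3) (i : Fin 3) (x : R3) : ℝ :=
  ∫ y, ∑ j, ∑ k, pd k (oseenTensor i j t) (x - y) * (f y j * f y k)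

/-- The times of existence of a solution on `ℝ³ × (0,S)`, where `S` may be `∞`. -/
def times (S : EReal) : Set ℝ := {t : ℝ | 0 < t ∧ (t : EReal) < S}

/-- `u` is a mild solution of the Navier-Stokes equations (with unit viscosity) on
`ℝ³ × (0,S)` with initial data the distribution `u₀`. As usual, functions of `x` are
determined up to null sets. -/
structure IsMildSolution (S : EReal) (u₀ : 𝓓'((⊤ : TopologicalSpace.Opens R3), R3))
    (u : ℝ → R3 → R3) : Prop where
  /-- joint measurability on `(0,S) × ℝ³` -/
  aestronglyMeasurable : AEStronglyMeasurable (Function.uncurry u)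
    ((volume : Measure (ℝ × R3)).restrict (times S ×ˢ Set.univ))
  /-- measurability of every time slice -/
  aestronglyMeasurable_slice : ∀ t ∈ times S, AEStronglyMeasurable (u t) volume
  /-- `u ∈ L^∞_loc((0,S); L^∞(ℝ³))` -/
  locally_bounded : ∀ s ∈ times S, ∀ t ∈ times S, ∃ M : ℝ,
    ∀ r ∈ Set.Icc s t, ∀ᵐ x : R3, ‖u r x‖ ≤ M
  /-- `∇ · u = 0` in the sense of distributions -/
  divergence_free : ∀ t ∈ times S, ∀ φ : 𝓓((⊤ : TopologicalSpace.Opens R3), ℝ),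
    ∫ x, ∑ i, u t x i * pd i φ x = 0
  /-- `u(t) = e^{(t-s)Δ} u(s) - ∫ₛᵗ e^{(t-r)Δ} ℙ ∇·(u ⊗ u)(r) dr` -/
  duhamel : ∀ s ∈ times S, ∀ t ∈ times S, s < t → ∀ i : Fin 3, ∀ᵐ x : R3,
    u t x i = heatFlow (t - s) (u s) x i - ∫ r in s..t, oseenDiv (t - r) (u r) i x
  /-- `u(t) → u₀` in the sense of distributions as `t → 0⁺` -/
  initial_data : ∀ φ : 𝓓((⊤ : TopologicalSpace.Opens R3), ℝ),
    Tendsto (fun t => ∫ x, φ x • u t x) (𝓝[>] 0) (𝓝 (u₀ φ))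

/-- The centered Type I condition `|u(x,t)| + |v(x,t)| ≤ c₁ / (|x| + √t)` on `ℝ³ × (0,S)`. -/
def CenteredTypeI (S : EReal) (c₁ : ℝ) (u v : ℝ → R3 → R3) : Prop :=
  ∀ t ∈ times S, ∀ᵐ x : R3, ‖u t x‖ + ‖v t x‖ ≤ c₁ / (‖x‖ + √t)

/-- The lower bound `‖w(t)‖_{L^p} t^{1/2 - 3/(2p)} ≥ c₂` for all times, where
`1/2 - 3/(2p)` is `1/2` when `p = ∞`. -/
def CriticalLowerBound (S : EReal) (p : ℝ≥0∞) (c₂ : ℝ) (w : ℝ → R3 → R3) : Prop :=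
  ∀ t ∈ times S, ENNReal.ofReal c₂ ≤
    eLpNorm (w t) p volume * ENNReal.ofReal (t ^ (1 / 2 - 3 / 2 * (p⁻¹).toReal))

/-- `M₀(t) = 2 max{‖u(t)‖_∞, ‖v(t)‖_∞}`. -/
noncomputable def M0 (u v : ℝ → R3 → R3) (t : ℝ) : ℝ≥0∞ :=
  2 * max (eLpNorm (u t) ∞ volume) (eLpNorm (v t) ∞ volume)

end NSError

/-! All three parts rest on one integral inequality for w = u - v. The kernel of e^{tΔ}ℙ∇· is at
most a constant times (|x|+√t)^{-4} (`exists_oseenGrad_bound`), so subtracting the two Duhamel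
formulas bounds |w(t)| by the heat flow of w(s) plus a multiple of the space-time integral of this
majorant against |w|(|u|+|v|) (`IsMildSolution.enorm_sub_le`). Under the Type I condition |w(s)| ≤
c₁/|x| uniformly in s, while w(s) → 0 as a distribution; hence the heat term disappears as s → 0 and
only the bilinear term is left (`IsMildSolution.enorm_sub_le_bilinearMajorant`).

Upper bound: feeding |w| ≲ √t^k/(|x|+√t)^{k+1} and |u|+|v| ≤ c₁/(|x|+√t) into the bilinear term
gains a factor √t/(|x|+√t) (`exists_differenceDecay_succ`). Starting from the Type I bound, three
rounds give the decay |x|^{-4}, which is that of the kernel itself.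

Uniqueness: with α = 1/2 - 3/(2p), this decay makes W = sup t^α ‖w(t)‖_p finite. Far from the origin
|u|+|v| ≤ ε₁/√t, and near the origin w is small by hypothesis, so ‖w(|u|+|v|)‖_p ≲ ε₁ t^{-1/2} ‖w‖_p
(`lintegral_nonlinear_rpow_le`). A space-time Young inequality (`lintegral_rpow_majorant_le`) turns
this into W ≤ Kε₁W with Kε₁ ≤ 1/2, so W = 0 for short times. Uniqueness of bounded mild solutions
forward in time does the rest (`forall_sub_eq_zero_of_sub_eq_zero`).

Lower bound: the forbidden bound implies |w(x,t)| ≤ c₃/(b|x|+√t). For p < ∞ the L^p norm of the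
right side tends to 0 as b → ∞, contradicting (A2) at time t. For p = ∞ its supremum does not depend
on b, so one looks at a slightly later time t': by |w(t)| ≤ c₃/(b|x|) the heat flow is of size
b^{-1}(t'-t)^{-1/2}, and the bound M at time t controls the nonlinear term on [t,t']
(`exists_forall_enorm_le`, `forall_enorm_sub_le_of_heatFlow_le`). Thus w(t') is small, contradicting
(A2) there. -/

namespace NSError

/-! ### Derivatives of the heat kernel -/

/-- The linear form on `ℝ³` with coefficients `c`. -/
noncomputable def coordForm (c : Fin 3 → ℝ) : R3 →L[ℝ] ℝ :=
  ∑ k, c k • (EuclideanSpace.proj k : R3 →L[ℝ] ℝ)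

theorem coordForm_apply (c : Fin 3 → ℝ) (x : R3) : coordForm c x = ∑ k, c k * x k := by
  simp [coordForm]

theorem coordForm_single (c : Fin 3 → ℝ) (k : Fin 3) :
    coordForm c (EuclideanSpace.single k 1) = c k := by
  simp [coordForm_apply]

theorem norm_coord_le (x : R3) (i : Fin 3) : |x i| ≤ ‖x‖ := by
  simpa using PiLp.norm_apply_le x i

theorem norm_coordForm_le (c : Fin 3 → ℝ) : ‖coordForm c‖ ≤ ∑ k, |c k| := by
  refine ContinuousLinearMap.opNorm_le_bound _ (Finset.sum_nonneg fun _ _ => abs_nonneg _) fun x => ?_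
  rw [coordForm_apply, Finset.sum_mul]
  refine (norm_sum_le _ _).trans (Finset.sum_le_sum fun k _ => ?_)
  rw [norm_mul]
  exact mul_le_mul_of_nonneg_left (norm_coord_le x k) (abs_nonneg _)

theorem pd_eq_of_hasFDerivAt {f : R3 → ℝ} {c : Fin 3 → ℝ} {x : R3}
    (h : HasFDerivAt f (coordForm c) x) (k : Fin 3) : pd k f x = c k := by
  rw [pd, h.fderiv, coordForm_single]

theorem hasFDerivAt_coord (i : Fin 3) (x : R3) :
    HasFDerivAt (fun y : R3 => y i) (coordForm fun k => if i = k then 1 else 0) x := by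
  have h := (EuclideanSpace.proj i : R3 →L[ℝ] ℝ).hasFDerivAt (x := x)
  have e : (coordForm fun k => if i = k then 1 else 0) = (EuclideanSpace.proj i : R3 →L[ℝ] ℝ) := by
    ext y
    simp [coordForm_apply]
  rw [e]
  exact h

theorem hasFDerivAt_mul_coordForm {f g : R3 → ℝ} {c d : Fin 3 → ℝ} {x : R3}
    (hf : HasFDerivAt f (coordForm c) x) (hg : HasFDerivAt g (coordForm d) x) :
    HasFDerivAt (fun y => f y * g y) (coordForm fun k => f x * d k + g x * c k) x := by
  refine (hf.mul hg).congr_fderiv ?_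
  ext y
  simp only [coordForm_apply, add_apply, smul_apply, smul_eq_mul, Finset.mul_sum, ← Finset.sum_add_distrib]
  exact Finset.sum_congr rfl fun k _ => by ring

theorem hasFDerivAt_heatKernel (s : ℝ) (x : R3) :
    HasFDerivAt (heatKernel s) (coordForm fun k => -(x k / (2 * s)) * heatKernel s x) x := by
  have h1 : HasFDerivAt (fun y : R3 => ‖y‖ ^ 2) (2 • innerSL ℝ x) x :=
    (hasStrictFDerivAt_norm_sq x).hasFDerivAt
  have h2 := (((h1.neg.mul_const (4 * s)⁻¹).exp).const_mul ((4 * Real.pi * s) ^ (-(3 / 2) : ℝ)))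
  have h3 : HasFDerivAt (heatKernel s) _ x := h2
  refine h3.congr_fderiv ?_
  ext y
  simp only [coordForm_apply, smul_apply, heatKernel, smul_eq_mul, neg_apply, Pi.neg_apply, innerSL_apply_apply, div_eq_mul_inv, PiLp.inner_apply, nsmul_eq_mul, Nat.cast_ofNat,
    Fin.sum_univ_three, RCLike.inner_apply, conj_trivial, mul_inv]
  ring

/-- The second derivatives of the heat kernel. -/
noncomputable def heatHess (i j : Fin 3) (s : ℝ) (x : R3) : ℝ :=
  (x i * x j * ((2 * s)⁻¹ * (2 * s)⁻¹) - (if j = i then 1 else 0) * (2 * s)⁻¹) * heatKernel s x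

/-- The third derivatives of the heat kernel. -/
noncomputable def heatThird (i j k : Fin 3) (s : ℝ) (x : R3) : ℝ :=
  ((x i * (if j = k then 1 else 0) + x j * (if i = k then 1 else 0)) * ((2 * s)⁻¹ * (2 * s)⁻¹) -
    (x i * x j * ((2 * s)⁻¹ * (2 * s)⁻¹) - (if j = i then 1 else 0) * (2 * s)⁻¹) *
      (x k * (2 * s)⁻¹)) * heatKernel s x

theorem pd_heatKernel (j : Fin 3) (s : ℝ) :
    pd j (heatKernel s) = fun x => x j * (-(2 * s)⁻¹ * heatKernel s x) := by
  ext x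
  rw [pd_eq_of_hasFDerivAt (hasFDerivAt_heatKernel s x)]
  ring

theorem hasFDerivAt_const_mul_coordForm {f : R3 → ℝ} {c : Fin 3 → ℝ} {x : R3}
    (hf : HasFDerivAt f (coordForm c) x) (a : ℝ) :
    HasFDerivAt (fun y => a * f y) (coordForm fun k => a * c k) x := by
  refine (hf.const_mul a).congr_fderiv ?_
  ext y
  simp only [coordForm_apply, smul_apply, smul_eq_mul, Finset.mul_sum]
  exact Finset.sum_congr rfl fun k _ => by ring

theorem pd_pd_heatKernel (i j : Fin 3) (s : ℝ) :
    pd i (pd j (heatKernel s)) = heatHess i j s := by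
  ext x
  rw [pd_heatKernel, pd_eq_of_hasFDerivAt (hasFDerivAt_mul_coordForm (hasFDerivAt_coord j x)
    (hasFDerivAt_const_mul_coordForm (hasFDerivAt_heatKernel s x) (-(2 * s)⁻¹))), heatHess]
  ring

theorem hasFDerivAt_heatHess (i j : Fin 3) (s : ℝ) (x : R3) :
    HasFDerivAt (heatHess i j s) (coordForm fun k => heatThird i j k s x) x := by
  have h1 := hasFDerivAt_const_mul_coordForm
    (hasFDerivAt_mul_coordForm (hasFDerivAt_coord i x) (hasFDerivAt_coord j x)) ((2 * s)⁻¹ * (2 * s)⁻¹)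
  have h2 : HasFDerivAt (fun y : R3 => (2 * s)⁻¹ * (2 * s)⁻¹ * (y i * y j) -
      (if j = i then 1 else 0) * (2 * s)⁻¹) _ x := h1.sub_const _
  have e : heatHess i j s = fun y : R3 => ((2 * s)⁻¹ * (2 * s)⁻¹ * (y i * y j) -
      (if j = i then 1 else 0) * (2 * s)⁻¹) * heatKernel s y := by
    ext y
    rw [heatHess]
    ring
  rw [e]
  refine (hasFDerivAt_mul_coordForm h2 (hasFDerivAt_heatKernel s x)).congr_fderiv ?_
  congr 1
  ext k
  rw [heatThird]
  ring

/-! ### Polynomial bounds for the heat kernel and its derivatives -/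

/-- Take the fifth power of y ≤ e^y at y = (s+q)/(20s): the 20 makes 5y = 1/4 + q/(4s). With q =
|x|² the fifth power means decay |x|^{-10}, enough to absorb the polynomial factors of three
derivatives. -/
theorem exists_exp_bound : ∃ A : ℝ, 0 < A ∧ ∀ q s : ℝ, 0 ≤ q → 0 < s →
    Real.exp (-q / (4 * s)) ≤ A * (s ^ 5 / (s + q) ^ 5) := by
  refine ⟨20 ^ 5 * Real.exp (1 / 4), by positivity, fun q s hq hs => ?_⟩
  have h1 : (s + q) / (20 * s) ≤ Real.exp ((s + q) / (20 * s)) :=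
    (by linarith : (s + q) / (20 * s) ≤ (s + q) / (20 * s) + 1).trans (Real.add_one_le_exp _)
  have h2 := pow_le_pow_left₀ (by positivity) h1 5
  rw [← Real.exp_nat_mul] at h2
  have h3 : ((5 : ℕ) : ℝ) * ((s + q) / (20 * s)) = 1 / 4 + q / (4 * s) := by
    push_cast
    field_simp
    ring
  rw [h3, Real.exp_add] at h2
  have h4 : Real.exp (-q / (4 * s)) = (Real.exp (q / (4 * s)))⁻¹ := by
    rw [← Real.exp_neg, neg_div]
  rw [h4, inv_le_iff_one_le_mul₀ (Real.exp_pos _)]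
  have h5 : 0 < s + q := by positivity
  have h6 : (s + q) ^ 5 / (20 ^ 5 * s ^ 5) ≤ Real.exp (1 / 4) * Real.exp (q / (4 * s)) := by
    rwa [div_pow, mul_pow] at h2
  have h7 : (1 : ℝ) = 20 ^ 5 * (s ^ 5 / (s + q) ^ 5) * ((s + q) ^ 5 / (20 ^ 5 * s ^ 5)) := by
    field_simp
  calc (1 : ℝ) = 20 ^ 5 * (s ^ 5 / (s + q) ^ 5) * ((s + q) ^ 5 / (20 ^ 5 * s ^ 5)) := h7
    _ ≤ 20 ^ 5 * (s ^ 5 / (s + q) ^ 5) * (Real.exp (1 / 4) * Real.exp (q / (4 * s))) := by gcongr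
    _ = _ := by ring

theorem heatKernel_nonneg {s : ℝ} (hs : 0 < s) (x : R3) : 0 ≤ heatKernel s x := by
  rw [heatKernel]; positivity

/-- Gaussian decay in polynomial form. -/
theorem exists_heatKernel_bound : ∃ A : ℝ, 0 < A ∧ ∀ s : ℝ, 0 < s → ∀ x : R3,
    heatKernel s x ≤ A * (√s ^ 7 / (‖x‖ + √s) ^ 10) := by
  obtain ⟨A, hA, h⟩ := exists_exp_bound
  refine ⟨2 ^ 5 * A, by positivity, fun s hs x => ?_⟩
  have hσ : 0 < √s := Real.sqrt_pos.2 hs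
  have hs2 : √s ^ 2 = s := Real.sq_sqrt hs.le
  have h1 : (4 * Real.pi * s) ^ (-(3 / 2) : ℝ) ≤ (√s ^ 3)⁻¹ := by
    have e : (√s ^ 3)⁻¹ = s ^ (-(3 / 2) : ℝ) := by
      rw [Real.rpow_neg hs.le, Real.sqrt_eq_rpow, ← Real.rpow_mul_natCast hs.le]
      norm_num
    rw [e]
    apply Real.rpow_le_rpow_of_nonpos hs _ (by norm_num)
    nlinarith [Real.pi_gt_three]
  have h2 := h (‖x‖ ^ 2) s (by positivity) hs
  have hρ : 0 < ‖x‖ + √s := by positivity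
  have h3 : ((‖x‖ + √s) ^ 2) ≤ 2 * (s + ‖x‖ ^ 2) := by
    nlinarith [sq_nonneg (‖x‖ - √s)]
  have h4 : s ^ 5 / (s + ‖x‖ ^ 2) ^ 5 ≤ 2 ^ 5 * (√s ^ 10 / (‖x‖ + √s) ^ 10) := by
    have h5 := pow_le_pow_left₀ (by positivity) h3 5
    rw [div_le_iff₀ (by positivity), ← mul_div_assoc, div_mul_eq_mul_div, le_div_iff₀ (by positivity)]
    have e1 : √s ^ 10 = s ^ 5 := by rw [← hs2]; rw [hs2]; rw [show √s ^ 10 = (√s ^ 2) ^ 5 by ring, hs2]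
    rw [e1]
    calc s ^ 5 * (‖x‖ + √s) ^ 10 = s ^ 5 * ((‖x‖ + √s) ^ 2) ^ 5 := by ring
      _ ≤ s ^ 5 * (2 * (s + ‖x‖ ^ 2)) ^ 5 := by gcongr
      _ = _ := by ring
  calc heatKernel s x ≤ (√s ^ 3)⁻¹ * (A * (2 ^ 5 * (√s ^ 10 / (‖x‖ + √s) ^ 10))) := by
        rw [heatKernel]
        gcongr
        exact h2.trans (by gcongr)
    _ = _ := by
      field_simp

theorem exists_heatKernel_le : ∃ A : ℝ, 0 < A ∧ ∀ s : ℝ, 0 < s → ∀ x : R3,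
    heatKernel s x ≤ A * (√s * ((‖x‖ + √s) ^ 4)⁻¹) := by
  obtain ⟨A, hA, h⟩ := exists_heatKernel_bound
  refine ⟨A, hA, fun s hs x => (h s hs x).trans ?_⟩
  have hσ : 0 < √s := Real.sqrt_pos.2 hs
  have hρ : √s ≤ ‖x‖ + √s := by linarith [norm_nonneg x]
  set ρ := ‖x‖ + √s
  have hρ0 : 0 < ρ := hσ.trans_le hρ
  gcongr
  rw [← div_eq_mul_inv, div_le_div_iff₀ (by positivity) (by positivity)]
  calc √s ^ 7 * ρ ^ 4 = √s * ρ ^ 4 * √s ^ 6 := by ring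
    _ ≤ √s * ρ ^ 4 * ρ ^ 6 := by gcongr
    _ = _ := by ring

theorem abs_ite_le (p : Prop) [Decidable p] : |(if p then 1 else 0 : ℝ)| ≤ 1 := by
  split_ifs <;> simp

/-- Put σ = √s ≤ ρ = |x|+√s. The polynomial prefactors are at most ρ/σ², ρ²/σ⁴ and ρ³/σ⁶; multiplied
by σ⁷/ρ¹⁰ each leaves a positive power of σ, part or all of which may be traded for powers of ρ. -/
theorem exists_heatKernel_derivative_bounds : ∃ A : ℝ, 0 < A ∧ ∀ s : ℝ, 0 < s → ∀ (x : R3) (i j k : Fin 3),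
    |x k / (2 * s) * heatKernel s x| ≤ A * ((‖x‖ + √s) ^ 4)⁻¹ ∧
    |heatHess i j s x| ≤ A * (√s ^ 3 * ((‖x‖ + √s) ^ 8)⁻¹) ∧
    |heatThird i j k s x| ≤ A * ((‖x‖ + √s) ^ 6)⁻¹ := by
  obtain ⟨A, hA, h⟩ := exists_heatKernel_bound
  refine ⟨A, hA, fun s hs x i j k => ?_⟩
  have hσ : 0 < √s := Real.sqrt_pos.2 hs
  have hs2 : √s ^ 2 = s := Real.sq_sqrt hs.le
  have hρ : √s ≤ ‖x‖ + √s := by linarith [norm_nonneg x]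
  have hx : ∀ l, |x l| ≤ ‖x‖ + √s := fun l => (norm_coord_le x l).trans (by linarith)
  have hΓ := h s hs x
  have hΓ0 := heatKernel_nonneg hs x
  set ρ := ‖x‖ + √s
  set σ := √s
  set G := heatKernel s x
  have hρ0 : 0 < ρ := hσ.trans_le hρ
  have hS : (2 * s)⁻¹ = (σ ^ 2)⁻¹ / 2 := by rw [← hs2]; field_simp
  have hS' : |(2 * s)⁻¹| = (σ ^ 2)⁻¹ / 2 := by rw [hS, abs_of_pos (by positivity)]
  have hσρ : (σ ^ 2)⁻¹ ≤ ρ ^ 2 * (σ ^ 4)⁻¹ := by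
    rw [← div_eq_mul_inv, le_div_iff₀ (by positivity)]
    calc (σ ^ 2)⁻¹ * σ ^ 4 = σ ^ 2 := by field_simp
      _ ≤ ρ ^ 2 := by gcongr
  have hH : |x i * x j * ((2 * s)⁻¹ * (2 * s)⁻¹) - (if j = i then 1 else 0) * (2 * s)⁻¹| ≤
      ρ ^ 2 * (σ ^ 4)⁻¹ := by
    refine (abs_sub _ _).trans ?_
    simp only [abs_mul, hS']
    calc |x i| * |x j| * ((σ ^ 2)⁻¹ / 2 * ((σ ^ 2)⁻¹ / 2)) + |(if j = i then 1 else 0 : ℝ)| * ((σ ^ 2)⁻¹ / 2)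
        ≤ ρ * ρ * ((σ ^ 2)⁻¹ / 2 * ((σ ^ 2)⁻¹ / 2)) + 1 * ((σ ^ 2)⁻¹ / 2) := by
          gcongr
          · exact hx i
          · exact hx j
          · exact abs_ite_le _
      _ = ρ ^ 2 * (σ ^ 4)⁻¹ / 4 + (σ ^ 2)⁻¹ / 2 := by field_simp; ring
      _ ≤ _ := by nlinarith [show 0 < ρ ^ 2 * (σ ^ 4)⁻¹ by positivity]
  refine ⟨?_, ?_, ?_⟩
  · rw [div_eq_mul_inv, abs_mul, abs_mul, hS', abs_of_nonneg hΓ0]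
    calc |x k| * ((σ ^ 2)⁻¹ / 2) * G ≤ ρ * ((σ ^ 2)⁻¹ / 1) * (A * (σ ^ 7 / ρ ^ 10)) := by
          gcongr
          · exact hx k
          · norm_num
      _ = A * (σ ^ 5 * (ρ ^ 9)⁻¹) := by field_simp
      _ ≤ A * (ρ ^ 5 * (ρ ^ 9)⁻¹) := by gcongr
      _ = _ := by field_simp
  · rw [heatHess, abs_mul, abs_of_nonneg hΓ0]
    calc _ ≤ ρ ^ 2 * (σ ^ 4)⁻¹ * (A * (σ ^ 7 / ρ ^ 10)) := by gcongr
      _ = _ := by field_simp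
  · rw [heatThird, abs_mul, abs_of_nonneg hΓ0]
    have h1 : |(x i * (if j = k then 1 else 0) + x j * (if i = k then 1 else 0)) *
        ((2 * s)⁻¹ * (2 * s)⁻¹) -
        (x i * x j * ((2 * s)⁻¹ * (2 * s)⁻¹) - (if j = i then 1 else 0) * (2 * s)⁻¹) *
          (x k * (2 * s)⁻¹)| ≤ ρ ^ 3 * (σ ^ 6)⁻¹ := by
      refine (abs_sub _ _).trans ?_
      rw [abs_mul, abs_mul (_ - _), abs_mul (x k), abs_mul (2 * s)⁻¹, hS']
      have h2 : |x i * (if j = k then 1 else 0) + x j * (if i = k then 1 else 0)| ≤ 2 * ρ := by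
        refine (abs_add_le _ _).trans ?_
        rw [abs_mul, abs_mul]
        nlinarith [hx i, hx j, abs_ite_le (j = k), abs_ite_le (i = k), abs_nonneg (x i),
          abs_nonneg (x j)]
      calc _ ≤ 2 * ρ * ((σ ^ 2)⁻¹ / 2 * ((σ ^ 2)⁻¹ / 2)) + ρ ^ 2 * (σ ^ 4)⁻¹ * (ρ * ((σ ^ 2)⁻¹ / 2)) := by
            gcongr
            exact hx k
        _ = ρ * (σ ^ 2)⁻¹ * (σ ^ 2)⁻¹ / 2 + ρ ^ 3 * (σ ^ 6)⁻¹ / 2 := by field_simp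
        _ ≤ ρ * (σ ^ 2)⁻¹ * (ρ ^ 2 * (σ ^ 4)⁻¹) / 2 + ρ ^ 3 * (σ ^ 6)⁻¹ / 2 := by gcongr
        _ = _ := by field_simp; ring
    calc _ ≤ ρ ^ 3 * (σ ^ 6)⁻¹ * (A * (σ ^ 7 / ρ ^ 10)) := by gcongr
      _ = A * (σ ^ 1 * (ρ ^ 7)⁻¹) := by field_simp
      _ ≤ A * (ρ ^ 1 * (ρ ^ 7)⁻¹) := by gcongr
      _ = _ := by field_simp

/-! ### The gradient of the Oseen tensor -/

theorem integrableOn_inv_add_cube {q t : ℝ} (hq : 0 ≤ q) (ht : 0 < t) :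
    IntegrableOn (fun s => ((q + s) ^ 3)⁻¹) (Set.Ioi t) ∧
      ∫ s in Set.Ioi t, ((q + s) ^ 3)⁻¹ = ((q + t) ^ 2)⁻¹ / 2 := by
  have hd : ∀ s ∈ Set.Ici t, HasDerivAt (fun s => -(((q + s) ^ 2)⁻¹ / 2)) (((q + s) ^ 3)⁻¹) s := by
    intro s hs
    have hs0 : 0 < q + s := by have : t ≤ s := hs; linarith
    have h1 := (((((hasDerivAt_id s).const_add q).fun_pow 2).inv (pow_pos hs0 2).ne').div_const 2).neg
    refine h1.congr_deriv ?_
    simp only [id]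
    field_simp
    push_cast
    ring
  have hpos : ∀ s ∈ Set.Ioi t, 0 ≤ ((q + s) ^ 3)⁻¹ := by
    intro s hs
    have : t < s := hs
    have : 0 < q + s := by linarith
    positivity
  have hlim : Tendsto (fun s => -(((q + s) ^ 2)⁻¹ / 2)) atTop (𝓝 0) := by
    have h1 : Tendsto (fun s : ℝ => (q + s) ^ 2) atTop atTop :=
      (tendsto_pow_atTop two_ne_zero).comp (tendsto_atTop_add_const_left _ q tendsto_id)
    simpa using ((tendsto_inv_atTop_zero.comp h1).div_const 2).neg
  refine ⟨integrableOn_Ioi_deriv_of_nonneg' hd hpos hlim, ?_⟩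
  rw [integral_Ioi_of_hasDerivAt_of_nonneg' hd hpos hlim]
  ring

theorem measurable_heatKernel : Measurable fun p : ℝ × R3 => heatKernel p.1 p.2 := by
  unfold heatKernel
  fun_prop

theorem measurable_heatHess (i j : Fin 3) : Measurable fun p : ℝ × R3 => heatHess i j p.1 p.2 := by
  unfold heatHess
  have := measurable_heatKernel
  fun_prop

theorem measurable_heatThird (i j k : Fin 3) :
    Measurable fun p : ℝ × R3 => heatThird i j k p.1 p.2 := by
  unfold heatThird
  have := measurable_heatKernel
  fun_prop

/-- The derivative `∂ₖ Kᵢⱼ(x,t)` of the Oseen tensor in explicit form. -/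
noncomputable def oseenGrad (i j k : Fin 3) (t : ℝ) (x : R3) : ℝ :=
  (if i = j then -(x k / (2 * t)) * heatKernel t x else 0) +
    ∫ s in Set.Ioi t, heatThird i j k s x

theorem norm_sq_add_le (x : R3) {s : ℝ} (hs : 0 < s) : ‖x‖ ^ 2 + s ≤ (‖x‖ + √s) ^ 2 := by
  have := Real.sq_sqrt hs.le
  nlinarith [mul_nonneg (norm_nonneg x) (Real.sqrt_nonneg s)]

theorem inv_rho_six_le (x : R3) {s : ℝ} (hs : 0 < s) :
    ((‖x‖ + √s) ^ 6)⁻¹ ≤ ((‖x‖ ^ 2 + s) ^ 3)⁻¹ := by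
  have h := pow_le_pow_left₀ (by positivity) (norm_sq_add_le x hs) 3
  rw [← pow_mul] at h
  exact inv_anti₀ (by positivity) h

/-- Differentiation under the integral over s: for s > t the third derivatives are at most A s^{-3}
uniformly in space, which is integrable on (t,∞). -/
theorem pd_oseenTensor (i j k : Fin 3) {t : ℝ} (ht : 0 < t) (x : R3) :
    pd k (oseenTensor i j t) x = oseenGrad i j k t x := by
  obtain ⟨A, hA, hb⟩ := exists_heatKernel_derivative_bounds
  have hcube := integrableOn_inv_add_cube le_rfl ht
  have hthird : ∀ s ∈ Set.Ioi t, ∀ (y : R3) (l : Fin 3),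
      |heatThird i j l s y| ≤ A * ((0 + s) ^ 3)⁻¹ := by
    intro s hs y l
    have hs0 : 0 < s := ht.trans hs
    refine (hb s hs0 y i j l).2.2.trans ?_
    refine mul_le_mul_of_nonneg_left ((inv_rho_six_le y hs0).trans ?_) hA.le
    gcongr
    positivity
  have hmeasH : ∀ y, AEStronglyMeasurable (fun s => heatHess i j s y)
      (volume.restrict (Set.Ioi t)) := fun y =>
    ((measurable_heatHess i j).comp (measurable_id.prodMk measurable_const)).aestronglyMeasurable
  have hmeasT : ∀ (l : Fin 3) (y : R3), AEStronglyMeasurable (fun s => heatThird i j l s y)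
      (volume.restrict (Set.Ioi t)) := fun l y =>
    ((measurable_heatThird i j l).comp (measurable_id.prodMk measurable_const)).aestronglyMeasurable
  have hintT : ∀ (l : Fin 3) (y : R3), IntegrableOn (fun s => heatThird i j l s y) (Set.Ioi t) := by
    intro l y
    refine (hcube.1.const_mul A).mono' (hmeasT l y) ?_
    exact (ae_restrict_iff' measurableSet_Ioi).2 (ae_of_all _ fun s hs => hthird s hs y l)
  have hintH : IntegrableOn (fun s => heatHess i j s x) (Set.Ioi t) := by
    -- The Hessian is of order s^{-5/2}; half a power is spent on t^{-1/2}, leaving s^{-2}.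
    refine ((integrableOn_Ioi_rpow_of_lt (a := -2) (by norm_num) ht).const_mul (A * (√t)⁻¹)).mono'
      (hmeasH x) ?_
    refine (ae_restrict_iff' measurableSet_Ioi).2 (ae_of_all _ fun s hs => ?_)
    have hs0 : 0 < s := ht.trans hs
    have hσ : 0 < √s := Real.sqrt_pos.2 hs0
    have hτ : 0 < √t := Real.sqrt_pos.2 ht
    have hts : √t ≤ √s := Real.sqrt_le_sqrt (le_of_lt hs)
    have e : s ^ (-2 : ℝ) = (√s ^ 4)⁻¹ := by
      rw [show √s ^ 4 = (√s ^ 2) ^ 2 by ring, Real.sq_sqrt hs0.le, Real.rpow_neg hs0.le]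
      norm_num
    rw [Real.norm_eq_abs, e]
    calc |heatHess i j s x| ≤ A * (√s ^ 3 * ((‖x‖ + √s) ^ 8)⁻¹) := (hb s hs0 x i j k).2.1
      _ ≤ A * (√s ^ 3 * ((√s) ^ 8)⁻¹) := by
        gcongr
        linarith [norm_nonneg x]
      _ = A * (√s)⁻¹ * (√s ^ 4)⁻¹ := by field_simp
      _ ≤ _ := by gcongr
  have hform : ∀ (s : ℝ) (y : R3), coordForm (fun l => heatThird i j l s y) =
      ∑ l, heatThird i j l s y • (EuclideanSpace.proj l : R3 →L[ℝ] ℝ) := fun _ _ => rfl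
  have key : HasFDerivAt (fun y => ∫ s in Set.Ioi t, heatHess i j s y)
      (∫ s in Set.Ioi t, coordForm (fun l => heatThird i j l s x)) x := by
    refine hasFDerivAt_integral_of_dominated_of_fderiv_le (s := Set.univ)
      (F' := fun y s => coordForm fun l => heatThird i j l s y)
      (bound := fun s => 3 * (A * ((0 + s) ^ 3)⁻¹)) univ_mem
      (Eventually.of_forall hmeasH) hintH ?_ ?_ ((hcube.1.const_mul A).const_mul 3) ?_
    · simp only [hform]
      exact Finset.aestronglyMeasurable_fun_sum _ fun l _ => (hmeasT l x).smul_const _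
    · refine (ae_restrict_iff' measurableSet_Ioi).2 (ae_of_all _ fun s hs y _ => ?_)
      refine (norm_coordForm_le _).trans ?_
      rw [Fin.sum_univ_three]
      linarith [hthird s hs y 0, hthird s hs y 1, hthird s hs y 2]
    · exact ae_of_all _ fun s y _ => hasFDerivAt_heatHess i j s y
  have key2 : (∫ s in Set.Ioi t, coordForm (fun l => heatThird i j l s x)) =
      coordForm fun l => ∫ s in Set.Ioi t, heatThird i j l s x := by
    simp only [hform]
    rw [integral_finsetSum _ fun l _ => (hintT l x).smul_const _]
    simp only [integral_smul_const]
    rfl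
  rw [key2] at key
  have e : oseenTensor i j t = fun y => (if i = j then 1 else 0) * heatKernel t y +
      ∫ s in Set.Ioi t, heatHess i j s y := by
    ext y
    simp only [oseenTensor, pd_pd_heatKernel]
    split_ifs <;> simp
  have h1 := (hasFDerivAt_const_mul_coordForm (hasFDerivAt_heatKernel t x)
    (if i = j then 1 else 0)).add key
  have h2 : HasFDerivAt (oseenTensor i j t) (coordForm fun l => oseenGrad i j l t x) x := by
    rw [e]
    refine h1.congr_fderiv ?_
    ext y
    simp only [coordForm_apply, add_apply, oseenGrad, ← Finset.sum_add_distrib]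
    refine Finset.sum_congr rfl fun l _ => ?_
    split_ifs <;> ring
  exact pd_eq_of_hasFDerivAt h2 k

/-- Joint measurability in time and space makes the time integrand of the Duhamel term measurable.
Since the domain (t,∞) moves with t, it is encoded as an indicator on a product space. -/
theorem stronglyMeasurable_oseenGrad (i j k : Fin 3) :
    StronglyMeasurable fun p : ℝ × R3 => oseenGrad i j k p.1 p.2 := by
  have e : ∀ p : ℝ × R3, ∫ s in Set.Ioi p.1, heatThird i j k s p.2 =
      ∫ s, Set.indicator {z : (ℝ × R3) × ℝ | z.1.1 < z.2}
        (fun z => heatThird i j k z.2 z.1.2) (p, s) := by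
    intro p
    rw [← integral_indicator measurableSet_Ioi]
    rfl
  have h1 : StronglyMeasurable fun p : ℝ × R3 => ∫ s in Set.Ioi p.1, heatThird i j k s p.2 := by
    simp only [e]
    refine StronglyMeasurable.integral_prod_right ?_
    refine Measurable.stronglyMeasurable ?_
    refine Measurable.indicator ?_ (measurableSet_lt (by fun_prop) (by fun_prop))
    exact (measurable_heatThird i j k).comp (measurable_snd.prodMk (measurable_snd.comp measurable_fst))
  have h2 : Measurable fun p : ℝ × R3 =>
      if i = j then -(p.2 k / (2 * p.1)) * heatKernel p.1 p.2 else 0 := by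
    have := measurable_heatKernel
    split_ifs <;> fun_prop
  exact h2.stronglyMeasurable.add h1

/-- Third derivatives are O((|x|²+s)^{-3}), whose integral over s > t is (|x|²+t)^{-2}/2, comparable
to (|x|+√t)^{-4}. -/
theorem exists_oseenGrad_bound : ∃ A : ℝ, 0 < A ∧ ∀ (i j k : Fin 3) (t : ℝ), 0 < t → ∀ x : R3,
    |oseenGrad i j k t x| ≤ A * ((‖x‖ + √t) ^ 4)⁻¹ := by
  obtain ⟨A, hA, hb⟩ := exists_heatKernel_derivative_bounds
  refine ⟨3 * A, by positivity, fun i j k t ht x => ?_⟩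
  have hτ : 0 < √t := Real.sqrt_pos.2 ht
  have hcube := integrableOn_inv_add_cube (sq_nonneg ‖x‖) ht
  have h1 : |(if i = j then -(x k / (2 * t)) * heatKernel t x else 0)| ≤ A * ((‖x‖ + √t) ^ 4)⁻¹ := by
    split_ifs
    · rw [neg_mul, abs_neg]
      exact (hb t ht x i j k).1
    · rw [abs_zero]
      positivity
  have h2 : |∫ s in Set.Ioi t, heatThird i j k s x| ≤ A * (((‖x‖ ^ 2 + t) ^ 2)⁻¹ / 2) := by
    rw [← hcube.2, ← integral_const_mul, ← Real.norm_eq_abs]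
    refine norm_integral_le_of_norm_le (hcube.1.const_mul A) ?_
    refine (ae_restrict_iff' measurableSet_Ioi).2 (ae_of_all _ fun s hs => ?_)
    have hs0 : 0 < s := ht.trans hs
    exact (hb s hs0 x i j k).2.2.trans (mul_le_mul_of_nonneg_left (inv_rho_six_le x hs0) hA.le)
  have h3 : ((‖x‖ ^ 2 + t) ^ 2)⁻¹ ≤ 4 * ((‖x‖ + √t) ^ 4)⁻¹ := by
    have e : (‖x‖ + √t) ^ 2 ≤ 2 * (‖x‖ ^ 2 + t) := by
      nlinarith [sq_nonneg (‖x‖ - √t), Real.sq_sqrt ht.le]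
    rw [← div_eq_mul_inv, inv_eq_one_div, div_le_div_iff₀ (by positivity) (by positivity)]
    calc 1 * (‖x‖ + √t) ^ 4 = ((‖x‖ + √t) ^ 2) ^ 2 := by ring
      _ ≤ (2 * (‖x‖ ^ 2 + t)) ^ 2 := by gcongr
      _ = _ := by ring
  calc |oseenGrad i j k t x| ≤ A * ((‖x‖ + √t) ^ 4)⁻¹ + A * (((‖x‖ ^ 2 + t) ^ 2)⁻¹ / 2) :=
        (abs_add_le _ _).trans (add_le_add h1 h2)
    _ ≤ A * ((‖x‖ + √t) ^ 4)⁻¹ + A * (4 * ((‖x‖ + √t) ^ 4)⁻¹ / 2) := by gcongr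
    _ = _ := by ring

/-! ### Integrals of the majorants in space and in time -/

theorem finrank_R3 : Module.finrank ℝ R3 = 3 := by simp

theorem lintegral_comp_smul {f : R3 → ℝ≥0∞} (hf : Measurable f) {r : ℝ} (hr : 0 < r) :
    ∫⁻ x, f (r • x) = ENNReal.ofReal ((r ^ 3)⁻¹) * ∫⁻ x, f x := by
  have h := Measure.map_addHaar_smul (volume : Measure R3) hr.ne'
  rw [finrank_R3, abs_of_pos (by positivity)] at h
  rw [← lintegral_map hf (measurable_const_smul r), h, lintegral_smul_measure, smul_eq_mul]

/-- The integral of `(|x| + 1)^{-q}` over `ℝ³`. -/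
noncomputable def japaneseIntegral (q : ℝ) : ℝ≥0∞ := ∫⁻ x : R3, ENNReal.ofReal ((‖x‖ + 1) ^ (-q))

theorem japaneseIntegral_ne_top {q : ℝ} (hq : 3 < q) : japaneseIntegral q ≠ ∞ := by
  have h := integrable_one_add_norm (E := R3) (μ := volume) (r := q) (by rw [finrank_R3]; exact_mod_cast hq)
  have h2 := h.lintegral_lt_top
  simp only [add_comm (1 : ℝ)] at h2
  exact h2.ne

theorem lintegral_norm_add_rpow (q : ℝ) {ρ : ℝ} (hρ : 0 < ρ) :
    ∫⁻ x : R3, ENNReal.ofReal ((‖x‖ + ρ) ^ (-q)) =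
      ENNReal.ofReal (ρ ^ (3 - q)) * japaneseIntegral q := by
  have h1 : ∀ x : R3, ENNReal.ofReal ((‖x‖ + ρ) ^ (-q)) =
      ENNReal.ofReal (ρ ^ (-q)) * ENNReal.ofReal ((‖ρ⁻¹ • x‖ + 1) ^ (-q)) := by
    intro x
    rw [← ENNReal.ofReal_mul (by positivity), ← Real.mul_rpow hρ.le (by positivity), norm_smul,
      norm_inv, Real.norm_of_nonneg hρ.le]
    congr 2
    field_simp
  simp_rw [h1]
  rw [lintegral_const_mul _ (by fun_prop), lintegral_comp_smul (f := fun x =>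
    ENNReal.ofReal ((‖x‖ + 1) ^ (-q))) (by fun_prop) (inv_pos.2 hρ), ← mul_assoc,
    ← ENNReal.ofReal_mul (by positivity), japaneseIntegral]
  congr 2
  rw [inv_pow, inv_inv, ← Real.rpow_natCast, ← Real.rpow_add hρ]
  congr 1
  push_cast
  ring

/-- The majorant `(|x| + √t)^{-4}` of the gradient of the Oseen tensor. -/
noncomputable def majorant (t : ℝ) (x : R3) : ℝ≥0∞ := ENNReal.ofReal (((‖x‖ + √t) ^ 4)⁻¹)

theorem measurable_majorant_conv (t : ℝ) :
    Measurable fun z : R3 × (ℝ × R3) => majorant (t - z.2.1) (z.1 - z.2.2) := by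
  unfold majorant
  fun_prop

theorem measurable_majorant_conv_left (t : ℝ) (x : R3) :
    Measurable fun y : R3 => majorant t (x - y) := by
  unfold majorant
  fun_prop

theorem measurable_majorant_conv_prod (t : ℝ) (x : R3) :
    Measurable fun z : ℝ × R3 => majorant (t - z.1) (x - z.2) := by
  unfold majorant
  fun_prop

theorem lintegral_majorant {t : ℝ} (ht : 0 < t) :
    ∫⁻ x, majorant t x = ENNReal.ofReal (√t)⁻¹ * japaneseIntegral 4 := by
  have hτ : 0 < √t := Real.sqrt_pos.2 ht
  have h := lintegral_norm_add_rpow 4 hτ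
  have e : (√t) ^ ((3 : ℝ) - 4) = (√t)⁻¹ := by
    rw [show (3 : ℝ) - 4 = -1 by norm_num, Real.rpow_neg_one]
  rw [e] at h
  rw [← h]
  refine lintegral_congr fun x => ?_
  rw [majorant, Real.rpow_neg (by positivity)]
  norm_cast

theorem lintegral_majorant_sub {t : ℝ} (ht : 0 < t) (x : R3) :
    ∫⁻ y, majorant t (x - y) = ENNReal.ofReal (√t)⁻¹ * japaneseIntegral 4 := by
  rw [lintegral_sub_left_eq_self (fun z => majorant t z) x, lintegral_majorant ht]

theorem lintegral_majorant_sub' {t : ℝ} (ht : 0 < t) (y : R3) :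
    ∫⁻ x, majorant t (x - y) = ENNReal.ofReal (√t)⁻¹ * japaneseIntegral 4 := by
  rw [lintegral_sub_right_eq_self (fun z => majorant t z) y, lintegral_majorant ht]

theorem japaneseIntegral_four_ne_top : japaneseIntegral 4 ≠ ∞ :=
  japaneseIntegral_ne_top (by norm_num)

theorem lintegral_majorant_mul_le {t : ℝ} (ht : 0 < t) (x : R3) {f : R3 → ℝ≥0∞} {c : ℝ≥0∞}
    (hf : ∀ᵐ y, f y ≤ c) :
    ∫⁻ y, majorant t (x - y) * f y ≤ c * (ENNReal.ofReal (√t)⁻¹ * japaneseIntegral 4) := by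
  calc ∫⁻ y, majorant t (x - y) * f y ≤ ∫⁻ y, c * majorant t (x - y) := by
        refine lintegral_mono_ae (hf.mono fun y hy => ?_)
        rw [mul_comm c]
        gcongr
    _ = _ := by
      rw [lintegral_const_mul _ (measurable_majorant_conv_left t x), lintegral_majorant_sub ht]

/-- The integral of `1/|x|` over the unit ball. -/
noncomputable def ballIntegral : ℝ≥0∞ := ∫⁻ x : R3 in Metric.ball 0 1, ENNReal.ofReal ‖x‖⁻¹

theorem ballIntegral_ne_top : ballIntegral ≠ ∞ := by
  have h : IntegrableOn (fun x : R3 => ‖x‖⁻¹) (Metric.ball 0 1) := by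
    have h1 := integrableOn_fun_norm_addHaar (volume : Measure R3) (f := fun r : ℝ => r⁻¹) (r := 1)
    rw [h1, finrank_R3]
    have h2 : IntegrableOn (fun r : ℝ => r) (Set.Ioo 0 1) :=
      (continuous_id.integrableOn_Icc (a := 0) (b := 1)).mono_set Set.Ioo_subset_Icc_self
    refine h2.congr_fun (fun r hr => ?_) measurableSet_Ioo
    have : r ≠ 0 := hr.1.ne'
    simp only [smul_eq_mul]
    field_simp
  exact h.lintegral_lt_top.ne

theorem lintegral_ball_inv_norm {R : ℝ} (hR : 0 < R) :
    ∫⁻ x : R3 in Metric.ball 0 R, ENNReal.ofReal ‖x‖⁻¹ = ENNReal.ofReal (R ^ 2) * ballIntegral := by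
  rw [ballIntegral, ← lintegral_indicator Metric.isOpen_ball.measurableSet,
    ← lintegral_indicator Metric.isOpen_ball.measurableSet]
  have h1 : ∀ x : R3, (Metric.ball (0 : R3) R).indicator (fun x => ENNReal.ofReal ‖x‖⁻¹) x =
      ENNReal.ofReal R⁻¹ *
        (Metric.ball (0 : R3) 1).indicator (fun x => ENNReal.ofReal ‖x‖⁻¹) (R⁻¹ • x) := by
    intro x
    have e : R⁻¹ • x ∈ Metric.ball (0 : R3) 1 ↔ x ∈ Metric.ball (0 : R3) R := by
      rw [mem_ball_zero_iff, mem_ball_zero_iff, norm_smul, norm_inv, Real.norm_of_nonneg hR.le,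
        inv_mul_lt_iff₀ hR, mul_one]
    by_cases hx : x ∈ Metric.ball (0 : R3) R
    · rw [Set.indicator_of_mem hx, Set.indicator_of_mem (e.2 hx),
        ← ENNReal.ofReal_mul (by positivity), norm_smul, norm_inv, Real.norm_of_nonneg hR.le]
      congr 1
      field_simp
    · rw [Set.indicator_of_notMem hx, Set.indicator_of_notMem (mt e.1 hx), mul_zero]
  simp_rw [h1]
  have hm : Measurable ((Metric.ball (0 : R3) 1).indicator fun x => ENNReal.ofReal ‖x‖⁻¹) :=
    Measurable.indicator (by fun_prop) Metric.isOpen_ball.measurableSet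
  rw [lintegral_const_mul' _ _ ENNReal.ofReal_ne_top, lintegral_comp_smul hm (inv_pos.2 hR),
    ← mul_assoc, ← ENNReal.ofReal_mul (by positivity)]
  congr 2
  field_simp

theorem lintegral_Ioo_rpow {s t β : ℝ} (hst : s ≤ t) (hβ : β < 1) :
    ∫⁻ r in Set.Ioo s t, ENNReal.ofReal ((r - s) ^ (-β)) =
      ENNReal.ofReal ((t - s) ^ (1 - β) / (1 - β)) := by
  have hi : IntervalIntegrable (fun r : ℝ => (r - s) ^ (-β)) volume s t := by
    have := (intervalIntegral.intervalIntegrable_rpow' (a := 0) (b := t - s) (r := -β)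
      (by linarith)).comp_sub_right s
    simpa using this
  have hi' : IntegrableOn (fun r : ℝ => (r - s) ^ (-β)) (Set.Ioo s t) :=
    ((intervalIntegrable_iff_integrableOn_Ioo_of_le hst).1 hi)
  rw [← ofReal_integral_eq_lintegral_ofReal hi', ← integral_Ioc_eq_integral_Ioo,
    ← intervalIntegral.integral_of_le hst,
    intervalIntegral.integral_comp_sub_right (fun r : ℝ => r ^ (-β)) s,
    integral_rpow (Or.inl (by linarith))]
  · rw [sub_self, Real.zero_rpow (by linarith), sub_zero, show -β + 1 = 1 - β by ring]
  · exact (ae_restrict_iff' measurableSet_Ioo).2 (ae_of_all _ fun r hr =>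
      Real.rpow_nonneg (by linarith [hr.1]) _)

/-- The reflection r ↦ s+t-r moves the singularity to the left endpoint. -/
theorem lintegral_Ioo_inv_sqrt {s t : ℝ} (hst : s ≤ t) :
    ∫⁻ r in Set.Ioo s t, ENNReal.ofReal (√(t - r))⁻¹ = ENNReal.ofReal (2 * √(t - s)) := by
  have h := lintegral_Ioo_rpow (s := s) (β := 1 / 2) hst (by norm_num)
  have e : ENNReal.ofReal ((t - s) ^ ((1 : ℝ) - 1 / 2) / (1 - 1 / 2)) = ENNReal.ofReal (2 * √(t - s)) := by
    rw [Real.sqrt_eq_rpow]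
    congr 1
    norm_num
    ring
  rw [e] at h
  rw [← h, ← lintegral_indicator measurableSet_Ioo, ← lintegral_indicator measurableSet_Ioo,
    ← lintegral_sub_left_eq_self _ (s + t)]
  refine lintegral_congr fun r => ?_
  have hm : s + t - r ∈ Set.Ioo s t ↔ r ∈ Set.Ioo s t := by
    simp only [Set.mem_Ioo]
    constructor <;> rintro ⟨h1, h2⟩ <;> constructor <;> linarith
  by_cases hr : r ∈ Set.Ioo s t
  · rw [Set.indicator_of_mem hr, Set.indicator_of_mem (hm.2 hr), Real.rpow_neg (by linarith [hr.1]),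
      Real.sqrt_eq_rpow]
    congr 3
    ring
  · rw [Set.indicator_of_notMem hr, Set.indicator_of_notMem (mt hm.1 hr)]

/-- A Beta integral, split at the midpoint: on each half one factor is nonsingular and is replaced
by its value at distance (t-s)/2. -/
theorem exists_lintegral_beta_le {β : ℝ} (hβ0 : 0 ≤ β) (hβ : β < 1) :
    ∃ C : ℝ, 0 < C ∧ ∀ s t : ℝ, s < t →
      ∫⁻ r in Set.Ioo s t, ENNReal.ofReal (√(t - r))⁻¹ * ENNReal.ofReal ((r - s) ^ (-β)) ≤
        ENNReal.ofReal (C * (t - s) ^ (1 / 2 - β)) := by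
  have hβ' : 0 < 1 - β := by linarith
  refine ⟨(2⁻¹ : ℝ) ^ (-(1 / 2) : ℝ) / (1 - β) + (2⁻¹ : ℝ) ^ (-β) * 2, by positivity, fun s t hst => ?_⟩
  have hd : 0 < t - s := by linarith
  set d := t - s
  have hpt : ∀ r ∈ Set.Ioo s t, ENNReal.ofReal (√(t - r))⁻¹ * ENNReal.ofReal ((r - s) ^ (-β)) ≤
      ENNReal.ofReal ((2⁻¹ * d) ^ (-(1 / 2) : ℝ)) * ENNReal.ofReal ((r - s) ^ (-β)) +
      ENNReal.ofReal ((2⁻¹ * d) ^ (-β)) * ENNReal.ofReal (√(t - r))⁻¹ := by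
    rintro r ⟨h1, h2⟩
    rcases le_total (r - s) (2⁻¹ * d) with h | h
    · refine le_add_right ?_
      gcongr
      rw [Real.sqrt_eq_rpow, ← Real.rpow_neg (by linarith)]
      exact Real.rpow_le_rpow_of_nonpos (by positivity) (by simp only [d] at *; linarith) (by norm_num)
    · refine le_add_left ?_
      rw [mul_comm]
      refine mul_le_mul' (ENNReal.ofReal_le_ofReal ?_) le_rfl
      exact Real.rpow_le_rpow_of_nonpos (by positivity) h (neg_nonpos.2 hβ0)
  have hm1 : Measurable fun r : ℝ => ENNReal.ofReal ((r - s) ^ (-β)) := by fun_prop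
  have hm2 : Measurable fun r : ℝ => ENNReal.ofReal (√(t - r))⁻¹ := by fun_prop
  refine (setLIntegral_mono' measurableSet_Ioo hpt).trans (le_of_eq ?_)
  rw [lintegral_add_left (hm1.const_mul _), lintegral_const_mul _ hm1, lintegral_const_mul _ hm2,
    lintegral_Ioo_rpow hst.le hβ, lintegral_Ioo_inv_sqrt hst.le, ← ENNReal.ofReal_mul (by positivity),
    ← ENNReal.ofReal_mul (by positivity), ← ENNReal.ofReal_add (by positivity) (by positivity)]
  congr 1
  rw [Real.mul_rpow (by norm_num) hd.le, Real.mul_rpow (by norm_num) hd.le]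
  have e1 : d ^ (-(1 / 2) : ℝ) * d ^ (1 - β) = d ^ (1 / 2 - β) := by
    rw [← Real.rpow_add hd]; congr 1; ring
  have e2 : d ^ (-β) * √d = d ^ (1 / 2 - β) := by
    rw [Real.sqrt_eq_rpow, ← Real.rpow_add hd]; congr 1; ring
  rw [add_mul, ← e1]
  nth_rewrite 2 [e1]
  rw [← e2]
  ring

/-! ### The integral inequality for the difference of two solutions -/

/-- A constant in the pointwise bound of the gradient of the Oseen tensor. -/
noncomputable def oseenConst : ℝ := exists_oseenGrad_bound.choose

theorem oseenConst_pos : 0 < oseenConst := exists_oseenGrad_bound.choose_spec.1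

theorem abs_oseenGrad_le (i j k : Fin 3) {t : ℝ} (ht : 0 < t) (x : R3) :
    |oseenGrad i j k t x| ≤ oseenConst * ((‖x‖ + √t) ^ 4)⁻¹ :=
  exists_oseenGrad_bound.choose_spec.2 i j k t ht x

/-- A constant in the pointwise bound of the heat kernel. -/
noncomputable def heatConst : ℝ := exists_heatKernel_le.choose

theorem heatConst_pos : 0 < heatConst := exists_heatKernel_le.choose_spec.1

theorem heatKernel_le {t : ℝ} (ht : 0 < t) (x : R3) :
    heatKernel t x ≤ heatConst * (√t * ((‖x‖ + √t) ^ 4)⁻¹) :=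
  exists_heatKernel_le.choose_spec.2 t ht x

/-- The Oseen majorant times √t also dominates the heat kernel, so the same convolution estimates
serve the linear and the bilinear term. -/
theorem enorm_heatKernel_le {t : ℝ} (ht : 0 < t) (x : R3) :
    ‖heatKernel t x‖ₑ ≤ ENNReal.ofReal (heatConst * √t) * majorant t x := by
  have := heatConst_pos
  rw [Real.enorm_of_nonneg (heatKernel_nonneg ht x), majorant, ← ENNReal.ofReal_mul (by positivity)]
  exact ENNReal.ofReal_le_ofReal ((heatKernel_le ht x).trans (by rw [mul_assoc]))

theorem enorm_le_sum_coord (x : R3) : ‖x‖ₑ ≤ ∑ i, ‖x i‖ₑ := by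
  have h : x = ∑ i, EuclideanSpace.single i (x i) := by
    ext j
    simp
  calc ‖x‖ₑ = ‖∑ i, EuclideanSpace.single i (x i)‖ₑ := by rw [← h]
    _ ≤ ∑ i, ‖EuclideanSpace.single i (x i)‖ₑ := enorm_sum_le _ _
    _ = _ := by simp [enorm_eq_nnnorm]

theorem enorm_heatFlow_le {t : ℝ} (ht : 0 < t) (f : R3 → R3) (x : R3) :
    ‖heatFlow t f x‖ₑ ≤ ENNReal.ofReal (heatConst * √t) * ∫⁻ y, majorant t (x - y) * ‖f y‖ₑ := by
  rw [heatFlow, ← lintegral_const_mul' _ _ ENNReal.ofReal_ne_top]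
  refine (enorm_integral_le_lintegral_enorm _).trans (lintegral_mono fun y => ?_)
  rw [enorm_smul, ← mul_assoc]
  exact mul_le_mul' (enorm_heatKernel_le ht _) le_rfl

theorem measurable_heatKernel_conv (t : ℝ) (x : R3) :
    Measurable fun y : R3 => heatKernel t (x - y) :=
  measurable_heatKernel.comp (measurable_const.prodMk (measurable_const.sub measurable_id))

theorem integrable_heatKernel_smul {t : ℝ} (ht : 0 < t) {f : R3 → R3} {M : ℝ≥0}
    (hf : AEStronglyMeasurable f volume) (hM : ∀ᵐ y, ‖f y‖ₑ ≤ M) (x : R3) :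
    Integrable fun y => heatKernel t (x - y) • f y := by
  refine ⟨(measurable_heatKernel_conv t x).aestronglyMeasurable.smul hf, ?_⟩
  have h : ∫⁻ y, ‖heatKernel t (x - y) • f y‖ₑ ≤
      ENNReal.ofReal (heatConst * √t) * ∫⁻ y, majorant t (x - y) * ‖f y‖ₑ := by
    rw [← lintegral_const_mul' _ _ ENNReal.ofReal_ne_top]
    refine lintegral_mono fun y => ?_
    rw [enorm_smul, ← mul_assoc]
    exact mul_le_mul' (enorm_heatKernel_le ht _) le_rfl
  refine (h.trans (mul_le_mul' le_rfl (lintegral_majorant_mul_le ht x hM))).trans_lt ?_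
  exact ENNReal.mul_lt_top ENNReal.ofReal_lt_top (ENNReal.mul_lt_top ENNReal.coe_lt_top
    (ENNReal.mul_lt_top ENNReal.ofReal_lt_top japaneseIntegral_four_ne_top.lt_top))

theorem heatFlow_sub {t : ℝ} (ht : 0 < t) {f g : R3 → R3} {M : ℝ≥0}
    (hf : AEStronglyMeasurable f volume) (hfM : ∀ᵐ y, ‖f y‖ₑ ≤ M)
    (hg : AEStronglyMeasurable g volume) (hgM : ∀ᵐ y, ‖g y‖ₑ ≤ M) (x : R3) :
    heatFlow t (f - g) x = heatFlow t f x - heatFlow t g x := by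
  rw [heatFlow, heatFlow, heatFlow, ← integral_sub (integrable_heatKernel_smul ht hf hfM x)
    (integrable_heatKernel_smul ht hg hgM x)]
  simp [smul_sub]

/-- The integrand in `oseenDiv`, with the explicit form of the kernel. -/
noncomputable def divIntegrand (i : Fin 3) (t : ℝ) (f : R3 → R3) (x y : R3) : ℝ :=
  ∑ j, ∑ k, oseenGrad i j k t (x - y) * (f y j * f y k)

theorem oseenDiv_eq {t : ℝ} (ht : 0 < t) (f : R3 → R3) (i : Fin 3) (x : R3) :
    oseenDiv t f i x = ∫ y, divIntegrand i t f x y := by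
  simp only [oseenDiv, divIntegrand, pd_oseenTensor _ _ _ ht]

theorem abs_quadratic_sub_le (a b : R3) (j k : Fin 3) :
    |a j * a k - b j * b k| ≤ ‖a - b‖ * (‖a‖ + ‖b‖) := by
  have e : a j * a k - b j * b k = a j * (a - b) k + (a - b) j * b k := by
    simp only [PiLp.sub_apply]; ring
  rw [e]
  refine (abs_add_le _ _).trans ?_
  rw [abs_mul, abs_mul]
  have h1 : |a j| * |(a - b) k| ≤ ‖a‖ * ‖a - b‖ := by
    gcongr <;> exact norm_coord_le _ _
  have h2 : |(a - b) j| * |b k| ≤ ‖a - b‖ * ‖b‖ := by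
    gcongr <;> exact norm_coord_le _ _
  linarith

theorem enorm_divIntegrand_sub_le (i : Fin 3) {t : ℝ} (ht : 0 < t) (f g : R3 → R3) (x y : R3) :
    ‖divIntegrand i t f x y - divIntegrand i t g x y‖ₑ ≤ ENNReal.ofReal (9 * oseenConst) *
      (majorant t (x - y) * (‖f y - g y‖ₑ * (‖f y‖ₑ + ‖g y‖ₑ))) := by
  have hA := oseenConst_pos
  have h : |divIntegrand i t f x y - divIntegrand i t g x y| ≤ 9 * oseenConst *
      (((‖x - y‖ + √t) ^ 4)⁻¹ * (‖f y - g y‖ * (‖f y‖ + ‖g y‖))) := by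
    have e : divIntegrand i t f x y - divIntegrand i t g x y =
        ∑ j, ∑ k, oseenGrad i j k t (x - y) * (f y j * f y k - g y j * g y k) := by
      simp only [divIntegrand, mul_sub, Finset.sum_sub_distrib]
    rw [e]
    have hb : ∀ j k : Fin 3, |oseenGrad i j k t (x - y) * (f y j * f y k - g y j * g y k)| ≤
        oseenConst * ((‖x - y‖ + √t) ^ 4)⁻¹ * (‖f y - g y‖ * (‖f y‖ + ‖g y‖)) := by
      intro j k
      rw [abs_mul]
      exact mul_le_mul (abs_oseenGrad_le i j k ht _) (abs_quadratic_sub_le _ _ j k)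
        (abs_nonneg _) (by positivity)
    calc _ ≤ ∑ j : Fin 3, ∑ k : Fin 3,
          oseenConst * ((‖x - y‖ + √t) ^ 4)⁻¹ * (‖f y - g y‖ * (‖f y‖ + ‖g y‖)) :=
        (Finset.abs_sum_le_sum_abs _ _).trans (Finset.sum_le_sum fun j _ =>
          (Finset.abs_sum_le_sum_abs _ _).trans (Finset.sum_le_sum fun k _ => hb j k))
      _ = _ := by simp; ring
  rw [← ofReal_norm, ← ofReal_norm (f y - g y), ← ofReal_norm (f y),
    ← ofReal_norm (g y), majorant, ← ENNReal.ofReal_add (by positivity) (by positivity),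
    ← ENNReal.ofReal_mul (by positivity), ← ENNReal.ofReal_mul (by positivity),
    ← ENNReal.ofReal_mul (by positivity)]
  exact ENNReal.ofReal_le_ofReal h

theorem divIntegrand_zero (i : Fin 3) (t : ℝ) (x y : R3) : divIntegrand i t 0 x y = 0 := by
  simp [divIntegrand]

theorem enorm_divIntegrand_le (i : Fin 3) {t : ℝ} (ht : 0 < t) (f : R3 → R3) (x y : R3) :
    ‖divIntegrand i t f x y‖ₑ ≤ ENNReal.ofReal (9 * oseenConst) *
      (majorant t (x - y) * (‖f y‖ₑ * ‖f y‖ₑ)) := by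
  simpa [divIntegrand_zero] using enorm_divIntegrand_sub_le i ht f 0 x y

theorem lintegral_enorm_divIntegrand_le (i : Fin 3) {t : ℝ} (ht : 0 < t) {f : R3 → R3} {M : ℝ≥0}
    (hM : ∀ᵐ y, ‖f y‖ₑ ≤ M) (x : R3) :
    ∫⁻ y, ‖divIntegrand i t f x y‖ₑ ≤ ENNReal.ofReal (9 * oseenConst) *
      ((M * M) * (ENNReal.ofReal (√t)⁻¹ * japaneseIntegral 4)) := by
  refine (lintegral_mono fun y => enorm_divIntegrand_le i ht f x y).trans ?_
  rw [lintegral_const_mul' _ _ ENNReal.ofReal_ne_top]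
  exact mul_le_mul' le_rfl (lintegral_majorant_mul_le ht x (hM.mono fun y hy => mul_le_mul' hy hy))

theorem measurable_oseenGrad_conv (i j k : Fin 3) (t : ℝ) (x : R3) :
    Measurable fun y : R3 => oseenGrad i j k t (x - y) :=
  (stronglyMeasurable_oseenGrad i j k).measurable.comp
    (measurable_const.prodMk (measurable_const.sub measurable_id))

theorem aestronglyMeasurable_apply {α : Type*} [MeasurableSpace α] {μ : Measure α} {f : α → R3}
    (hf : AEStronglyMeasurable f μ) (i : Fin 3) : AEStronglyMeasurable (fun y => f y i) μ :=
  (EuclideanSpace.proj i : R3 →L[ℝ] ℝ).continuous.comp_aestronglyMeasurable hf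

theorem integrable_divIntegrand (i : Fin 3) {t : ℝ} (ht : 0 < t) {f : R3 → R3} {M : ℝ≥0}
    (hf : AEStronglyMeasurable f volume) (hM : ∀ᵐ y, ‖f y‖ₑ ≤ M) (x : R3) :
    Integrable fun y => divIntegrand i t f x y := by
  refine ⟨?_, ?_⟩
  · exact Finset.aestronglyMeasurable_fun_sum _ fun j _ => Finset.aestronglyMeasurable_fun_sum _
      fun k _ => (measurable_oseenGrad_conv i j k t x).aestronglyMeasurable.mul
        ((aestronglyMeasurable_apply hf j).mul (aestronglyMeasurable_apply hf k))
  · refine (lintegral_enorm_divIntegrand_le i ht hM x).trans_lt ?_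
    exact ENNReal.mul_lt_top ENNReal.ofReal_lt_top (ENNReal.mul_lt_top
      (ENNReal.mul_lt_top ENNReal.coe_lt_top ENNReal.coe_lt_top)
      (ENNReal.mul_lt_top ENNReal.ofReal_lt_top japaneseIntegral_four_ne_top.lt_top))

theorem enorm_oseenDiv_sub_le (i : Fin 3) {t : ℝ} (ht : 0 < t) {f g : R3 → R3} {M : ℝ≥0}
    (hf : AEStronglyMeasurable f volume) (hfM : ∀ᵐ y, ‖f y‖ₑ ≤ M)
    (hg : AEStronglyMeasurable g volume) (hgM : ∀ᵐ y, ‖g y‖ₑ ≤ M) (x : R3) :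
    ‖oseenDiv t f i x - oseenDiv t g i x‖ₑ ≤ ENNReal.ofReal (9 * oseenConst) *
      ∫⁻ y, majorant t (x - y) * (‖f y - g y‖ₑ * (‖f y‖ₑ + ‖g y‖ₑ)) := by
  rw [oseenDiv_eq ht, oseenDiv_eq ht, ← integral_sub (integrable_divIntegrand i ht hf hfM x)
    (integrable_divIntegrand i ht hg hgM x), ← lintegral_const_mul' _ _ ENNReal.ofReal_ne_top]
  exact (enorm_integral_le_lintegral_enorm _).trans
    (lintegral_mono fun y => enorm_divIntegrand_sub_le i ht f g x y)

theorem mem_times_of_mem_Icc {S : EReal} {s t r : ℝ} (hs : s ∈ times S) (ht : t ∈ times S)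
    (hr : r ∈ Set.Icc s t) : r ∈ times S :=
  ⟨hs.1.trans_le hr.1, (EReal.coe_le_coe_iff.2 hr.2).trans_lt ht.2⟩

theorem mem_times_of_le {S : EReal} {t r : ℝ} (ht : t ∈ times S) (hr : 0 < r) (hrt : r ≤ t) :
    r ∈ times S := ⟨hr, (EReal.coe_le_coe_iff.2 hrt).trans_lt ht.2⟩

section
variable {S : EReal} {u₀ v₀ : 𝓓'((⊤ : TopologicalSpace.Opens R3), R3)} {u v : ℝ → R3 → R3}
  {s t : ℝ}

theorem IsMildSolution.exists_enorm_le (hu : IsMildSolution S u₀ u) (hs : s ∈ times S)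
    (ht : t ∈ times S) : ∃ M : ℝ≥0, ∀ r ∈ Set.Icc s t, ∀ᵐ x, ‖u r x‖ₑ ≤ M := by
  obtain ⟨M, hM⟩ := hu.locally_bounded s hs t ht
  refine ⟨M.toNNReal, fun r hr => (hM r hr).mono fun x hx => ?_⟩
  rw [← ofReal_norm]
  exact ENNReal.ofReal_le_ofReal hx

theorem IsMildSolution.aestronglyMeasurable_prod (hu : IsMildSolution S u₀ u) (hs : 0 ≤ s)
    (ht : t ∈ times S) : AEStronglyMeasurable (Function.uncurry u)
      ((volume.restrict (Set.Ioo s t)).prod (volume : Measure R3)) := by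
  have h : (volume.restrict (Set.Ioo s t)).prod (volume : Measure R3) =
      (volume : Measure (ℝ × R3)).restrict (Set.Ioo s t ×ˢ Set.univ) := by
    rw [Measure.volume_eq_prod, ← Measure.prod_restrict, Measure.restrict_univ]
  rw [h]
  refine hu.aestronglyMeasurable.mono_measure (Measure.restrict_mono ?_ le_rfl)
  exact Set.prod_mono (fun r hr => mem_times_of_le ht (hs.trans_lt hr.1) hr.2.le) subset_rfl

/-- Needed to write the difference of two Duhamel integrals as one integral. On [s,t] the solution
is bounded, so the integrand is O((t-r)^{-1/2}). -/
theorem IsMildSolution.intervalIntegrable (hu : IsMildSolution S u₀ u) (hs : s ∈ times S)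
    (ht : t ∈ times S) (hst : s < t) (i : Fin 3) (x : R3) :
    IntervalIntegrable (fun r => oseenDiv (t - r) (u r) i x) volume s t := by
  obtain ⟨M, hM⟩ := hu.exists_enorm_le hs ht
  rw [intervalIntegrable_iff_integrableOn_Ioo_of_le hst.le]
  have hcongr : ∀ r ∈ Set.Ioo s t, oseenDiv (t - r) (u r) i x =
      ∫ y, divIntegrand i (t - r) (u r) x y := fun r hr => oseenDiv_eq (sub_pos.2 hr.2) _ _ _
  have hmeas : AEStronglyMeasurable (fun r => ∫ y, divIntegrand i (t - r) (u r) x y)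
      (volume.restrict (Set.Ioo s t)) := by
    have hu' := hu.aestronglyMeasurable_prod hs.1.le ht
    refine AEStronglyMeasurable.integral_prod_right'
      (f := fun z : ℝ × R3 => divIntegrand i (t - z.1) (u z.1) x z.2) ?_
    refine Finset.aestronglyMeasurable_fun_sum _ fun j _ => Finset.aestronglyMeasurable_fun_sum _
      fun k _ => ?_
    refine AEStronglyMeasurable.mul ?_
      ((aestronglyMeasurable_apply hu' j).mul (aestronglyMeasurable_apply hu' k))
    exact ((stronglyMeasurable_oseenGrad i j k).comp_measurable ((measurable_const.sub measurable_fst).prodMk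
      (measurable_const.sub measurable_snd))).aestronglyMeasurable
  have hint : IntegrableOn (fun r => ∫ y, divIntegrand i (t - r) (u r) x y) (Set.Ioo s t) := by
    refine ⟨hmeas, ?_⟩
    have h1 : ∀ r ∈ Set.Ioo s t, ‖∫ y, divIntegrand i (t - r) (u r) x y‖ₑ ≤
        ENNReal.ofReal (√(t - r))⁻¹ *
          (ENNReal.ofReal (9 * oseenConst) * (M * M) * japaneseIntegral 4) := by
      intro r hr
      refine (enorm_integral_le_lintegral_enorm _).trans
        ((lintegral_enorm_divIntegrand_le i (sub_pos.2 hr.2)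
          (hM r (Set.Ioo_subset_Icc_self hr)) x).trans (le_of_eq (by ring)))
    have hC : ENNReal.ofReal (9 * oseenConst) * (M * M) * japaneseIntegral 4 ≠ ∞ :=
      ENNReal.mul_ne_top (ENNReal.mul_ne_top ENNReal.ofReal_ne_top
        (ENNReal.mul_ne_top ENNReal.coe_ne_top ENNReal.coe_ne_top)) japaneseIntegral_four_ne_top
    refine (setLIntegral_mono' measurableSet_Ioo h1).trans_lt ?_
    rw [lintegral_mul_const' _ _ hC, lintegral_Ioo_inv_sqrt hst.le]
    exact ENNReal.mul_lt_top ENNReal.ofReal_lt_top hC.lt_top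
  exact hint.congr_fun (fun r hr => (hcongr r hr).symm) measurableSet_Ioo

/-- The majorant of the bilinear term in the equation for the difference of two solutions. -/
noncomputable def bilinearMajorant (u v : ℝ → R3 → R3) (s t : ℝ) (x : R3) : ℝ≥0∞ :=
  ∫⁻ r in Set.Ioo s t, ∫⁻ y, majorant (t - r) (x - y) *
    (‖u r y - v r y‖ₑ * (‖u r y‖ₑ + ‖v r y‖ₑ))

/-- The constant in front of the bilinear term. -/
noncomputable def bilinearConst : ℝ := 27 * oseenConst

theorem bilinearConst_pos : 0 < bilinearConst := mul_pos (by norm_num) oseenConst_pos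

/-- The pointwise form of the equation for the difference of two mild solutions. -/
theorem IsMildSolution.enorm_sub_le (hu : IsMildSolution S u₀ u) (hv : IsMildSolution S v₀ v)
    (hs : s ∈ times S) (ht : t ∈ times S) (hst : s < t) :
    ∀ᵐ x, ‖u t x - v t x‖ₑ ≤ ‖heatFlow (t - s) (u s - v s) x‖ₑ +
      ENNReal.ofReal bilinearConst * bilinearMajorant u v s t x := by
  obtain ⟨M₁, hM₁⟩ := hu.exists_enorm_le hs ht
  obtain ⟨M₂, hM₂⟩ := hv.exists_enorm_le hs ht
  have hM₁' : ∀ r ∈ Set.Icc s t, ∀ᵐ x, ‖u r x‖ₑ ≤ (max M₁ M₂ : ℝ≥0) := fun r hr =>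
    (hM₁ r hr).mono fun x hx => hx.trans (by exact_mod_cast le_max_left _ _)
  have hM₂' : ∀ r ∈ Set.Icc s t, ∀ᵐ x, ‖v r x‖ₑ ≤ (max M₁ M₂ : ℝ≥0) := fun r hr =>
    (hM₂ r hr).mono fun x hx => hx.trans (by exact_mod_cast le_max_right _ _)
  have hsI : s ∈ Set.Icc s t := ⟨le_rfl, hst.le⟩
  have hdu := ae_all_iff.2 (hu.duhamel s hs t ht hst)
  have hdv := ae_all_iff.2 (hv.duhamel s hs t ht hst)
  filter_upwards [hdu, hdv] with x hux hvx
  rw [heatFlow_sub (sub_pos.2 hst) (hu.aestronglyMeasurable_slice s hs) (hM₁' s hsI)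
    (hv.aestronglyMeasurable_slice s hs) (hM₂' s hsI)]
  set H := heatFlow (t - s) (u s) x - heatFlow (t - s) (v s) x
  have hcoord : ∀ i, ‖(u t x - v t x - H) i‖ₑ ≤
      ENNReal.ofReal (9 * oseenConst) * bilinearMajorant u v s t x := by
    intro i
    have e : (u t x - v t x - H) i =
        -∫ r in s..t, (oseenDiv (t - r) (u r) i x - oseenDiv (t - r) (v r) i x) := by
      rw [intervalIntegral.integral_sub (hu.intervalIntegrable hs ht hst i x)
        (hv.intervalIntegrable hs ht hst i x)]
      simp only [H, PiLp.sub_apply, hux i, hvx i]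
      ring
    rw [e, enorm_neg, intervalIntegral.integral_of_le hst.le, integral_Ioc_eq_integral_Ioo,
      bilinearMajorant, ← lintegral_const_mul' _ _ ENNReal.ofReal_ne_top]
    refine (enorm_integral_le_lintegral_enorm _).trans (setLIntegral_mono' measurableSet_Ioo ?_)
    intro r hr
    have hrI := Set.Ioo_subset_Icc_self hr
    have hrS := mem_times_of_mem_Icc hs ht hrI
    exact enorm_oseenDiv_sub_le i (sub_pos.2 hr.2) (hu.aestronglyMeasurable_slice r hrS)
      (hM₁' r hrI) (hv.aestronglyMeasurable_slice r hrS) (hM₂' r hrI) x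
  calc ‖u t x - v t x‖ₑ = ‖H + (u t x - v t x - H)‖ₑ := by congr 1; abel
    _ ≤ ‖H‖ₑ + ‖u t x - v t x - H‖ₑ := enorm_add_le _ _
    _ ≤ ‖H‖ₑ + ∑ i : Fin 3, ENNReal.ofReal (9 * oseenConst) * bilinearMajorant u v s t x := by
        gcongr
        exact (enorm_le_sum_coord _).trans (Finset.sum_le_sum fun i _ => hcoord i)
    _ = _ := by
        have hA := oseenConst_pos
        -- The factor 27 is 3 · 9: three components of the vector, nine index pairs in each.
        rw [Finset.sum_const, Finset.card_univ, Fintype.card_fin, nsmul_eq_mul, ← mul_assoc,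
          bilinearConst, show 27 * oseenConst = 3 * (9 * oseenConst) by ring,
          ENNReal.ofReal_mul (by norm_num : (0 : ℝ) ≤ 3)]
        norm_num

/-- Taking v = 0 in the inequality for differences yields the bound for a single solution. -/
theorem isMildSolution_zero : IsMildSolution S 0 (0 : ℝ → R3 → R3) where
  aestronglyMeasurable := aestronglyMeasurable_const
  aestronglyMeasurable_slice _ _ := aestronglyMeasurable_const
  locally_bounded _ _ _ _ := ⟨0, fun _ _ => ae_of_all _ fun _ => by simp⟩
  divergence_free _ _ _ := by simp
  duhamel _ _ _ _ _ _ := ae_of_all _ fun _ => by simp [heatFlow, oseenDiv]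
  initial_data _ := by simp

theorem IsMildSolution.enorm_le (hu : IsMildSolution S u₀ u)
    (hs : s ∈ times S) (ht : t ∈ times S) (hst : s < t) :
    ∀ᵐ x, ‖u t x‖ₑ ≤ ‖heatFlow (t - s) (u s) x‖ₑ +
      ENNReal.ofReal bilinearConst * bilinearMajorant u 0 s t x := by
  simpa using hu.enorm_sub_le isMildSolution_zero hs ht hst

end

/-! ### Removing the heat term by letting the initial time tend to zero -/

theorem majorant_le {t : ℝ} (ht : 0 < t) (x : R3) : majorant t x ≤ ENNReal.ofReal (t ^ 2)⁻¹ := by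
  refine ENNReal.ofReal_le_ofReal ?_
  have hτ : 0 < √t := Real.sqrt_pos.2 ht
  have e : t ^ 2 = √t ^ 4 := by
    rw [show √t ^ 4 = (√t ^ 2) ^ 2 by ring, Real.sq_sqrt ht.le]
  rw [e]
  gcongr
  linarith [norm_nonneg x]

/-- Split at |y| = √t. Inside, the kernel is at most t^{-2} and 1/|y| integrates to a multiple of t;
outside, 1/|y| ≤ t^{-1/2} and the kernel has mass of order t^{-1/2}. -/
theorem lintegral_majorant_mul_inv_norm_le {t : ℝ} (ht : 0 < t) (x : R3) :
    ∫⁻ y, majorant t (x - y) * ENNReal.ofReal ‖y‖⁻¹ ≤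
      ENNReal.ofReal t⁻¹ * (ballIntegral + japaneseIntegral 4) := by
  have hτ : 0 < √t := Real.sqrt_pos.2 ht
  have hpt : ∀ y : R3, majorant t (x - y) * ENNReal.ofReal ‖y‖⁻¹ ≤
      ENNReal.ofReal (t ^ 2)⁻¹ *
        (Metric.ball (0 : R3) (√t)).indicator (fun y => ENNReal.ofReal ‖y‖⁻¹) y +
      ENNReal.ofReal (√t)⁻¹ * majorant t (x - y) := by
    intro y
    by_cases hy : y ∈ Metric.ball (0 : R3) (√t)
    · rw [Set.indicator_of_mem hy]
      exact le_add_right (mul_le_mul' (majorant_le ht _) le_rfl)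
    · refine le_add_left ?_
      rw [mul_comm]
      refine mul_le_mul' (ENNReal.ofReal_le_ofReal ?_) le_rfl
      rw [mem_ball_zero_iff, not_lt] at hy
      exact inv_anti₀ hτ hy
  refine (lintegral_mono hpt).trans (le_of_eq ?_)
  rw [lintegral_add_right _ ((measurable_majorant_conv_left t x).const_mul _),
    lintegral_const_mul' _ _ ENNReal.ofReal_ne_top, lintegral_const_mul' _ _ ENNReal.ofReal_ne_top,
    lintegral_indicator Metric.isOpen_ball.measurableSet, lintegral_ball_inv_norm hτ,
    lintegral_majorant_sub ht, ← mul_assoc, ← mul_assoc, ← ENNReal.ofReal_mul (by positivity),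
    ← ENNReal.ofReal_mul (by positivity), Real.sq_sqrt ht.le, mul_add]
  congr 3
  · field_simp
  · rw [← mul_inv, Real.mul_self_sqrt ht.le]

theorem lintegral_majorant_mul_inv_norm_ne_top {t : ℝ} (ht : 0 < t) (x : R3) :
    ∫⁻ y, majorant t (x - y) * ENNReal.ofReal ‖y‖⁻¹ ≠ ∞ :=
  ne_top_of_le_ne_top (ENNReal.mul_ne_top ENNReal.ofReal_ne_top
    (ENNReal.add_ne_top.2 ⟨ballIntegral_ne_top, japaneseIntegral_four_ne_top⟩))
    (lintegral_majorant_mul_inv_norm_le ht x)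

theorem contDiff_heatKernel_conv (t : ℝ) (x : R3) :
    ContDiff ℝ ((⊤ : ℕ∞) : WithTop ℕ∞) fun y => heatKernel t (x - y) := by
  unfold heatKernel
  have h : ContDiff ℝ ((⊤ : ℕ∞) : WithTop ℕ∞) fun y : R3 => ‖x - y‖ ^ 2 :=
    (contDiff_const.sub contDiff_id).norm_sq ℝ
  exact contDiff_const.mul ((h.neg.div_const _).exp)

/-- A smooth cutoff which equals one on the ball of radius `n + 1`. -/
noncomputable def cutoff (n : ℕ) : ContDiffBump (0 : R3) where
  rIn := n + 1
  rOut := n + 2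
  rIn_pos := by positivity
  rIn_lt_rOut := by linarith

theorem tendsto_cutoff (y : R3) : Tendsto (fun n => cutoff n y) atTop (𝓝 1) := by
  refine tendsto_const_nhds.congr' ?_
  obtain ⟨N, hN⟩ := exists_nat_ge ‖y‖
  filter_upwards [eventually_ge_atTop N] with n hn
  refine ((cutoff n).one_of_mem_closedBall ?_).symm
  rw [mem_closedBall_zero_iff]
  have : (N : ℝ) ≤ n := by exact_mod_cast hn
  simp only [cutoff]
  linarith

/-- The heat kernel based at `x`, cut off at infinity. -/
noncomputable def cutoffHeatKernel (t : ℝ) (x : R3) (n : ℕ) :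
    𝓓((⊤ : TopologicalSpace.Opens R3), ℝ) :=
  ⟨fun y => cutoff n y * heatKernel t (x - y),
    (cutoff n).contDiff.mul (contDiff_heatKernel_conv t x),
    (cutoff n).hasCompactSupport.mul_right, fun _ _ => trivial⟩

theorem cutoffHeatKernel_apply (t : ℝ) (x : R3) (n : ℕ) (y : R3) :
    cutoffHeatKernel t x n y = cutoff n y * heatKernel t (x - y) := rfl

theorem integrable_testFunction_smul (φ : 𝓓((⊤ : TopologicalSpace.Opens R3), ℝ)) {f : R3 → R3}
    {M : ℝ≥0} (hf : AEStronglyMeasurable f volume) (hM : ∀ᵐ y, ‖f y‖ₑ ≤ M) :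
    Integrable fun y => φ y • f y := by
  have h : Integrable φ := φ.continuous.integrable_of_hasCompactSupport φ.hasCompactSupport
  refine (h.norm.mul_const (M : ℝ)).mono' (h.aestronglyMeasurable.smul hf) (hM.mono fun y hy => ?_)
  rw [norm_smul]
  refine mul_le_mul_of_nonneg_left ?_ (norm_nonneg _)
  rw [enorm_le_coe] at hy
  exact_mod_cast hy

section
variable {S : EReal} {u₀ v₀ : 𝓓'((⊤ : TopologicalSpace.Opens R3), R3)} {u v : ℝ → R3 → R3}
  {s t c₁ : ℝ}

theorem IsMildSolution.exists_enorm_slice_le (hu : IsMildSolution S u₀ u) (ht : t ∈ times S) :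
    ∃ M : ℝ≥0, ∀ᵐ x, ‖u t x‖ₑ ≤ M := by
  obtain ⟨M, hM⟩ := hu.exists_enorm_le ht ht
  exact ⟨M, hM t ⟨le_rfl, le_rfl⟩⟩

theorem IsMildSolution.tendsto_testFunction (hu : IsMildSolution S u₀ u)
    (hv : IsMildSolution S u₀ v) (ht : t ∈ times S) (φ : 𝓓((⊤ : TopologicalSpace.Opens R3), ℝ)) :
    Tendsto (fun s => ∫ x, φ x • (u s - v s) x) (𝓝[>] 0) (𝓝 0) := by
  have h := (hu.initial_data φ).sub (hv.initial_data φ)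
  rw [sub_self] at h
  refine h.congr' ?_
  filter_upwards [Ioo_mem_nhdsGT ht.1] with s hs
  have hsS := mem_times_of_le ht hs.1 hs.2.le
  obtain ⟨M₁, hM₁⟩ := hu.exists_enorm_slice_le hsS
  obtain ⟨M₂, hM₂⟩ := hv.exists_enorm_slice_le hsS
  rw [← integral_sub (integrable_testFunction_smul φ (hu.aestronglyMeasurable_slice s hsS) hM₁)
    (integrable_testFunction_smul φ (hv.aestronglyMeasurable_slice s hsS) hM₂)]
  simp [smul_sub]

theorem CenteredTypeI.enorm_add_le (h : CenteredTypeI S c₁ u v) (ht : t ∈ times S) :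
    ∀ᵐ x, ‖u t x‖ₑ + ‖v t x‖ₑ ≤ ENNReal.ofReal (c₁ / (‖x‖ + √t)) := by
  filter_upwards [h t ht] with x hx
  rw [← ofReal_norm, ← ofReal_norm,
    ← ENNReal.ofReal_add (norm_nonneg _) (norm_nonneg _)]
  exact ENNReal.ofReal_le_ofReal hx

theorem CenteredTypeI.enorm_sub_le (h : CenteredTypeI S c₁ u v) (ht : t ∈ times S) :
    ∀ᵐ x, ‖u t x - v t x‖ₑ ≤ ENNReal.ofReal (c₁ / (‖x‖ + √t)) :=
  (h.enorm_add_le ht).mono fun _ hx => _root_.enorm_sub_le.trans hx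

/-- Dropping √t gives a bound independent of time, hence a dominating function for the limit t → 0.
-/
theorem CenteredTypeI.enorm_sub_le_inv_norm (hc : 0 < c₁) (h : CenteredTypeI S c₁ u v)
    (ht : t ∈ times S) :
    ∀ᵐ x, ‖u t x - v t x‖ₑ ≤ ENNReal.ofReal c₁ * ENNReal.ofReal ‖x‖⁻¹ := by
  -- The origin is excluded because `0⁻¹ = 0` would make the right side vanish there.
  have h0 : ∀ᵐ x : R3, x ≠ 0 := by simp [ae_iff]
  filter_upwards [h.enorm_sub_le ht, h0] with x hx hx0
  refine hx.trans ?_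
  rw [← ENNReal.ofReal_mul hc.le, div_eq_mul_inv]
  have := norm_pos_iff.2 hx0
  refine ENNReal.ofReal_le_ofReal ?_
  gcongr
  linarith [Real.sqrt_nonneg t]

theorem measurable_ofReal_inv_norm : Measurable fun y : R3 => ENNReal.ofReal ‖y‖⁻¹ := by fun_prop

theorem enorm_heatKernel_le_of_half_le (ht : 0 < t) (hs : t / 2 ≤ s) (hst : s ≤ t) (x : R3) :
    ‖heatKernel s x‖ₑ ≤ ENNReal.ofReal (heatConst * √t) * majorant (t / 2) x := by
  have h2 : 0 < √(t / 2) := Real.sqrt_pos.2 (by linarith)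
  have := heatConst_pos
  refine (enorm_heatKernel_le (by linarith) x).trans (mul_le_mul' ?_ ?_)
  · exact ENNReal.ofReal_le_ofReal (by gcongr)
  · exact ENNReal.ofReal_le_ofReal (by gcongr)

/-- Dominated convergence: for s < t/2 both kernels lie below a multiple of the majorant at time
t/2, which is integrable against 1/|y|. -/
theorem tendsto_lintegral_heatKernel_sub (ht : 0 < t) (x : R3) :
    Tendsto (fun s => ∫⁻ y, ‖heatKernel (t - s) (x - y) - heatKernel t (x - y)‖ₑ *
      ENNReal.ofReal ‖y‖⁻¹) (𝓝[>] 0) (𝓝 0) := by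
  have hlim : ∀ y : R3, Tendsto (fun s => ‖heatKernel (t - s) (x - y) - heatKernel t (x - y)‖ₑ *
      ENNReal.ofReal ‖y‖⁻¹) (𝓝[>] 0) (𝓝 0) := by
    intro y
    have hc : ContinuousAt (fun s => heatKernel (t - s) (x - y)) 0 := by
      unfold heatKernel
      have hb : 4 * Real.pi * (t - 0) ≠ 0 := by
        rw [sub_zero]; positivity
      have hb' : 4 * (t - 0) ≠ 0 := by
        rw [sub_zero]; positivity
      refine ContinuousAt.mul ?_ ?_
      · exact ContinuousAt.rpow_const (by fun_prop) (Or.inl hb)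
      · exact Real.continuous_exp.continuousAt.comp
          (ContinuousAt.div continuousAt_const (by fun_prop) hb')
    have h1 : Tendsto (fun s => heatKernel (t - s) (x - y) - heatKernel t (x - y)) (𝓝[>] 0) (𝓝 0) := by
      have := (hc.tendsto.mono_left (nhdsWithin_le_nhds (s := Set.Ioi 0))).sub_const
        (heatKernel t (x - y))
      simpa using this
    have h2 : Tendsto (fun s => ‖heatKernel (t - s) (x - y) - heatKernel t (x - y)‖ₑ) (𝓝[>] 0) (𝓝 0) := by
      simpa using h1.enorm
    simpa using ENNReal.Tendsto.mul_const h2 (Or.inr ENNReal.ofReal_ne_top) (b := ENNReal.ofReal ‖y‖⁻¹)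
  have key := tendsto_lintegral_filter_of_dominated_convergence (μ := (volume : Measure R3))
    (l := 𝓝[>] (0 : ℝ)) (F := fun s y => ‖heatKernel (t - s) (x - y) - heatKernel t (x - y)‖ₑ *
      ENNReal.ofReal ‖y‖⁻¹) (f := fun _ => 0)
    (fun y => ENNReal.ofReal (heatConst * √t) * 2 * (majorant (t / 2) (x - y) * ENNReal.ofReal ‖y‖⁻¹))
    ?_ ?_ ?_ (ae_of_all _ hlim)
  · simpa using key
  · exact Eventually.of_forall fun s => (((measurable_heatKernel_conv (t - s) x).sub
      (measurable_heatKernel_conv t x)).enorm.mul measurable_ofReal_inv_norm)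
  · filter_upwards [Ioo_mem_nhdsGT (half_pos ht)] with s hs
    refine ae_of_all _ fun y => ?_
    have h1 := enorm_heatKernel_le_of_half_le ht (s := t - s) (by linarith [hs.2])
      (by linarith [hs.1]) (x - y)
    have h2 := enorm_heatKernel_le_of_half_le ht (s := t) (by linarith) le_rfl (x - y)
    calc _ ≤ (‖heatKernel (t - s) (x - y)‖ₑ + ‖heatKernel t (x - y)‖ₑ) * ENNReal.ofReal ‖y‖⁻¹ :=
          mul_le_mul' enorm_sub_le le_rfl
      _ ≤ (ENNReal.ofReal (heatConst * √t) * majorant (t / 2) (x - y) +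
          ENNReal.ofReal (heatConst * √t) * majorant (t / 2) (x - y)) * ENNReal.ofReal ‖y‖⁻¹ :=
          mul_le_mul' (add_le_add h1 h2) le_rfl
      _ = _ := by ring
  · rw [lintegral_const_mul' _ _ (ENNReal.mul_ne_top ENNReal.ofReal_ne_top (by simp))]
    exact ENNReal.mul_ne_top (ENNReal.mul_ne_top ENNReal.ofReal_ne_top (by simp))
      (lintegral_majorant_mul_inv_norm_ne_top (half_pos ht) x)

theorem tendsto_lintegral_cutoff (ht : 0 < t) (x : R3) :
    Tendsto (fun n => ∫⁻ y, ‖heatKernel t (x - y) - cutoffHeatKernel t x n y‖ₑ *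
      ENNReal.ofReal ‖y‖⁻¹) atTop (𝓝 0) := by
  have e : ∀ n y, heatKernel t (x - y) - cutoffHeatKernel t x n y =
      (1 - cutoff n y) * heatKernel t (x - y) := by
    intro n y
    rw [cutoffHeatKernel_apply]
    ring
  simp only [e]
  have key := tendsto_lintegral_filter_of_dominated_convergence (μ := (volume : Measure R3))
    (l := atTop) (F := fun n y => ‖(1 - cutoff n y) * heatKernel t (x - y)‖ₑ *
      ENNReal.ofReal ‖y‖⁻¹) (f := fun _ => 0)
    (fun y => ENNReal.ofReal (heatConst * √t) * (majorant t (x - y) * ENNReal.ofReal ‖y‖⁻¹))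
    ?_ ?_ ?_ (ae_of_all _ fun y => ?_)
  · simpa using key
  · refine Eventually.of_forall fun n => ?_
    have hc : Measurable fun y => cutoff n y := (cutoff n).continuous.measurable
    exact ((measurable_const.sub hc).mul (measurable_heatKernel_conv t x)).enorm.mul
      measurable_ofReal_inv_norm
  · refine Eventually.of_forall fun n => ae_of_all _ fun y => ?_
    rw [← mul_assoc, enorm_mul]
    refine mul_le_mul' ?_ le_rfl
    refine (mul_le_mul' ?_ (enorm_heatKernel_le ht _)).trans (one_mul _).le
    rw [Real.enorm_of_nonneg (sub_nonneg.2 (cutoff n).le_one), ENNReal.ofReal_le_one]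
    linarith [(cutoff n).nonneg (x := y)]
  · rw [lintegral_const_mul' _ _ ENNReal.ofReal_ne_top]
    exact ENNReal.mul_ne_top ENNReal.ofReal_ne_top (lintegral_majorant_mul_inv_norm_ne_top ht x)
  · have h1 : Tendsto (fun n => (1 - cutoff n y) * heatKernel t (x - y)) atTop (𝓝 0) := by
      simpa using ((tendsto_cutoff y).const_sub 1).mul_const (heatKernel t (x - y))
    have h2 : Tendsto (fun n => ‖(1 - cutoff n y) * heatKernel t (x - y)‖ₑ) atTop (𝓝 0) := by
      simpa using h1.enorm
    simpa using ENNReal.Tendsto.mul_const h2 (Or.inr ENNReal.ofReal_ne_top) (b := ENNReal.ofReal ‖y‖⁻¹)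

/-- The heat flow of the difference of two Type I solutions with the same data vanishes as the
initial time tends to zero. -/
theorem IsMildSolution.tendsto_heatFlow (hu : IsMildSolution S u₀ u) (hv : IsMildSolution S u₀ v)
    (hc : 0 < c₁) (h : CenteredTypeI S c₁ u v) (ht : t ∈ times S) (x : R3) :
    Tendsto (fun s => ‖heatFlow (t - s) (u s - v s) x‖ₑ) (𝓝[>] 0) (𝓝 0) := by
  -- The initial data are only tested against compactly supported functions, so Γ(t-s) is replaced
  -- by Γ(t), then by its cutoff. Both errors are integrals against c₁/|y| and do not involve w.
  have hbound : ∀ n : ℕ, ∀ s ∈ Set.Ioo 0 t, ‖heatFlow (t - s) (u s - v s) x‖ₑ ≤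
      ‖∫ y, cutoffHeatKernel t x n y • (u s - v s) y‖ₑ + ENNReal.ofReal c₁ *
        ((∫⁻ y, ‖heatKernel (t - s) (x - y) - heatKernel t (x - y)‖ₑ * ENNReal.ofReal ‖y‖⁻¹) +
        ∫⁻ y, ‖heatKernel t (x - y) - cutoffHeatKernel t x n y‖ₑ * ENNReal.ofReal ‖y‖⁻¹) := by
    intro n s hs
    have hsS := mem_times_of_le ht hs.1 hs.2.le
    obtain ⟨M₁, hM₁⟩ := hu.exists_enorm_slice_le hsS
    obtain ⟨M₂, hM₂⟩ := hv.exists_enorm_slice_le hsS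
    have hw : AEStronglyMeasurable (u s - v s) volume :=
      (hu.aestronglyMeasurable_slice s hsS).sub (hv.aestronglyMeasurable_slice s hsS)
    have hwM : ∀ᵐ y, ‖(u s - v s) y‖ₑ ≤ (M₁ + M₂ : ℝ≥0) := by
      filter_upwards [hM₁, hM₂] with y h1 h2
      rw [ENNReal.coe_add]
      exact _root_.enorm_sub_le.trans (add_le_add h1 h2)
    have hi1 := integrable_heatKernel_smul (sub_pos.2 hs.2) hw hwM x
    have hi2 := integrable_testFunction_smul (cutoffHeatKernel t x n) hw hwM
    have e : heatFlow (t - s) (u s - v s) x = (∫ y, cutoffHeatKernel t x n y • (u s - v s) y) +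
        ∫ y, (heatKernel (t - s) (x - y) - cutoffHeatKernel t x n y) • (u s - v s) y := by
      simp only [sub_smul]
      rw [integral_sub hi1 hi2, heatFlow]
      abel
    rw [e]
    refine (_root_.enorm_add_le _ _).trans (add_le_add le_rfl ?_)
    have hm : Measurable fun y => ‖heatKernel (t - s) (x - y) - heatKernel t (x - y)‖ₑ *
        ENNReal.ofReal ‖y‖⁻¹ := ((measurable_heatKernel_conv (t - s) x).sub
      (measurable_heatKernel_conv t x)).enorm.mul measurable_ofReal_inv_norm
    rw [← lintegral_add_left hm, ← lintegral_const_mul' _ _ ENNReal.ofReal_ne_top]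
    refine (enorm_integral_le_lintegral_enorm _).trans (lintegral_mono_ae ?_)
    filter_upwards [h.enorm_sub_le_inv_norm hc hsS] with y hy
    rw [enorm_smul, ← add_mul, mul_left_comm]
    refine mul_le_mul' ?_ hy
    calc _ = ‖(heatKernel (t - s) (x - y) - heatKernel t (x - y)) +
          (heatKernel t (x - y) - cutoffHeatKernel t x n y)‖ₑ := by congr 1; ring
      _ ≤ _ := _root_.enorm_add_le _ _
  have hn : ∀ n : ℕ, Tendsto (fun s => ‖∫ y, cutoffHeatKernel t x n y • (u s - v s) y‖ₑ +
      ENNReal.ofReal c₁ *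
        ((∫⁻ y, ‖heatKernel (t - s) (x - y) - heatKernel t (x - y)‖ₑ * ENNReal.ofReal ‖y‖⁻¹) +
        ∫⁻ y, ‖heatKernel t (x - y) - cutoffHeatKernel t x n y‖ₑ * ENNReal.ofReal ‖y‖⁻¹))
      (𝓝[>] 0) (𝓝 (ENNReal.ofReal c₁ * ∫⁻ y, ‖heatKernel t (x - y) - cutoffHeatKernel t x n y‖ₑ *
        ENNReal.ofReal ‖y‖⁻¹)) := by
    intro n
    have h1 : Tendsto (fun s => ‖∫ y, cutoffHeatKernel t x n y • (u s - v s) y‖ₑ) (𝓝[>] 0) (𝓝 0) := by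
      simpa using (hu.tendsto_testFunction hv ht (cutoffHeatKernel t x n)).enorm
    have h2 := ENNReal.Tendsto.const_mul (a := ENNReal.ofReal c₁)
      ((tendsto_lintegral_heatKernel_sub ht.1 x).add_const
        (∫⁻ y, ‖heatKernel t (x - y) - cutoffHeatKernel t x n y‖ₑ * ENNReal.ofReal ‖y‖⁻¹))
      (Or.inr ENNReal.ofReal_ne_top)
    simpa using h1.add h2
  have hlast : Tendsto (fun n => ENNReal.ofReal c₁ * ∫⁻ y, ‖heatKernel t (x - y) -
      cutoffHeatKernel t x n y‖ₑ * ENNReal.ofReal ‖y‖⁻¹) atTop (𝓝 0) := by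
    simpa using ENNReal.Tendsto.const_mul (a := ENNReal.ofReal c₁)
      (tendsto_lintegral_cutoff ht.1 x) (Or.inr ENNReal.ofReal_ne_top)
  rw [ENNReal.tendsto_nhds_zero]
  intro ε hε
  -- The cutoff is fixed first, uniformly in s; only then does s tend to 0.
  obtain ⟨n, hnε⟩ := (hlast.eventually_lt_const hε).exists
  filter_upwards [Ioo_mem_nhdsGT ht.1, (hn n).eventually_lt_const hnε] with s hs hsε
  exact (hbound n s hs).trans hsε.le

theorem IsMildSolution.enorm_sub_le_bilinearMajorant (hu : IsMildSolution S u₀ u)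
    (hv : IsMildSolution S u₀ v) (hc : 0 < c₁) (h : CenteredTypeI S c₁ u v) (ht : t ∈ times S) :
    ∀ᵐ x, ‖u t x - v t x‖ₑ ≤ ENNReal.ofReal bilinearConst * bilinearMajorant u v 0 t x := by
  have ht0 : 0 < t := ht.1
  have hpos : ∀ n : ℕ, 0 < t / (n + 2) := fun n => by positivity
  have hlt : ∀ n : ℕ, t / (n + 2) < t := fun n =>
    div_lt_self ht0 (by have : (0 : ℝ) ≤ n := Nat.cast_nonneg n; linarith)
  -- The exceptional null set depends on s, so s runs through a sequence only. The shift by 2 keeps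
  -- every term strictly below t.
  have hsn : Tendsto (fun n : ℕ => t / ((n : ℝ) + 2)) atTop (𝓝[>] 0) := by
    refine tendsto_nhdsWithin_iff.2 ⟨?_, Eventually.of_forall hpos⟩
    exact (tendsto_atTop_add_const_right _ 2 tendsto_natCast_atTop_atTop).const_div_atTop t
  have hall := ae_all_iff.2 fun n : ℕ =>
    hu.enorm_sub_le hv (mem_times_of_le ht (hpos n) (hlt n).le) ht (hlt n)
  filter_upwards [hall] with x hx
  have hlim := ((hu.tendsto_heatFlow hv hc h ht x).comp hsn).add_const
    (ENNReal.ofReal bilinearConst * bilinearMajorant u v 0 t x)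
  rw [zero_add] at hlim
  refine ge_of_tendsto' hlim fun n => (hx n).trans (add_le_add le_rfl (mul_le_mul' le_rfl ?_))
  exact lintegral_mono_set (Set.Ioo_subset_Ioo_left (hpos n).le)

end

/-! ### Spatial decay of the difference: the upper bound -/

theorem lintegral_Ioo_inv_sqrt_left {s t : ℝ} (hst : s ≤ t) :
    ∫⁻ r in Set.Ioo s t, ENNReal.ofReal (√(r - s))⁻¹ = ENNReal.ofReal (2 * √(t - s)) := by
  have h := lintegral_Ioo_rpow (s := s) (β := 1 / 2) hst (by norm_num)
  have e : ENNReal.ofReal ((t - s) ^ ((1 : ℝ) - 1 / 2) / (1 - 1 / 2)) = ENNReal.ofReal (2 * √(t - s)) := by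
    rw [Real.sqrt_eq_rpow]
    congr 1
    norm_num
    ring
  rw [← e, ← h]
  refine setLIntegral_congr_fun measurableSet_Ioo fun r hr => ?_
  rw [Real.rpow_neg (by linarith [hr.1]), Real.sqrt_eq_rpow]

theorem majorant_le_of_norm_le (t : ℝ) {x y : R3} (hy : 2 * ‖y‖ ≤ ‖x‖) (hx : 0 < ‖x‖) :
    majorant t (x - y) ≤ ENNReal.ofReal (16 * (‖x‖ ^ 4)⁻¹) := by
  refine ENNReal.ofReal_le_ofReal ?_
  have h1 : ‖x‖ / 2 ≤ ‖x - y‖ + √t := by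
    have := norm_sub_norm_le x y
    have := Real.sqrt_nonneg t
    linarith
  have e : 16 * (‖x‖ ^ 4)⁻¹ = ((‖x‖ / 2) ^ 4)⁻¹ := by field_simp; norm_num
  rw [e]
  gcongr

/-- The spatial decay gained in one step of the Picard iteration. -/
theorem lintegral_majorant_decay_le {k : ℕ} (hk : k ≤ 2) {t : ℝ} (ht : 0 < t) {x : R3}
    (hx : √t ≤ ‖x‖) {f : ℝ → R3 → ℝ≥0∞}
    (hf : ∀ r ∈ Set.Ioo 0 t, ∀ᵐ y, f r y ≤ ENNReal.ofReal (√r ^ k / (‖y‖ + √r) ^ (k + 2))) :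
    ∫⁻ r in Set.Ioo 0 t, ∫⁻ y, majorant (t - r) (x - y) * f r y ≤
      ENNReal.ofReal (160 * (√t ^ (k + 1) / ‖x‖ ^ (k + 2))) * japaneseIntegral 4 := by
  have hτ : 0 < √t := Real.sqrt_pos.2 ht
  have hx0 : 0 < ‖x‖ := hτ.trans_le hx
  set A : ℝ := 16 * (√t ^ k / ‖x‖ ^ (k + 2))
  set B : ℝ := 64 * (√t ^ k / ‖x‖ ^ (k + 2))
  have hA0 : 0 ≤ A := by positivity
  have hB0 : 0 ≤ B := by positivity
  have hpt : ∀ r ∈ Set.Ioo 0 t, ∀ y : R3, majorant (t - r) (x - y) *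
      ENNReal.ofReal (√r ^ k / (‖y‖ + √r) ^ (k + 2)) ≤
      ENNReal.ofReal A * majorant (t - r) (x - y) + ENNReal.ofReal B * majorant r y := by
    rintro r ⟨hr0, hrt⟩ y
    have hσ : 0 < √r := Real.sqrt_pos.2 hr0
    have hστ : √r ≤ √t := Real.sqrt_le_sqrt hrt.le
    -- For |y| ≥ |x|/2 the bound of f is replaced by its size at |x|/2 and the mass of the kernel is
    -- used. For |y| ≤ |x|/2 the kernel is at most 16|x|^{-4} and the mass of f is used.
    rcases le_total ‖x‖ (2 * ‖y‖) with h | h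
    · refine le_add_right ?_
      rw [mul_comm]
      refine mul_le_mul' (ENNReal.ofReal_le_ofReal ?_) le_rfl
      have h1 : (‖x‖ / 2) ^ (k + 2) ≤ (‖y‖ + √r) ^ (k + 2) := by
        gcongr
        linarith
      calc √r ^ k / (‖y‖ + √r) ^ (k + 2) ≤ √t ^ k / (‖x‖ / 2) ^ (k + 2) := by gcongr
        _ = 2 ^ (k + 2) * (√t ^ k / ‖x‖ ^ (k + 2)) := by rw [div_pow]; field_simp
        _ ≤ 2 ^ (2 + 2) * (√t ^ k / ‖x‖ ^ (k + 2)) := by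
          gcongr
          norm_num
        _ = A := by norm_num [A]
    · refine le_add_left ?_
      have h1 := majorant_le_of_norm_le (t - r) h hx0
      refine (mul_le_mul' h1 le_rfl).trans ?_
      rw [majorant, ← ENNReal.ofReal_mul (by positivity), ← ENNReal.ofReal_mul hB0]
      refine ENNReal.ofReal_le_ofReal ?_
      have h2 : ‖y‖ + √r ≤ 2 * ‖x‖ := by linarith
      -- Here k ≤ 2 matters: the weight of f decays no faster than the power -4, so the missing
      -- factor (|y|+√r)^{2-k} is bounded by (2|x|)^{2-k}. Beyond k = 2 the kernel's own decay
      -- |x|^{-4} would be the obstruction.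
      have h3 : (‖y‖ + √r) ^ (2 - k) ≤ (2 * ‖x‖) ^ (2 - k) := by gcongr
      have h4 : √r ^ k / (‖y‖ + √r) ^ (k + 2) = √r ^ k * (‖y‖ + √r) ^ (2 - k) * ((‖y‖ + √r) ^ 4)⁻¹ := by
        have : (‖y‖ + √r) ^ 4 = (‖y‖ + √r) ^ (k + 2) * (‖y‖ + √r) ^ (2 - k) := by
          rw [← pow_add]; congr 1; omega
        rw [this]
        field_simp
      have h5 : (2 * ‖x‖) ^ (2 - k) = 2 ^ (2 - k) * (‖x‖ ^ 4 * (‖x‖ ^ (k + 2))⁻¹) := by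
        have : ‖x‖ ^ 4 = ‖x‖ ^ (k + 2) * ‖x‖ ^ (2 - k) := by
          rw [← pow_add]; congr 1; omega
        rw [this, mul_pow]
        field_simp
      rw [h4]
      calc 16 * (‖x‖ ^ 4)⁻¹ * (√r ^ k * (‖y‖ + √r) ^ (2 - k) * ((‖y‖ + √r) ^ 4)⁻¹)
          ≤ 16 * (‖x‖ ^ 4)⁻¹ * (√t ^ k * (2 * ‖x‖) ^ (2 - k) * ((‖y‖ + √r) ^ 4)⁻¹) := by gcongr
        _ = 2 ^ (2 - k) * (16 * (√t ^ k / ‖x‖ ^ (k + 2)) * ((‖y‖ + √r) ^ 4)⁻¹) := by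
          rw [h5]; field_simp
        _ ≤ 2 ^ 2 * (16 * (√t ^ k / ‖x‖ ^ (k + 2)) * ((‖y‖ + √r) ^ 4)⁻¹) := by
          gcongr
          · norm_num
          · omega
        _ = B * ((‖y‖ + √r) ^ 4)⁻¹ := by simp only [B]; ring
  have hinner : ∀ r ∈ Set.Ioo 0 t, ∫⁻ y, majorant (t - r) (x - y) * f r y ≤
      ENNReal.ofReal A * (ENNReal.ofReal (√(t - r))⁻¹ * japaneseIntegral 4) +
      ENNReal.ofReal B * (ENNReal.ofReal (√(r - 0))⁻¹ * japaneseIntegral 4) := by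
    intro r hr
    rw [sub_zero, ← lintegral_majorant_sub (sub_pos.2 hr.2) x, ← lintegral_majorant hr.1,
      ← lintegral_const_mul' _ _ ENNReal.ofReal_ne_top, ← lintegral_const_mul' _ _ ENNReal.ofReal_ne_top,
      ← lintegral_add_left ((measurable_majorant_conv_left (t - r) x).const_mul _)]
    refine lintegral_mono_ae ((hf r hr).mono fun y hy => ?_)
    exact (mul_le_mul' le_rfl hy).trans (hpt r hr y)
  refine (setLIntegral_mono' measurableSet_Ioo hinner).trans (le_of_eq ?_)
  have hm : Measurable fun r : ℝ => ENNReal.ofReal (√(t - r))⁻¹ * japaneseIntegral 4 := by fun_prop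
  rw [lintegral_add_left (hm.const_mul _), lintegral_const_mul' _ _ ENNReal.ofReal_ne_top,
    lintegral_const_mul' _ _ ENNReal.ofReal_ne_top,
    lintegral_mul_const' _ _ japaneseIntegral_four_ne_top,
    lintegral_mul_const' _ _ japaneseIntegral_four_ne_top,
    lintegral_Ioo_inv_sqrt ht.le, lintegral_Ioo_inv_sqrt_left ht.le, ← mul_assoc, ← mul_assoc,
    ← add_mul, ← ENNReal.ofReal_mul hA0, ← ENNReal.ofReal_mul hB0,
    ← ENNReal.ofReal_add (by positivity) (by positivity), sub_zero]
  congr 2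
  simp only [A, B]
  field_simp
  ring

/-- The solutions `u` and `v` differ by at most `D √t^k / (|x| + √t)^{k+1}`. -/
def DifferenceDecay (S : EReal) (D : ℝ) (k : ℕ) (u v : ℝ → R3 → R3) : Prop :=
  ∀ t ∈ times S, ∀ᵐ x, ‖u t x - v t x‖ₑ ≤ ENNReal.ofReal (D * (√t ^ k / (‖x‖ + √t) ^ (k + 1)))

/-- The Type I bound on |u|+|v| supplies one more power of |x|+√t, and the time integral of the
kernel mass supplies the factor √t. For |x| ≤ √t the two weights are comparable, so Type I alone
suffices. -/
theorem exists_differenceDecay_succ {c₁ : ℝ} (hc : 0 < c₁) {k : ℕ} (hk : k ≤ 2) {D : ℝ}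
    (hD : 0 < D) : ∃ D' : ℝ, 0 < D' ∧ ∀ (S : EReal)
      (u₀ : 𝓓'((⊤ : TopologicalSpace.Opens R3), R3)) (u v : ℝ → R3 → R3),
      IsMildSolution S u₀ u → IsMildSolution S u₀ v → CenteredTypeI S c₁ u v →
      DifferenceDecay S D k u v → DifferenceDecay S D' (k + 1) u v := by
  have hB := bilinearConst_pos
  set J := (japaneseIntegral 4).toReal
  have hJ : japaneseIntegral 4 = ENNReal.ofReal J :=
    (ENNReal.ofReal_toReal japaneseIntegral_four_ne_top).symm
  have hJ0 : 0 ≤ J := ENNReal.toReal_nonneg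
  refine ⟨bilinearConst * (D * c₁) * (160 * J) * 16 + 8 * c₁, by positivity, ?_⟩
  intro S u₀ u v hu hv h hdec t ht
  have ht0 : 0 < t := ht.1
  have hτ : 0 < √t := Real.sqrt_pos.2 ht0
  filter_upwards [hu.enorm_sub_le_bilinearMajorant hv hc h ht, h.enorm_sub_le ht] with x hx1 hx2
  rcases le_total (√t) ‖x‖ with hx | hx
  · have hx0 : 0 < ‖x‖ := hτ.trans_le hx
    -- The product is normalized by D c₁ so that it satisfies the decay hypothesis with constant
    -- one.
    have hf : ∀ r ∈ Set.Ioo 0 t, ∀ᵐ y, ENNReal.ofReal (D * c₁)⁻¹ *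
        (‖u r y - v r y‖ₑ * (‖u r y‖ₑ + ‖v r y‖ₑ)) ≤
        ENNReal.ofReal (√r ^ k / (‖y‖ + √r) ^ (k + 2)) := by
      intro r hr
      have hrS := mem_times_of_le ht hr.1 hr.2.le
      have hσ : 0 < √r := Real.sqrt_pos.2 hr.1
      filter_upwards [hdec r hrS, h.enorm_add_le hrS] with y h1 h2
      refine (mul_le_mul' le_rfl (mul_le_mul' h1 h2)).trans (le_of_eq ?_)
      rw [← ENNReal.ofReal_mul (by positivity), ← ENNReal.ofReal_mul (by positivity)]
      congr 1
      field_simp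
      ring
    have h3 := lintegral_majorant_decay_le hk ht0 hx hf
    have h4 : bilinearMajorant u v 0 t x ≤ ENNReal.ofReal (D * c₁) *
        (ENNReal.ofReal (160 * (√t ^ (k + 1) / ‖x‖ ^ (k + 2))) * japaneseIntegral 4) := by
      refine le_trans (le_of_eq ?_) (mul_le_mul' le_rfl h3)
      simp only [mul_left_comm (majorant _ _) (ENNReal.ofReal (D * c₁)⁻¹)]
      simp only [lintegral_const_mul' _ _ (ENNReal.ofReal_ne_top (r := (D * c₁)⁻¹))]
      rw [← mul_assoc, ← ENNReal.ofReal_mul (by positivity), mul_inv_cancel₀ (by positivity),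
        ENNReal.ofReal_one, one_mul, bilinearMajorant]
    refine (hx1.trans (mul_le_mul' le_rfl h4)).trans ?_
    rw [hJ, ← ENNReal.ofReal_mul (by positivity), ← ENNReal.ofReal_mul (by positivity),
      ← ENNReal.ofReal_mul (by positivity)]
    refine ENNReal.ofReal_le_ofReal ?_
    have h5 : (‖x‖ + √t) ^ (k + 1 + 1) ≤ 16 * ‖x‖ ^ (k + 2) := by
      calc (‖x‖ + √t) ^ (k + 2) ≤ (2 * ‖x‖) ^ (k + 2) := by gcongr; linarith
        _ = 2 ^ (k + 2) * ‖x‖ ^ (k + 2) := mul_pow _ _ _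
        _ ≤ 2 ^ (2 + 2) * ‖x‖ ^ (k + 2) := by gcongr; norm_num
        _ = _ := by norm_num
    have h6 : √t ^ (k + 1) / ‖x‖ ^ (k + 2) ≤ 16 * (√t ^ (k + 1) / (‖x‖ + √t) ^ (k + 1 + 1)) := by
      rw [← mul_div_assoc, div_le_div_iff₀ (by positivity) (by positivity)]
      nlinarith [mul_le_mul_of_nonneg_left h5 (pow_nonneg hτ.le (k + 1))]
    calc _ = bilinearConst * (D * c₁) * (160 * J) * (√t ^ (k + 1) / ‖x‖ ^ (k + 2)) := by ring
      _ ≤ bilinearConst * (D * c₁) * (160 * J) * (16 * (√t ^ (k + 1) / (‖x‖ + √t) ^ (k + 1 + 1))) := by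
        gcongr
      _ = bilinearConst * (D * c₁) * (160 * J) * 16 * (√t ^ (k + 1) / (‖x‖ + √t) ^ (k + 1 + 1)) := by
        ring
      _ ≤ _ := by
        gcongr
        linarith
  · refine hx2.trans (ENNReal.ofReal_le_ofReal ?_)
    have h5 : (‖x‖ + √t) ^ (k + 1) ≤ 8 * √t ^ (k + 1) := by
      calc (‖x‖ + √t) ^ (k + 1) ≤ (2 * √t) ^ (k + 1) := by gcongr; linarith
        _ = 2 ^ (k + 1) * √t ^ (k + 1) := mul_pow _ _ _
        _ ≤ 2 ^ (2 + 1) * √t ^ (k + 1) := by gcongr; norm_num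
        _ = _ := by norm_num
    have h6 : c₁ / (‖x‖ + √t) ≤ 8 * c₁ * (√t ^ (k + 1) / (‖x‖ + √t) ^ (k + 1 + 1)) := by
      rw [← mul_div_assoc, div_le_div_iff₀ (by positivity) (by positivity), pow_succ _ (k + 1)]
      have h0 : 0 ≤ c₁ * (‖x‖ + √t) := by positivity
      nlinarith [mul_le_mul_of_nonneg_left h5 h0]
    refine h6.trans ?_
    gcongr
    have : 0 ≤ bilinearConst * (D * c₁) * (160 * J) * 16 := by positivity
    linarith

theorem exists_differenceDecay_three {c₁ : ℝ} (hc : 0 < c₁) : ∃ D : ℝ, 0 < D ∧ ∀ (S : EReal)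
      (u₀ : 𝓓'((⊤ : TopologicalSpace.Opens R3), R3)) (u v : ℝ → R3 → R3),
      IsMildSolution S u₀ u → IsMildSolution S u₀ v → CenteredTypeI S c₁ u v →
      DifferenceDecay S D 3 u v := by
  obtain ⟨D₁, hD₁, h₁⟩ := exists_differenceDecay_succ hc (k := 0) (by norm_num) hc
  obtain ⟨D₂, hD₂, h₂⟩ := exists_differenceDecay_succ hc (k := 1) (by norm_num) hD₁
  obtain ⟨D₃, hD₃, h₃⟩ := exists_differenceDecay_succ hc (k := 2) (by norm_num) hD₂
  refine ⟨D₃, hD₃, fun S u₀ u v hu hv h => ?_⟩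
  refine h₃ S u₀ u v hu hv h (h₂ S u₀ u v hu hv h (h₁ S u₀ u v hu hv h ?_))
  intro t ht
  filter_upwards [h.enorm_sub_le ht] with x hx
  simpa [div_eq_mul_inv] using hx

/-- Upper bound on the error. -/
theorem exists_error_upper_bound {c₁ : ℝ} (hc : 0 < c₁) : ∃ C : ℝ,
    ∀ (S : EReal) (u₀ : 𝓓'((⊤ : TopologicalSpace.Opens R3), R3)) (u v : ℝ → R3 → R3),
      IsMildSolution S u₀ u → IsMildSolution S u₀ v → CenteredTypeI S c₁ u v →
      ∀ t ∈ times S, ∀ᵐ x : R3, ‖u t x - v t x‖ * (‖x‖ + √t) ^ 4 / √t ^ 3 ≤ C := by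
  obtain ⟨D, hD, h⟩ := exists_differenceDecay_three hc
  refine ⟨D, fun S u₀ u v hu hv hI t ht => ?_⟩
  have hτ : 0 < √t := Real.sqrt_pos.2 ht.1
  filter_upwards [h S u₀ u v hu hv hI t ht] with x hx
  rw [← ofReal_norm, ENNReal.ofReal_le_ofReal_iff (by positivity)] at hx
  rw [div_le_iff₀ (by positivity)]
  calc ‖u t x - v t x‖ * (‖x‖ + √t) ^ 4 ≤ D * (√t ^ 3 / (‖x‖ + √t) ^ (3 + 1)) * (‖x‖ + √t) ^ 4 := by
        gcongr
    _ = D * √t ^ 3 := by field_simp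

/-! ### Short-time estimates in L^∞ and forward uniqueness -/

theorem exists_mul_sqrt_le {K : ℝ≥0∞} (hK : K ≠ ∞) :
    ∃ δ : ℝ, 0 < δ ∧ K * ENNReal.ofReal √δ ≤ 2⁻¹ := by
  have h0 : 0 ≤ K.toReal := ENNReal.toReal_nonneg
  refine ⟨((2 * (K.toReal + 1))⁻¹) ^ 2, by positivity, ?_⟩
  rw [Real.sqrt_sq (by positivity), ← ENNReal.ofReal_toReal hK, ENNReal.toReal_ofReal h0,
    ← ENNReal.ofReal_mul h0, show (2⁻¹ : ℝ≥0∞) = ENNReal.ofReal 2⁻¹ by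
      rw [ENNReal.ofReal_inv_of_pos two_pos]; norm_num]
  refine ENNReal.ofReal_le_ofReal ?_
  rw [← div_eq_mul_inv, div_le_iff₀ (by positivity)]
  linarith

/-- Absorption. Finiteness of W is essential: the inequality says nothing when W = ∞, so each use
must first find an a priori bound. -/
theorem le_two_mul_of_le_add_half {W D K : ℝ≥0∞} (hW : W ≠ ∞) (hK : K ≤ 2⁻¹) (h : W ≤ D + K * W) :
    W ≤ 2 * D := by
  have h1 : W ≤ D + 2⁻¹ * W := h.trans (by gcongr)
  have h2 : 2⁻¹ * W + 2⁻¹ * W = W := by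
    rw [← add_mul, ENNReal.inv_two_add_inv_two, one_mul]
  have h3 : 2⁻¹ * W ≤ D := by
    have h4 : 2⁻¹ * W + 2⁻¹ * W ≤ D + 2⁻¹ * W := h2.le.trans h1
    exact (ENNReal.add_le_add_iff_right (ENNReal.mul_ne_top (by simp) hW)).1 h4
  calc W = 2 * (2⁻¹ * W) := by rw [← mul_assoc, ENNReal.mul_inv_cancel (by simp) (by simp), one_mul]
    _ ≤ 2 * D := by gcongr

theorem exists_lintegral_beta_half_le : ∃ C : ℝ, ∀ s t : ℝ, s < t →
    ∫⁻ r in Set.Ioo s t, ENNReal.ofReal (√(t - r))⁻¹ * ENNReal.ofReal (√(r - s))⁻¹ ≤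
      ENNReal.ofReal C := by
  obtain ⟨C, -, hC⟩ := exists_lintegral_beta_le (β := 1 / 2) (by norm_num) (by norm_num)
  refine ⟨C, fun s t hst => ?_⟩
  have h := hC s t hst
  rw [sub_self, Real.rpow_zero, mul_one] at h
  refine le_trans (le_of_eq (setLIntegral_congr_fun measurableSet_Ioo fun r hr => ?_)) h
  rw [Real.rpow_neg (by linarith [hr.1]), ← Real.sqrt_eq_rpow]

/-- A bound of `∫ₛᵗ (t-r)^{-1/2} (r-s)^{-1/2} dr`. -/
noncomputable def betaConst : ℝ := exists_lintegral_beta_half_le.choose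

theorem lintegral_beta_half_le {s t : ℝ} (hst : s < t) :
    ∫⁻ r in Set.Ioo s t, ENNReal.ofReal (√(t - r))⁻¹ * ENNReal.ofReal (√(r - s))⁻¹ ≤
      ENNReal.ofReal betaConst := exists_lintegral_beta_half_le.choose_spec s t hst

theorem ofReal_sqrt_mul_inv {t : ℝ} (ht : 0 < t) :
    ENNReal.ofReal √t * ENNReal.ofReal (√t)⁻¹ = 1 := by
  have hτ : 0 < √t := Real.sqrt_pos.2 ht
  rw [← ENNReal.ofReal_mul hτ.le, mul_inv_cancel₀ hτ.ne', ENNReal.ofReal_one]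

theorem heatFlow_eq_zero {f : R3 → R3} (hf : ∀ᵐ y, f y = 0) (t : ℝ) (x : R3) :
    heatFlow t f x = 0 := by
  rw [heatFlow]
  refine integral_eq_zero_of_ae (hf.mono fun y hy => ?_)
  simp [hy]

theorem enorm_heatFlow_le_of_enorm_le {t : ℝ} (ht : 0 < t) {f : R3 → R3} {M : ℝ≥0∞}
    (hf : ∀ᵐ y, ‖f y‖ₑ ≤ M) (x : R3) :
    ‖heatFlow t f x‖ₑ ≤ ENNReal.ofReal heatConst * japaneseIntegral 4 * M := by
  refine (enorm_heatFlow_le ht f x).trans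
    ((mul_le_mul' le_rfl (lintegral_majorant_mul_le ht x hf)).trans (le_of_eq ?_))
  rw [ENNReal.ofReal_mul heatConst_pos.le]
  calc _ = ENNReal.ofReal √t * ENNReal.ofReal (√t)⁻¹ *
        (ENNReal.ofReal heatConst * japaneseIntegral 4 * M) := by ring
    _ = _ := by rw [ofReal_sqrt_mul_inv ht, one_mul]

section
variable {S : EReal} {u₀ v₀ : 𝓓'((⊤ : TopologicalSpace.Opens R3), R3)} {u v : ℝ → R3 → R3}
  {s t : ℝ}

/-- A contraction estimate in the norm sup √(r-s) ‖w(r)‖_∞. The weight is the one suited to w(s) =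
O(1/|x|), whose heat flow is O((r-s)^{-1/2}); the Beta integral of (τ-r)^{-1/2}(r-s)^{-1/2} is a
constant, and the outer weight √(τ-s) gives the smallness. The case D = 0 is forward uniqueness. -/
theorem forall_enorm_sub_le_of_heatFlow_le (hu : IsMildSolution S u₀ u)
    (hv : IsMildSolution S v₀ v) (hs : s ∈ times S) (ht : t ∈ times S) {N : ℝ≥0} {D : ℝ≥0∞}
    (hN : ∀ r ∈ Set.Icc s t, ∀ᵐ x, ‖u r x‖ₑ + ‖v r x‖ₑ ≤ N)
    (hD : ∀ r ∈ Set.Ioc s t, ∀ᵐ x, ‖heatFlow (r - s) (u s - v s) x‖ₑ ≤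
      D * ENNReal.ofReal (√(r - s))⁻¹)
    (hsmall : ENNReal.ofReal bilinearConst * N * japaneseIntegral 4 * ENNReal.ofReal betaConst *
      ENNReal.ofReal √(t - s) ≤ 2⁻¹) :
    ∀ r ∈ Set.Ioc s t, ∀ᵐ x, ‖u r x - v r x‖ₑ ≤ 2 * D * ENNReal.ofReal (√(r - s))⁻¹ := by
  set W : ℝ≥0∞ := ⨆ r ∈ Set.Ioc s t, ENNReal.ofReal √(r - s) * eLpNormEssSup (u r - v r) volume
    with hWdef
  have hle : ∀ r ∈ Set.Ioc s t, ENNReal.ofReal √(r - s) * eLpNormEssSup (u r - v r) volume ≤ W :=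
    fun r hr => le_iSup₂ (f := fun r (_ : r ∈ Set.Ioc s t) =>
      ENNReal.ofReal √(r - s) * eLpNormEssSup (u r - v r) volume) r hr
  have hpt : ∀ r ∈ Set.Ioc s t, ∀ᵐ x, ‖u r x - v r x‖ₑ ≤ W * ENNReal.ofReal (√(r - s))⁻¹ := by
    intro r hr
    filter_upwards [enorm_ae_le_eLpNormEssSup (u r - v r) volume] with x hx
    refine hx.trans ?_
    calc eLpNormEssSup (u r - v r) volume = ENNReal.ofReal √(r - s) * ENNReal.ofReal (√(r - s))⁻¹ *
          eLpNormEssSup (u r - v r) volume := by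
          rw [ofReal_sqrt_mul_inv (sub_pos.2 hr.1), one_mul]
      _ = ENNReal.ofReal √(r - s) * eLpNormEssSup (u r - v r) volume *
          ENNReal.ofReal (√(r - s))⁻¹ := by ring
      _ ≤ _ := by gcongr; exact hle r hr
  -- Finite because both solutions are bounded on [s,t].
  have hWtop : W ≠ ∞ := by
    refine ne_top_of_le_ne_top (b := ENNReal.ofReal √(t - s) * N)
      (ENNReal.mul_ne_top ENNReal.ofReal_ne_top ENNReal.coe_ne_top) (iSup₂_le fun r hr => ?_)
    refine mul_le_mul' (ENNReal.ofReal_le_ofReal (Real.sqrt_le_sqrt (by linarith [hr.2]))) ?_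
    refine eLpNormEssSup_le_of_ae_enorm_bound ?_
    filter_upwards [hN r ⟨hr.1.le, hr.2⟩] with x hx
    exact _root_.enorm_sub_le.trans hx
  have hWle : W ≤ D + (ENNReal.ofReal bilinearConst * N * japaneseIntegral 4 *
      ENNReal.ofReal betaConst * ENNReal.ofReal √(t - s)) * W := by
    refine iSup₂_le fun τ hτ => ?_
    have hτS := mem_times_of_mem_Icc hs ht ⟨hτ.1.le, hτ.2⟩
    have hbil : ∀ x, bilinearMajorant u v s τ x ≤
        W * N * japaneseIntegral 4 * ENNReal.ofReal betaConst := by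
      intro x
      have h1 : ∀ r ∈ Set.Ioo s τ, ∫⁻ y, majorant (τ - r) (x - y) *
          (‖u r y - v r y‖ₑ * (‖u r y‖ₑ + ‖v r y‖ₑ)) ≤ (W * N * japaneseIntegral 4) *
            (ENNReal.ofReal (√(τ - r))⁻¹ * ENNReal.ofReal (√(r - s))⁻¹) := by
        intro r hr
        have hrI : r ∈ Set.Ioc s t := ⟨hr.1, hr.2.le.trans hτ.2⟩
        refine (lintegral_majorant_mul_le (sub_pos.2 hr.2) x
          (c := W * ENNReal.ofReal (√(r - s))⁻¹ * N) ?_).trans (le_of_eq (by ring))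
        filter_upwards [hpt r hrI, hN r ⟨hrI.1.le, hrI.2⟩] with y h1 h2
        exact mul_le_mul' h1 h2
      refine (setLIntegral_mono' measurableSet_Ioo h1).trans ?_
      rw [lintegral_const_mul' _ _ (ENNReal.mul_ne_top (ENNReal.mul_ne_top hWtop ENNReal.coe_ne_top)
        japaneseIntegral_four_ne_top)]
      exact mul_le_mul' le_rfl (lintegral_beta_half_le hτ.1)
    have h2 : eLpNormEssSup (u τ - v τ) volume ≤ D * ENNReal.ofReal (√(τ - s))⁻¹ +
        ENNReal.ofReal bilinearConst * (W * N * japaneseIntegral 4 * ENNReal.ofReal betaConst) := by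
      refine eLpNormEssSup_le_of_ae_enorm_bound ?_
      filter_upwards [hu.enorm_sub_le hv hs hτS hτ.1, hD τ hτ] with x hx hx'
      exact hx.trans (add_le_add hx' (mul_le_mul' le_rfl (hbil x)))
    calc _ ≤ ENNReal.ofReal √(τ - s) * (D * ENNReal.ofReal (√(τ - s))⁻¹ +
        ENNReal.ofReal bilinearConst * (W * N * japaneseIntegral 4 * ENNReal.ofReal betaConst)) :=
          mul_le_mul' le_rfl h2
      _ = ENNReal.ofReal √(τ - s) * ENNReal.ofReal (√(τ - s))⁻¹ * D + (ENNReal.ofReal bilinearConst *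
          N * japaneseIntegral 4 * ENNReal.ofReal betaConst * ENNReal.ofReal √(τ - s)) * W := by ring
      _ ≤ _ := by
          rw [ofReal_sqrt_mul_inv (sub_pos.2 hτ.1), one_mul]
          gcongr
          exact hτ.2
  have hW2 := le_two_mul_of_le_add_half hWtop hsmall hWle
  exact fun r hr => (hpt r hr).mono fun x hx => hx.trans (by gcongr)

theorem ofReal_sqrt_mono {K : ℝ≥0∞} {a b : ℝ} (hab : a ≤ b) (h : K * ENNReal.ofReal √b ≤ 2⁻¹) :
    K * ENNReal.ofReal √a ≤ 2⁻¹ :=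
  le_trans (by gcongr) h

/-- Two bounded mild solutions which agree at one time agree afterwards. -/
theorem forall_sub_eq_zero_of_sub_eq_zero (hu : IsMildSolution S u₀ u)
    (hv : IsMildSolution S v₀ v) (hs : s ∈ times S) (ht : t ∈ times S)
    (h0 : ∀ᵐ x, u s x - v s x = 0) : ∀ r ∈ Set.Icc s t, ∀ᵐ x, u r x - v r x = 0 := by
  obtain ⟨M₁, hM₁⟩ := hu.exists_enorm_le hs ht
  obtain ⟨M₂, hM₂⟩ := hv.exists_enorm_le hs ht
  have hN : ∀ r ∈ Set.Icc s t, ∀ᵐ x, ‖u r x‖ₑ + ‖v r x‖ₑ ≤ (M₁ + M₂ : ℝ≥0) := by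
    intro r hr
    filter_upwards [hM₁ r hr, hM₂ r hr] with x h1 h2
    rw [ENNReal.coe_add]
    exact add_le_add h1 h2
  obtain ⟨δ, hδ, hsmall⟩ := exists_mul_sqrt_le (K := ENNReal.ofReal bilinearConst * (M₁ + M₂ : ℝ≥0) *
    japaneseIntegral 4 * ENNReal.ofReal betaConst) (ENNReal.mul_ne_top (ENNReal.mul_ne_top
      (ENNReal.mul_ne_top ENNReal.ofReal_ne_top ENNReal.coe_ne_top) japaneseIntegral_four_ne_top)
      ENNReal.ofReal_ne_top)
  -- The step δ depends only on the bound N over the whole of [s,t], so finitely many steps cover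
  -- it.
  have hind : ∀ n : ℕ, ∀ r ∈ Set.Icc s t, r ≤ s + n * δ → ∀ᵐ x, u r x - v r x = 0 := by
    intro n
    induction n with
    | zero =>
      intro r hr hrs
      have : r = s := le_antisymm (by simpa using hrs) hr.1
      rwa [this]
    | succ n ih =>
      intro r hr hrn
      rcases le_or_gt r (s + n * δ) with h | h
      · exact ih r hr h
      · push_cast at hrn
        have hn0 : (0 : ℝ) ≤ n * δ := by positivity
        have hsn : s + n * δ ∈ Set.Icc s t := ⟨by linarith, h.le.trans hr.2⟩
        have hz := ih _ hsn le_rfl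
        have key := forall_enorm_sub_le_of_heatFlow_le hu hv (mem_times_of_mem_Icc hs ht hsn)
          (mem_times_of_mem_Icc hs ht hr) (D := 0)
          (fun q hq => hN q ⟨hsn.1.trans hq.1, hq.2.trans hr.2⟩)
          (fun q _ => ae_of_all _ fun x => by
            rw [heatFlow_eq_zero (hz.mono fun y hy => by simpa using hy)]; simp)
          (ofReal_sqrt_mono (by linarith) hsmall) r ⟨h, le_rfl⟩
        filter_upwards [key] with x hx
        simpa using hx
  intro r hr
  obtain ⟨n, hn⟩ := exists_nat_ge ((r - s) / δ)
  refine hind n r hr ?_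
  rw [div_le_iff₀ hδ] at hn
  linarith

/-- Short-time control of a mild solution by its size at one time. -/
theorem exists_forall_enorm_le (M : ℝ≥0) : ∃ (L : ℝ≥0) (δ : ℝ), 0 < δ ∧
    ∀ (S : EReal) (u₀ : 𝓓'((⊤ : TopologicalSpace.Opens R3), R3)) (u : ℝ → R3 → R3) (s t : ℝ),
      IsMildSolution S u₀ u → s ∈ times S → t ∈ times S → t ≤ s + δ → (∀ᵐ x, ‖u s x‖ₑ ≤ M) →
      ∀ r ∈ Set.Icc s t, ∀ᵐ x, ‖u r x‖ₑ ≤ L := by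
  have hHtop : ENNReal.ofReal heatConst * japaneseIntegral 4 * M ≠ ∞ :=
    ENNReal.mul_ne_top (ENNReal.mul_ne_top ENNReal.ofReal_ne_top japaneseIntegral_four_ne_top)
      ENNReal.coe_ne_top
  obtain ⟨H, hH⟩ : ∃ H : ℝ≥0, (H : ℝ≥0∞) = ENNReal.ofReal heatConst * japaneseIntegral 4 * M :=
    ⟨_, ENNReal.coe_toNNReal hHtop⟩
  -- H bounds the heat flow of data of size M; the extra 1 leaves 1/2 + 1/2 for the two pieces of
  -- the bilinear term.
  set L : ℝ≥0 := H + M + 1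
  have hKtop : ∀ B : ℝ≥0, ENNReal.ofReal bilinearConst * (B * B) * japaneseIntegral 4 * 2 ≠ ∞ :=
    fun B => ENNReal.mul_ne_top (ENNReal.mul_ne_top (ENNReal.mul_ne_top ENNReal.ofReal_ne_top
      (ENNReal.mul_ne_top ENNReal.coe_ne_top ENNReal.coe_ne_top)) japaneseIntegral_four_ne_top)
      (by simp)
  obtain ⟨δ, hδ, hδsmall⟩ := exists_mul_sqrt_le (hKtop L)
  refine ⟨L, δ, hδ, fun S u₀ u s t hu hs ht hts hM => ?_⟩
  obtain ⟨B, hB⟩ := hu.exists_enorm_le hs ht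
  -- B is a bound for this particular solution and may be huge; it only determines the step h of the
  -- induction, not L or δ. Advancing by h in this way uses no continuity of ‖u(t)‖_∞ in time.
  obtain ⟨h, hh, hhsmall⟩ := exists_mul_sqrt_le (hKtop B)
  have hind : ∀ n : ℕ, ∀ r ∈ Set.Icc s t, r ≤ s + n * h → ∀ᵐ x, ‖u r x‖ₑ ≤ L := by
    intro n
    induction n with
    | zero =>
      intro r hr hrs
      have : r = s := le_antisymm (by simpa using hrs) hr.1
      rw [this]
      refine hM.mono fun x hx => hx.trans ?_
      have : M ≤ L := by simp only [L]; exact (le_add_left le_rfl).trans (le_add_right le_rfl)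
      exact_mod_cast this
    | succ n ih =>
      intro τ hτ hτn
      rcases le_or_gt τ (s + n * h) with hle | hgt
      · exact ih τ hτ hle
      have hn0 : (0 : ℝ) ≤ n * h := by positivity
      have hsτ : s < τ := by linarith
      push_cast at hτn
      have hinner : ∀ x : R3, ∀ r ∈ Set.Ioo s τ, ∫⁻ y, majorant (τ - r) (x - y) *
          (‖u r y - (0 : ℝ → R3 → R3) r y‖ₑ * (‖u r y‖ₑ + ‖(0 : ℝ → R3 → R3) r y‖ₑ)) ≤
          (L * L * japaneseIntegral 4) * ENNReal.ofReal (√(τ - r))⁻¹ +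
          (Set.Ioo (τ - h) τ).indicator
            (fun r => (B * B * japaneseIntegral 4) * ENNReal.ofReal (√(τ - r))⁻¹) r := by
        intro x r hr
        have hrI : r ∈ Set.Icc s t := ⟨hr.1.le, hr.2.le.trans hτ.2⟩
        simp only [Pi.zero_apply, sub_zero, enorm_zero, add_zero]
        -- Times already treated carry the bound L and contribute at most 1/2 since τ-s ≤ δ. The
        -- remaining times lie within h of τ, carry the bound B, and contribute at most 1/2.
        rcases le_or_gt r (s + n * h) with hrn | hrn
        · refine le_add_right ((lintegral_majorant_mul_le (sub_pos.2 hr.2) x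
            (c := L * L) ?_).trans (le_of_eq (by ring)))
          exact (ih r hrI hrn).mono fun y hy => mul_le_mul' hy hy
        · refine le_add_left ?_
          rw [Set.indicator_of_mem (show r ∈ Set.Ioo (τ - h) τ from ⟨by linarith, hr.2⟩)]
          refine (lintegral_majorant_mul_le (sub_pos.2 hr.2) x
            (c := B * B) ?_).trans (le_of_eq (by ring))
          exact (hB r hrI).mono fun y hy => mul_le_mul' hy hy
      have hbil : ∀ x, bilinearMajorant u 0 s τ x ≤
          (L * L * japaneseIntegral 4) * ENNReal.ofReal (2 * √(τ - s)) +
          (B * B * japaneseIntegral 4) * ENNReal.ofReal (2 * √h) := by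
        intro x
        have htop : ∀ c : ℝ≥0, (c * c * japaneseIntegral 4 : ℝ≥0∞) ≠ ∞ := fun c =>
          ENNReal.mul_ne_top (ENNReal.mul_ne_top ENNReal.coe_ne_top ENNReal.coe_ne_top)
            japaneseIntegral_four_ne_top
        refine (setLIntegral_mono' measurableSet_Ioo (hinner x)).trans ?_
        have hm : Measurable fun r : ℝ =>
            (L * L * japaneseIntegral 4) * ENNReal.ofReal (√(τ - r))⁻¹ := by fun_prop
        rw [lintegral_add_left hm, lintegral_const_mul' _ _ (htop L), lintegral_Ioo_inv_sqrt hsτ.le]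
        refine add_le_add le_rfl ((setLIntegral_le_lintegral _ _).trans ?_)
        rw [lintegral_indicator measurableSet_Ioo, lintegral_const_mul' _ _ (htop B),
          lintegral_Ioo_inv_sqrt (by linarith), sub_sub_cancel]
      have hsplit : ∀ (c : ℝ≥0) (a : ℝ), ENNReal.ofReal bilinearConst *
          ((c * c * japaneseIntegral 4) * ENNReal.ofReal (2 * √a)) =
          ENNReal.ofReal bilinearConst * (c * c) * japaneseIntegral 4 * 2 * ENNReal.ofReal √a := by
        intro c a
        rw [ENNReal.ofReal_mul (by norm_num), ENNReal.ofReal_ofNat]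
        ring
      filter_upwards [hu.enorm_le hs (mem_times_of_mem_Icc hs ht hτ) hsτ] with x hx
      refine hx.trans ?_
      calc _ ≤ (H : ℝ≥0∞) + (2⁻¹ + 2⁻¹) := by
            refine add_le_add ?_ ((mul_le_mul' le_rfl (hbil x)).trans ?_)
            · rw [hH]
              exact enorm_heatFlow_le_of_enorm_le (sub_pos.2 hsτ) hM x
            · rw [mul_add, hsplit, hsplit]
              exact add_le_add (ofReal_sqrt_mono (by linarith [hτ.2]) hδsmall) hhsmall
        _ ≤ L := by
            rw [ENNReal.inv_two_add_inv_two]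
            have : H + 1 ≤ L := by
              simp only [L]
              gcongr
              exact le_add_right le_rfl
            exact_mod_cast this
  intro r hr
  obtain ⟨n, hn⟩ := exists_nat_ge ((r - s) / h)
  refine hind n r hr ?_
  rw [div_le_iff₀ hh] at hn
  linarith

end

/-! ### The lower bound on the error -/

theorem exists_one_lt_of_tendsto_zero {F : ℝ → ℝ≥0∞} (hF : Tendsto F atTop (𝓝 0)) {c : ℝ}
    (hc : 0 < c) : ∃ b : ℝ, 1 < b ∧ F b < ENNReal.ofReal c :=
  ((eventually_gt_atTop 1).and (hF.eventually_lt_const (ENNReal.ofReal_pos.2 hc))).exists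

theorem tendsto_ofReal_div_atTop (c : ℝ) :
    Tendsto (fun b : ℝ => ENNReal.ofReal (c / b)) atTop (𝓝 0) := by
  have h : Tendsto (fun b : ℝ => c / b) atTop (𝓝 0) := tendsto_const_nhds.div_atTop tendsto_id
  simpa using ENNReal.tendsto_ofReal h

/-- Since τ ≤ ρ+τ, the exponent a only strengthens the bound; the argument needs just its weakest
form, a = 0. -/
theorem weighted_bound_le {a c τ ρ z : ℝ} (ha : 0 ≤ a) (hc : 0 < c) (hτ : 0 < τ) (hρ : 0 ≤ ρ)
    (hz : z < c * τ ^ a / (ρ + τ) ^ (a + 1)) : z ≤ c / (ρ + τ) := by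
  have h0 : 0 < ρ + τ := by positivity
  refine hz.le.trans ?_
  rw [Real.rpow_add h0, Real.rpow_one, div_le_div_iff₀ (by positivity) h0]
  have h1 : τ ^ a ≤ (ρ + τ) ^ a := Real.rpow_le_rpow hτ.le (by linarith) ha
  calc c * τ ^ a * (ρ + τ) ≤ c * (ρ + τ) ^ a * (ρ + τ) := by gcongr
    _ = _ := by ring

theorem enorm_le_of_weighted_bound {a c t b : ℝ} (ha : 0 ≤ a) (hc : 0 < c) (ht : 0 < t)
    (hb : 1 < b) {w : R3 → R3} {x : R3}
    (h : ‖w x‖ < c * √t ^ a / (b * ‖x‖ + √t) ^ (a + 1)) :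
    ‖w x‖ₑ ≤ ENNReal.ofReal (c / (b * ‖x‖ + √t)) := by
  rw [← ofReal_norm]
  exact ENNReal.ofReal_le_ofReal
    (weighted_bound_le ha hc (Real.sqrt_pos.2 ht) (by positivity) h)

/-- Rescaling x ↦ bx extracts a negative power of b, and p > 3 makes (|x|+√t)^{-p} integrable. -/
theorem eLpNorm_le_of_weighted_bound {p : ℝ≥0∞} (hp : 3 < p) (hp' : p ≠ ∞) {c t b : ℝ} (hc : 0 < c)
    (ht : 0 < t) (hb : 1 < b) {w : R3 → R3}
    (h : ∀ᵐ x, ‖w x‖ₑ ≤ ENNReal.ofReal (c / (b * ‖x‖ + √t))) :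
    eLpNorm w p volume ≤ (ENNReal.ofReal (1 / b) * (ENNReal.ofReal (c ^ p.toReal) *
      (ENNReal.ofReal (√t ^ (3 - p.toReal)) * japaneseIntegral p.toReal))) ^ (1 / p.toReal) := by
  have hτ : 0 < √t := Real.sqrt_pos.2 ht
  have hb0 : 0 < b := by linarith
  have hp0 : p ≠ 0 := (zero_le.trans_lt hp).ne'
  have hq : 0 < p.toReal := ENNReal.toReal_pos hp0 hp'
  rw [eLpNorm_eq_lintegral_rpow_enorm_toReal hp0 hp']
  refine ENNReal.rpow_le_rpow ?_ (by positivity)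
  have h1 : ∀ᵐ x, ‖w x‖ₑ ^ p.toReal ≤ ENNReal.ofReal (c ^ p.toReal) *
      ENNReal.ofReal ((‖b • x‖ + √t) ^ (-p.toReal)) := by
    filter_upwards [h] with x hx
    refine (ENNReal.rpow_le_rpow hx hq.le).trans (le_of_eq ?_)
    rw [ENNReal.ofReal_rpow_of_pos (by positivity), ← ENNReal.ofReal_mul (by positivity),
      Real.div_rpow hc.le (by positivity), norm_smul, Real.norm_of_nonneg hb0.le,
      Real.rpow_neg (by positivity), div_eq_mul_inv]
  refine (lintegral_mono_ae h1).trans ?_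
  rw [lintegral_const_mul' _ _ ENNReal.ofReal_ne_top,
    lintegral_comp_smul (f := fun x => ENNReal.ofReal ((‖x‖ + √t) ^ (-p.toReal))) (by fun_prop) hb0,
    lintegral_norm_add_rpow _ hτ, mul_left_comm]
  refine mul_le_mul' (ENNReal.ofReal_le_ofReal ?_) le_rfl
  -- The change of variables gives b^{-3}; the weaker b^{-1} is enough.
  rw [one_div]
  exact inv_anti₀ hb0 (le_self_pow₀ hb.le (by norm_num))

/-- For p = ∞ the factor 1/b comes from |w| ≤ (c/b)|x|^{-1}; the singularity at the origin is
smoothed by the heat flow at the price τ^{-1/2}. -/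
theorem enorm_heatFlow_le_of_weighted_bound {c t b τ : ℝ} (hc : 0 < c) (hb : 1 < b)
    {w : R3 → R3} (h : ∀ᵐ x, ‖w x‖ₑ ≤ ENNReal.ofReal (c / (b * ‖x‖ + √t))) (hτ : 0 < τ) (x : R3) :
    ‖heatFlow τ w x‖ₑ ≤ ENNReal.ofReal (c / b) * (ENNReal.ofReal heatConst *
      (ballIntegral + japaneseIntegral 4)) * ENNReal.ofReal (√τ)⁻¹ := by
  have hb0 : 0 < b := by linarith
  have hs : 0 < √τ := Real.sqrt_pos.2 hτ
  have h0 : ∀ᵐ x : R3, x ≠ 0 := by simp [ae_iff]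
  have h1 : ∫⁻ y, majorant τ (x - y) * ‖w y‖ₑ ≤
      ENNReal.ofReal (c / b) * ∫⁻ y, majorant τ (x - y) * ENNReal.ofReal ‖y‖⁻¹ := by
    rw [← lintegral_const_mul' _ _ ENNReal.ofReal_ne_top]
    refine lintegral_mono_ae ?_
    filter_upwards [h, h0] with y hy hy0
    rw [mul_left_comm, ← ENNReal.ofReal_mul (by positivity)]
    refine mul_le_mul' le_rfl (hy.trans (ENNReal.ofReal_le_ofReal ?_))
    have := norm_pos_iff.2 hy0
    rw [← div_eq_mul_inv, div_div]
    gcongr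
    linarith [Real.sqrt_nonneg t]
  refine (enorm_heatFlow_le hτ w x).trans ((mul_le_mul' le_rfl (h1.trans
    (mul_le_mul' le_rfl (lintegral_majorant_mul_inv_norm_le hτ x)))).trans (le_of_eq ?_))
  have e : ENNReal.ofReal √τ * ENNReal.ofReal τ⁻¹ = ENNReal.ofReal (√τ)⁻¹ := by
    rw [← ENNReal.ofReal_mul hs.le]
    congr 1
    nth_rewrite 2 [← Real.mul_self_sqrt hτ.le]
    field_simp
  rw [ENNReal.ofReal_mul heatConst_pos.le, ← e]
  ring

theorem exists_lt_mem_times {S : EReal} {t δ : ℝ} (ht : t ∈ times S) (hδ : 0 < δ) :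
    ∃ t' ∈ times S, t < t' ∧ t' ≤ t + δ := by
  obtain ⟨q, hq, hqS⟩ := EReal.lt_iff_exists_real_btwn.1 ht.2
  have hq' : t < q := EReal.coe_lt_coe_iff.1 hq
  refine ⟨min q (t + δ), mem_times_of_le (t := q) ⟨ht.1.trans hq', hqS⟩ ?_ (min_le_left _ _),
    lt_min hq' (by linarith), min_le_right _ _⟩
  exact lt_min (ht.1.trans hq') (by linarith [ht.1])

/-- Lower bound on the error. -/
theorem exists_error_lower_bound {S : EReal} {p : ℝ≥0∞} (hp : 3 < p) {c₂ : ℝ} (hc₂ : 0 < c₂) {t : ℝ}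
    (ht : t ∈ times S) {a : ℝ} (ha : 0 ≤ a) {c₃ : ℝ} (hc₃ : 0 < c₃) (M : ℝ≥0) :
    ∃ b : ℝ, 1 < b ∧ ∀ (u₀ : 𝓓'((⊤ : TopologicalSpace.Opens R3), R3)) (u v : ℝ → R3 → R3),
      IsMildSolution S u₀ u → IsMildSolution S u₀ v →
      CriticalLowerBound S p c₂ (fun s => u s - v s) → M0 u v t = M →
      ¬ ∀ᵐ x : R3, ‖u t x - v t x‖ < c₃ * √t ^ a / (b * ‖x‖ + √t) ^ (a + 1) := by
  have ht0 : 0 < t := ht.1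
  rcases eq_or_ne p ∞ with rfl | hp'
  · obtain ⟨L, δ, hδ, hL⟩ := exists_forall_enorm_le M
    have hK : ENNReal.ofReal bilinearConst * (L + L : ℝ≥0) * japaneseIntegral 4 *
        ENNReal.ofReal betaConst ≠ ∞ := ENNReal.mul_ne_top (ENNReal.mul_ne_top
      (ENNReal.mul_ne_top ENNReal.ofReal_ne_top ENNReal.coe_ne_top) japaneseIntegral_four_ne_top)
      ENNReal.ofReal_ne_top
    obtain ⟨δ', hδ', hsmall⟩ := exists_mul_sqrt_le hK
    -- The later time t' depends on M, S and t only and is fixed before b, so the factor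
    -- (t'-t)^{-1/2} is a constant as b → ∞.
    obtain ⟨t', ht', htt', ht'δ⟩ := exists_lt_mem_times ht (lt_min hδ hδ')
    have hF : Tendsto (fun b : ℝ => 2 * (ENNReal.ofReal (c₃ / b) * (ENNReal.ofReal heatConst *
        (ballIntegral + japaneseIntegral 4))) * ENNReal.ofReal (√(t' - t))⁻¹ *
        ENNReal.ofReal (t' ^ (1 / 2 - 3 / 2 * ((∞ : ℝ≥0∞)⁻¹).toReal))) atTop (𝓝 0) := by
      have hQ : ENNReal.ofReal heatConst * (ballIntegral + japaneseIntegral 4) ≠ ∞ :=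
        ENNReal.mul_ne_top ENNReal.ofReal_ne_top
          (ENNReal.add_ne_top.2 ⟨ballIntegral_ne_top, japaneseIntegral_four_ne_top⟩)
      have h1 := ENNReal.Tendsto.mul_const (tendsto_ofReal_div_atTop c₃) (Or.inr hQ)
      have h2 := ENNReal.Tendsto.const_mul (a := 2) h1 (Or.inr (by simp))
      have h3 := ENNReal.Tendsto.mul_const h2
        (Or.inr (ENNReal.ofReal_ne_top (r := (√(t' - t))⁻¹)))
      have h4 := ENNReal.Tendsto.mul_const h3 (Or.inr (ENNReal.ofReal_ne_top
        (r := t' ^ (1 / 2 - 3 / 2 * ((∞ : ℝ≥0∞)⁻¹).toReal))))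
      simpa only [zero_mul, mul_zero] using h4
    obtain ⟨b, hb, hbF⟩ := exists_one_lt_of_tendsto_zero hF hc₂
    refine ⟨b, hb, fun u₀ u v hu hv hlow hM hcon => ?_⟩
    have hle : max (eLpNorm (u t) ∞ volume) (eLpNorm (v t) ∞ volume) ≤ M := by
      rw [← hM, M0, two_mul]
      exact le_add_right le_rfl
    have hut : ∀ᵐ x, ‖u t x‖ₑ ≤ M := by
      filter_upwards [enorm_ae_le_eLpNormEssSup (u t) volume] with x hx
      rw [← eLpNorm_exponent_top] at hx
      exact hx.trans ((le_max_left _ _).trans hle)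
    have hvt : ∀ᵐ x, ‖v t x‖ₑ ≤ M := by
      filter_upwards [enorm_ae_le_eLpNormEssSup (v t) volume] with x hx
      rw [← eLpNorm_exponent_top] at hx
      exact hx.trans ((le_max_right _ _).trans hle)
    have ht'1 : t' ≤ t + δ := ht'δ.trans (by gcongr; exact min_le_left _ _)
    have ht'2 : t' - t ≤ δ' := by linarith [min_le_right δ δ']
    have hN : ∀ r ∈ Set.Icc t t', ∀ᵐ x, ‖u r x‖ₑ + ‖v r x‖ₑ ≤ (L + L : ℝ≥0) := by
      intro r hr
      filter_upwards [hL S u₀ u t t' hu ht ht' ht'1 hut r hr,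
        hL S u₀ v t t' hv ht ht' ht'1 hvt r hr] with x h1 h2
      rw [ENNReal.coe_add]
      exact add_le_add h1 h2
    have hw : ∀ᵐ x, ‖(u t - v t) x‖ₑ ≤ ENNReal.ofReal (c₃ / (b * ‖x‖ + √t)) :=
      hcon.mono fun x hx => enorm_le_of_weighted_bound ha hc₃ ht0 hb hx
    have key := forall_enorm_sub_le_of_heatFlow_le hu hv ht ht' hN
      (fun r hr => ae_of_all _ fun x =>
        enorm_heatFlow_le_of_weighted_bound hc₃ hb hw (sub_pos.2 hr.1) x)
      (ofReal_sqrt_mono ht'2 hsmall) t' ⟨htt', le_rfl⟩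
    have hsup := eLpNormEssSup_le_of_ae_enorm_bound (f := u t' - v t') key
    have := hlow t' ht'
    simp only [eLpNorm_exponent_top] at this
    exact absurd (this.trans (mul_le_mul' hsup le_rfl)) (not_le.2 hbF)
  · have hq : 3 < p.toReal := by
      have := (ENNReal.toReal_lt_toReal (by simp) hp').2 hp
      simpa using this
    have hQ : ENNReal.ofReal (c₃ ^ p.toReal) *
        (ENNReal.ofReal (√t ^ (3 - p.toReal)) * japaneseIntegral p.toReal) ≠ ∞ :=
      ENNReal.mul_ne_top ENNReal.ofReal_ne_top
        (ENNReal.mul_ne_top ENNReal.ofReal_ne_top (japaneseIntegral_ne_top hq))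
    have hF : Tendsto (fun b : ℝ => (ENNReal.ofReal (1 / b) * (ENNReal.ofReal (c₃ ^ p.toReal) *
        (ENNReal.ofReal (√t ^ (3 - p.toReal)) * japaneseIntegral p.toReal))) ^ (1 / p.toReal) *
        ENNReal.ofReal (t ^ (1 / 2 - 3 / 2 * (p⁻¹).toReal))) atTop (𝓝 0) := by
      have h1 := ENNReal.Tendsto.mul_const (tendsto_ofReal_div_atTop 1) (Or.inr hQ)
      have h2 := (ENNReal.continuous_rpow_const (y := 1 / p.toReal)).continuousAt.tendsto.comp h1
      rw [zero_mul, ENNReal.zero_rpow_of_pos (by positivity)] at h2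
      have h3 := ENNReal.Tendsto.mul_const h2 (Or.inr (ENNReal.ofReal_ne_top
        (r := t ^ (1 / 2 - 3 / 2 * (p⁻¹).toReal))))
      rw [zero_mul] at h3
      exact h3
    obtain ⟨b, hb, hbF⟩ := exists_one_lt_of_tendsto_zero hF hc₂
    refine ⟨b, hb, fun u₀ u v hu hv hlow hM hcon => ?_⟩
    have hw : ∀ᵐ x, ‖(u t - v t) x‖ₑ ≤ ENNReal.ofReal (c₃ / (b * ‖x‖ + √t)) :=
      hcon.mono fun x hx => enorm_le_of_weighted_bound ha hc₃ ht0 hb hx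
    exact absurd ((hlow t ht).trans (mul_le_mul'
      (eLpNorm_le_of_weighted_bound hp hp' hc₃ ht0 hb hw) le_rfl)) (not_le.2 hbF)

/-! ### The uniqueness criterion in L^p -/

/-- Jensen's inequality for a kernel of finite mass. -/
theorem lintegral_mul_rpow_le {α : Type*} [MeasurableSpace α] {μ : Measure α} {q : ℝ} (hq : 1 ≤ q)
    {κ h : α → ℝ≥0∞} (hκ : AEMeasurable κ μ) (hh : AEMeasurable h μ) :
    (∫⁻ a, κ a * h a ∂μ) ^ q ≤ (∫⁻ a, κ a ∂μ) ^ (q - 1) * ∫⁻ a, κ a * h a ^ q ∂μ := by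
  have hq0 : 0 < q := by linarith
  have hq1 : 1 / q ≤ 1 := by rw [div_le_one hq0]; exact hq
  -- Hölder with weights 1-1/q and 1/q applied to κ and κh^q, whose weighted product is κh.
  have key := ENNReal.lintegral_mul_norm_pow_le (μ := μ) hκ (hκ.mul (hh.pow_const q))
    (p := 1 - 1 / q) (q := 1 / q) (by linarith) (by positivity) (by ring)
  have e : ∀ a, κ a ^ (1 - 1 / q) * (κ a * h a ^ q) ^ (1 / q) = κ a * h a := by
    intro a
    rw [ENNReal.mul_rpow_of_nonneg _ _ (by positivity), ← mul_assoc,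
      ← ENNReal.rpow_add_of_nonneg _ _ (by linarith) (by positivity), ← ENNReal.rpow_mul,
      mul_one_div_cancel hq0.ne', sub_add_cancel, ENNReal.rpow_one, ENNReal.rpow_one]
  simp only [Pi.mul_apply, e] at key
  refine (ENNReal.rpow_le_rpow key hq0.le).trans (le_of_eq ?_)
  rw [ENNReal.mul_rpow_of_nonneg _ _ hq0.le, ← ENNReal.rpow_mul, ← ENNReal.rpow_mul,
    one_div_mul_cancel hq0.ne', ENNReal.rpow_one, sub_mul, one_mul, one_div_mul_cancel hq0.ne']

/-- A space-time form of Young's convolution inequality for the majorant of the Oseen kernel. -/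
theorem lintegral_rpow_majorant_le {q β C t : ℝ} (hq : 1 ≤ q) (ht : 0 < t)
    (hC : ∀ s t : ℝ, s < t →
      ∫⁻ r in Set.Ioo s t, ENNReal.ofReal (√(t - r))⁻¹ * ENNReal.ofReal ((r - s) ^ (-β)) ≤
        ENNReal.ofReal (C * (t - s) ^ (1 / 2 - β)))
    {g : ℝ → R3 → ℝ≥0∞} {G : ℝ≥0∞}
    (hg : AEMeasurable (Function.uncurry g) ((volume.restrict (Set.Ioo 0 t)).prod volume))
    (hG : ∀ r ∈ Set.Ioo 0 t, ∫⁻ y, g r y ^ q ≤ (G * ENNReal.ofReal (r ^ (-β))) ^ q) :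
    ∫⁻ x, (∫⁻ r in Set.Ioo 0 t, ∫⁻ y, majorant (t - r) (x - y) * g r y) ^ q ≤
      (japaneseIntegral 4 * ENNReal.ofReal (C * t ^ (1 / 2 - β)) * G) ^ q := by
  have hq0 : 0 < q := by linarith
  set μ : Measure (ℝ × R3) := (volume.restrict (Set.Ioo 0 t)).prod volume with hμ
  set A : ℝ≥0∞ := japaneseIntegral 4 * ENNReal.ofReal (C * t ^ (1 / 2 - β)) with hA
  -- The time weight r^{-β} is moved into the kernel, so that r^β g(r) has L^q norm at most G at
  -- every time and the kernel has space-time mass at most A.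
  set κ : R3 → ℝ × R3 → ℝ≥0∞ := fun x z =>
    majorant (t - z.1) (x - z.2) * ENNReal.ofReal (z.1 ^ (-β)) with hκ
  set h : ℝ × R3 → ℝ≥0∞ := fun z => g z.1 z.2 * ENNReal.ofReal (z.1 ^ β) with hh
  have hκm : Measurable fun w : R3 × (ℝ × R3) => κ w.1 w.2 :=
    (measurable_majorant_conv t).mul (by fun_prop : Measurable fun w : R3 × (ℝ × R3) =>
      ENNReal.ofReal (w.2.1 ^ (-β)))
  have hκx : ∀ x, Measurable (κ x) := fun x =>
    (measurable_majorant_conv_prod t x).mul (by fun_prop : Measurable fun z : ℝ × R3 =>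
      ENNReal.ofReal (z.1 ^ (-β)))
  have hhm : AEMeasurable h μ := hg.mul (by fun_prop)
  have hinv : ∀ r ∈ Set.Ioo 0 t, ENNReal.ofReal (r ^ (-β)) * ENNReal.ofReal (r ^ β) = 1 := by
    intro r hr
    rw [← ENNReal.ofReal_mul (Real.rpow_nonneg hr.1.le _), ← Real.rpow_add hr.1, neg_add_cancel,
      Real.rpow_zero, ENNReal.ofReal_one]
  have hbeta : ∫⁻ r in Set.Ioo 0 t, ENNReal.ofReal (√(t - r))⁻¹ * ENNReal.ofReal (r ^ (-β)) ≤
      ENNReal.ofReal (C * t ^ (1 / 2 - β)) := by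
    simpa using hC 0 t ht
  have hmass : ∀ x, ∫⁻ z, κ x z ∂μ ≤ A := by
    intro x
    rw [hμ, lintegral_prod _ (hκx x).aemeasurable]
    have h1 : ∀ r ∈ Set.Ioo 0 t, ∫⁻ y, κ x (r, y) ≤ japaneseIntegral 4 *
        (ENNReal.ofReal (√(t - r))⁻¹ * ENNReal.ofReal (r ^ (-β))) := by
      intro r hr
      simp only [hκ]
      rw [lintegral_mul_const' _ _ ENNReal.ofReal_ne_top, lintegral_majorant_sub (sub_pos.2 hr.2)]
      exact le_of_eq (by ring)
    refine (setLIntegral_mono' measurableSet_Ioo h1).trans ?_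
    rw [lintegral_const_mul' _ _ japaneseIntegral_four_ne_top]
    exact mul_le_mul' le_rfl hbeta
  have hrepr : ∀ x, ∫⁻ r in Set.Ioo 0 t, ∫⁻ y, majorant (t - r) (x - y) * g r y =
      ∫⁻ z, κ x z * h z ∂μ := by
    intro x
    have hm : AEMeasurable (fun z => κ x z * h z) μ := (hκx x).aemeasurable.mul hhm
    rw [lintegral_prod _ hm]
    refine setLIntegral_congr_fun measurableSet_Ioo fun r hr => lintegral_congr fun y => ?_
    simp only [hκ, hh]
    calc _ = majorant (t - r) (x - y) * g r y *
          (ENNReal.ofReal (r ^ (-β)) * ENNReal.ofReal (r ^ β)) := by rw [hinv r hr, mul_one]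
      _ = _ := by ring
  -- By Tonelli the x-integral meets only the kernel and produces A once more; with A^{q-1} from
  -- Jensen this makes (AG)^q.
  have hswap : ∫⁻ x, ∫⁻ z, κ x z * h z ^ q ∂μ ≤ A * G ^ q := by
    rw [lintegral_lintegral_swap]
    · have h1 : ∀ z : ℝ × R3, ∫⁻ x, κ x z * h z ^ q =
          (∫⁻ x, majorant (t - z.1) (x - z.2)) * ENNReal.ofReal (z.1 ^ (-β)) * h z ^ q := by
        intro z
        have hm : Measurable fun x : R3 => majorant (t - z.1) (x - z.2) := by
          unfold majorant
          fun_prop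
        simp only [hκ]
        rw [← lintegral_mul_const _ hm, ← lintegral_mul_const _ (hm.mul_const _)]
      simp only [h1]
      have hm : Measurable fun z : ℝ × R3 =>
          (∫⁻ x, majorant (t - z.1) (x - z.2)) * ENNReal.ofReal (z.1 ^ (-β)) := by
        refine Measurable.mul ?_ (by fun_prop)
        exact Measurable.lintegral_prod_left'
          (f := fun w : R3 × (ℝ × R3) => majorant (t - w.2.1) (w.1 - w.2.2))
          (measurable_majorant_conv t)
      have hm' : AEMeasurable (fun z => (∫⁻ x, majorant (t - z.1) (x - z.2)) *
          ENNReal.ofReal (z.1 ^ (-β)) * h z ^ q) μ := hm.aemeasurable.mul (hhm.pow_const q)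
      rw [lintegral_prod _ hm']
      have h2 : ∀ r ∈ Set.Ioo 0 t, ∫⁻ y, (∫⁻ x, majorant (t - r) (x - y)) *
          ENNReal.ofReal (r ^ (-β)) * h (r, y) ^ q ≤ japaneseIntegral 4 *
          (ENNReal.ofReal (√(t - r))⁻¹ * ENNReal.ofReal (r ^ (-β))) * G ^ q := by
        intro r hr
        simp only [lintegral_majorant_sub' (sub_pos.2 hr.2)]
        rw [lintegral_const_mul' _ _ (ENNReal.mul_ne_top (ENNReal.mul_ne_top ENNReal.ofReal_ne_top
          japaneseIntegral_four_ne_top) ENNReal.ofReal_ne_top)]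
        refine mul_le_mul' (le_of_eq (by ring)) ?_
        simp only [hh, ENNReal.mul_rpow_of_nonneg _ _ hq0.le]
        rw [lintegral_mul_const' _ _ (ENNReal.rpow_ne_top_of_nonneg hq0.le ENNReal.ofReal_ne_top)]
        refine (mul_le_mul' (hG r hr) le_rfl).trans (le_of_eq ?_)
        rw [← ENNReal.mul_rpow_of_nonneg _ _ hq0.le, mul_assoc, hinv r hr, mul_one]
      refine (setLIntegral_mono' measurableSet_Ioo h2).trans ?_
      rw [lintegral_mul_const _ (by fun_prop), lintegral_const_mul' _ _ japaneseIntegral_four_ne_top]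
      exact mul_le_mul' (mul_le_mul' le_rfl hbeta) le_rfl
    · exact hκm.aemeasurable.mul ((hhm.pow_const q).comp_snd)
  calc ∫⁻ x, (∫⁻ r in Set.Ioo 0 t, ∫⁻ y, majorant (t - r) (x - y) * g r y) ^ q
      = ∫⁻ x, (∫⁻ z, κ x z * h z ∂μ) ^ q := by simp only [hrepr]
    _ ≤ ∫⁻ x, A ^ (q - 1) * ∫⁻ z, κ x z * h z ^ q ∂μ := by
        refine lintegral_mono fun x => ?_
        refine (lintegral_mul_rpow_le hq (hκx x).aemeasurable hhm).trans ?_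
        exact mul_le_mul' (ENNReal.rpow_le_rpow (hmass x) (by linarith)) le_rfl
    _ = A ^ (q - 1) * ∫⁻ x, ∫⁻ z, κ x z * h z ^ q ∂μ := by
        refine lintegral_const_mul' _ _ (ENNReal.rpow_ne_top_of_nonneg (by linarith) ?_)
        exact ENNReal.mul_ne_top japaneseIntegral_four_ne_top ENNReal.ofReal_ne_top
    _ ≤ A ^ (q - 1) * (A * G ^ q) := mul_le_mul' le_rfl hswap
    _ = (A * G) ^ q := by
        rw [ENNReal.mul_rpow_of_nonneg _ _ hq0.le, ← mul_assoc]
        congr 1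
        nth_rewrite 2 [← ENNReal.rpow_one A]
        rw [← ENNReal.rpow_add_of_nonneg _ _ (by linarith) zero_le_one, sub_add_cancel]

section
variable {S : EReal} {u₀ : 𝓓'((⊤ : TopologicalSpace.Opens R3), R3)} {u v : ℝ → R3 → R3}
  {t c₁ : ℝ} {p : ℝ≥0∞}

/-- The scaling exponent `1/2 - 3/(2q)` of `L^q`. -/
noncomputable def scalingExponent (q : ℝ) : ℝ := 1 / 2 - 3 / 2 * q⁻¹

/-- Scale invariance cancels all powers of t. The improved decay is what gives finiteness down to p
= 3, where (|x|+√t)^{-1} is not in L^p. -/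
theorem DifferenceDecay.eLpNorm_le {D : ℝ} (hD : 0 < D) (h : DifferenceDecay S D 3 u v)
    (ht : t ∈ times S) (hp : 3 ≤ p) (hp' : p ≠ ∞) :
    ENNReal.ofReal (t ^ scalingExponent p.toReal) * eLpNorm (u t - v t) p volume ≤
      ENNReal.ofReal D * japaneseIntegral (4 * p.toReal) ^ (1 / p.toReal) := by
  have ht0 : 0 < t := ht.1
  have hτ : 0 < √t := Real.sqrt_pos.2 ht0
  have hp0 : p ≠ 0 := (lt_of_lt_of_le (by norm_num) hp).ne'
  have hq : 0 < p.toReal := ENNReal.toReal_pos hp0 hp'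
  set q := p.toReal
  rw [eLpNorm_eq_lintegral_rpow_enorm_toReal hp0 hp']
  have h1 : ∀ᵐ x, ‖(u t - v t) x‖ₑ ^ q ≤ ENNReal.ofReal ((D * √t ^ 3) ^ q) *
      ENNReal.ofReal ((‖x‖ + √t) ^ (-(4 * q))) := by
    filter_upwards [h t ht] with x hx
    refine (ENNReal.rpow_le_rpow hx hq.le).trans (le_of_eq ?_)
    have hρ : 0 < ‖x‖ + √t := by positivity
    rw [ENNReal.ofReal_rpow_of_pos (by positivity), ← ENNReal.ofReal_mul (by positivity),
      ← mul_div_assoc, Real.div_rpow (by positivity) (by positivity), ← Real.rpow_natCast_mul hρ.le,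
      Real.rpow_neg hρ.le, div_eq_mul_inv]
    norm_num
  have h2 : ∫⁻ x, ‖(u t - v t) x‖ₑ ^ q ≤
      ENNReal.ofReal (D ^ q * √t ^ (3 - q)) * japaneseIntegral (4 * q) := by
    refine (lintegral_mono_ae h1).trans (le_of_eq ?_)
    rw [lintegral_const_mul' _ _ ENNReal.ofReal_ne_top, lintegral_norm_add_rpow _ hτ, ← mul_assoc,
      ← ENNReal.ofReal_mul (by positivity)]
    congr 2
    rw [Real.mul_rpow hD.le (by positivity), mul_assoc, ← Real.rpow_natCast_mul hτ.le,
      ← Real.rpow_add hτ]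
    congr 2
    push_cast
    ring
  refine (mul_le_mul' le_rfl (ENNReal.rpow_le_rpow h2 (by positivity))).trans (le_of_eq ?_)
  rw [ENNReal.mul_rpow_of_nonneg _ _ (by positivity), ← mul_assoc,
    ENNReal.ofReal_rpow_of_pos (by positivity), ← ENNReal.ofReal_mul (by positivity)]
  congr 2
  rw [Real.mul_rpow (by positivity) (by positivity), ← Real.rpow_mul hD.le, mul_one_div_cancel hq.ne',
    Real.rpow_one, Real.sqrt_eq_rpow, ← Real.rpow_mul ht0.le, ← Real.rpow_mul ht0.le, mul_left_comm,
    ← Real.rpow_add ht0]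
  have e : scalingExponent q + 1 / 2 * (3 - q) * (1 / q) = 0 := by
    rw [scalingExponent]
    field_simp
    ring
  rw [e, Real.rpow_zero, mul_one]

/-- The nonlinear term is small in `L^p` if the difference is concentrated far from the origin. -/
theorem lintegral_nonlinear_rpow_le (hu : IsMildSolution S u₀ u) (hv : IsMildSolution S u₀ v)
    (hc : 0 < c₁) (hI : CenteredTypeI S c₁ u v) (ht : t ∈ times S) (hp : 3 ≤ p) (hp' : p ≠ ∞)
    {ε η : ℝ} (hε : 0 < ε) (hη : η = ε / (c₁ - ε))
    (h : eLpNorm ((Metric.ball 0 (η⁻¹ * √t)).indicator (u t - v t)) p volume ≤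
      ENNReal.ofReal (ε / 2) *
        eLpNorm ((Metric.ball 0 (η⁻¹ * √t))ᶜ.indicator (u t - v t)) p volume) :
    ∫⁻ y, (‖u t y - v t y‖ₑ * (‖u t y‖ₑ + ‖v t y‖ₑ)) ^ p.toReal ≤
      (ENNReal.ofReal ((c₁ / 2 + 1) * ε) * ENNReal.ofReal (√t)⁻¹ *
        eLpNorm (u t - v t) p volume) ^ p.toReal := by
  have ht0 : 0 < t := ht.1
  have hτ : 0 < √t := Real.sqrt_pos.2 ht0
  have hp0 : p ≠ 0 := (lt_of_lt_of_le (by norm_num) hp).ne'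
  have hq : 0 < p.toReal := ENNReal.toReal_pos hp0 hp'
  have hq1 : 1 ≤ p.toReal := by
    have := (ENNReal.toReal_le_toReal (by simp) hp').2 hp
    norm_num at this
    linarith
  set B : Set R3 := Metric.ball 0 (η⁻¹ * √t)
  have hB : MeasurableSet B := Metric.isOpen_ball.measurableSet
  have hw : AEStronglyMeasurable (u t - v t) volume :=
    (hu.aestronglyMeasurable_slice t ht).sub (hv.aestronglyMeasurable_slice t ht)
  -- In the ball only |u|+|v| ≤ c₁/√t holds and the smallness will come from w; outside it the Type
  -- I bound is itself small.
  have hpt : ∀ᵐ y, ‖u t y - v t y‖ₑ * (‖u t y‖ₑ + ‖v t y‖ₑ) ≤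
      ENNReal.ofReal (c₁ / √t) * ‖B.indicator (u t - v t) y‖ₑ +
      ENNReal.ofReal (ε / √t) * ‖Bᶜ.indicator (u t - v t) y‖ₑ := by
    filter_upwards [hI.enorm_add_le ht] with y hy
    by_cases hyB : y ∈ B
    · refine le_add_right ?_
      rw [Set.indicator_of_mem hyB, mul_comm, Pi.sub_apply]
      refine mul_le_mul' (hy.trans (ENNReal.ofReal_le_ofReal ?_)) le_rfl
      gcongr
      linarith [norm_nonneg y]
    · refine le_add_left ?_
      rw [Set.indicator_of_mem (Set.mem_compl hyB), mul_comm, Pi.sub_apply]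
      refine mul_le_mul' (hy.trans (ENNReal.ofReal_le_ofReal ?_)) le_rfl
      have hyn : η⁻¹ * √t ≤ ‖y‖ := by
        simpa [B] using hyB
      have hη' : η⁻¹ = (c₁ - ε) / ε := by rw [hη, inv_div]
      -- The value of η is chosen so that η^{-1} + 1 = c₁/ε.
      have h1 : c₁ / ε * √t ≤ ‖y‖ + √t := by
        have : c₁ / ε * √t = η⁻¹ * √t + √t := by rw [hη']; field_simp; ring
        linarith
      calc c₁ / (‖y‖ + √t) ≤ c₁ / (c₁ / ε * √t) := by gcongr
        _ = ε / √t := by field_simp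
  set F₁ : R3 → ℝ≥0∞ := fun y => ENNReal.ofReal (c₁ / √t) * ‖B.indicator (u t - v t) y‖ₑ
  set F₂ : R3 → ℝ≥0∞ := fun y => ENNReal.ofReal (ε / √t) * ‖Bᶜ.indicator (u t - v t) y‖ₑ
  have hF₁ : AEMeasurable F₁ volume := (hw.indicator hB).enorm.const_mul _
  have hF₂ : AEMeasurable F₂ volume := (hw.indicator hB.compl).enorm.const_mul _
  have hnorm : ∀ (c : ℝ) (f : R3 → R3), (∫⁻ y, (ENNReal.ofReal c * ‖f y‖ₑ) ^ p.toReal) ^ (1 / p.toReal) =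
      ENNReal.ofReal c * eLpNorm f p volume := by
    intro c f
    simp only [ENNReal.mul_rpow_of_nonneg _ _ hq.le]
    rw [lintegral_const_mul' _ _ (ENNReal.rpow_ne_top_of_nonneg hq.le ENNReal.ofReal_ne_top),
      ENNReal.mul_rpow_of_nonneg _ _ (by positivity), ← ENNReal.rpow_mul, mul_one_div_cancel hq.ne',
      ENNReal.rpow_one, eLpNorm_eq_lintegral_rpow_enorm_toReal hp0 hp']
  have hLp := ENNReal.lintegral_Lp_add_le hF₁ hF₂ hq1
  rw [hnorm, hnorm] at hLp
  have hsum : ENNReal.ofReal (c₁ / √t) * eLpNorm (B.indicator (u t - v t)) p volume +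
      ENNReal.ofReal (ε / √t) * eLpNorm (Bᶜ.indicator (u t - v t)) p volume ≤
      ENNReal.ofReal ((c₁ / 2 + 1) * ε) * ENNReal.ofReal (√t)⁻¹ * eLpNorm (u t - v t) p volume := by
    calc _ ≤ ENNReal.ofReal (c₁ / √t) * (ENNReal.ofReal (ε / 2) *
          eLpNorm (Bᶜ.indicator (u t - v t)) p volume) +
          ENNReal.ofReal (ε / √t) * eLpNorm (Bᶜ.indicator (u t - v t)) p volume := by gcongr
      _ = ENNReal.ofReal ((c₁ / 2 + 1) * ε) * ENNReal.ofReal (√t)⁻¹ *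
          eLpNorm (Bᶜ.indicator (u t - v t)) p volume := by
        rw [← mul_assoc, ← add_mul, ← ENNReal.ofReal_mul (by positivity),
          ← ENNReal.ofReal_add (by positivity) (by positivity), ← ENNReal.ofReal_mul (by positivity)]
        congr 2
        field_simp
      _ ≤ _ := by
        gcongr
        exact eLpNorm_indicator_le _
  have h3 : ∫⁻ y, (‖u t y - v t y‖ₑ * (‖u t y‖ₑ + ‖v t y‖ₑ)) ^ p.toReal ≤
      ∫⁻ y, ((F₁ + F₂) y) ^ p.toReal :=
    lintegral_mono_ae (hpt.mono fun y hy => ENNReal.rpow_le_rpow hy hq.le)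
  refine h3.trans ?_
  have h4 := ENNReal.rpow_le_rpow (hLp.trans hsum) hq.le
  rwa [← ENNReal.rpow_mul, one_div_mul_cancel hq.ne', ENNReal.rpow_one] at h4

theorem scalingExponent_nonneg {q : ℝ} (hq : 3 ≤ q) : 0 ≤ scalingExponent q := by
  have h : q⁻¹ ≤ 3⁻¹ := inv_anti₀ (by norm_num) hq
  rw [scalingExponent]
  linarith

theorem scalingExponent_lt {q : ℝ} (hq : 0 < q) : scalingExponent q < 1 / 2 := by
  have h : 0 < q⁻¹ := inv_pos.2 hq
  rw [scalingExponent]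
  linarith

/-- Uniqueness criterion. -/
theorem exists_uniqueness_criterion (hc : 0 < c₁) (hp : 3 ≤ p) (hp' : p < ∞) :
    ∃ ε₁ : ℝ, 0 < ε₁ ∧ ε₁ < c₁ ∧ ∀ η : ℝ, η = ε₁ / (c₁ - ε₁) →
      ∀ (S : EReal) (u₀ : 𝓓'((⊤ : TopologicalSpace.Opens R3), R3)) (u v : ℝ → R3 → R3),
        IsMildSolution S u₀ u → IsMildSolution S u₀ v → CenteredTypeI S c₁ u v →
        (∃ T : ℝ, 0 < T ∧ ∀ t ∈ times S, t < T →
          eLpNorm ((Metric.ball 0 (η⁻¹ * √t)).indicator (u t - v t)) p volume ≤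
            ENNReal.ofReal (ε₁ / 2) *
              eLpNorm ((Metric.ball 0 (η⁻¹ * √t))ᶜ.indicator (u t - v t)) p volume) →
        ∀ t ∈ times S, ∀ᵐ x : R3, u t x - v t x = 0 := by
  have hp0 : p ≠ 0 := (lt_of_lt_of_le (by norm_num) hp).ne'
  have hq3 : 3 ≤ p.toReal := by
    have := (ENNReal.toReal_le_toReal (by simp) hp'.ne).2 hp
    simpa using this
  have hq : 0 < p.toReal := by linarith
  set q := p.toReal
  have hα0 := scalingExponent_nonneg hq3
  have hα1 := scalingExponent_lt hq
  set α := scalingExponent q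
  -- The weight r^{-(1/2+α)} combines r^{-1/2} from the nonlinearity with r^{-α} from the definition
  -- of W; it is integrable at 0 because α < 1/2, that is p < ∞.
  obtain ⟨C, hC0, hC⟩ := exists_lintegral_beta_le (β := 1 / 2 + α) (by linarith) (by linarith)
  set J := (japaneseIntegral 4).toReal
  have hJ : japaneseIntegral 4 = ENNReal.ofReal J :=
    (ENNReal.ofReal_toReal japaneseIntegral_four_ne_top).symm
  have hJ0 : 0 ≤ J := ENNReal.toReal_nonneg
  have hB := bilinearConst_pos
  -- K collects every constant of the closed estimate W ≤ KεW. The choice of ε makes Kε ≤ 1/2, and ε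
  -- ≤ c₁/2 keeps ε below c₁.
  set K : ℝ := bilinearConst * J * C * (c₁ / 2 + 1)
  have hK0 : 0 ≤ K := by positivity
  have hε : 0 < min (c₁ / 2) (2 * (K + 1))⁻¹ := lt_min (by linarith) (by positivity)
  set ε := min (c₁ / 2) (2 * (K + 1))⁻¹
  have hεc : ε < c₁ := (min_le_left _ _).trans_lt (by linarith)
  have hKε : ENNReal.ofReal (K * ε) ≤ 2⁻¹ := by
    rw [show (2⁻¹ : ℝ≥0∞) = ENNReal.ofReal 2⁻¹ by
      rw [ENNReal.ofReal_inv_of_pos two_pos]; norm_num]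
    refine ENNReal.ofReal_le_ofReal ?_
    calc K * ε ≤ K * (2 * (K + 1))⁻¹ := by gcongr; exact min_le_right _ _
      _ ≤ 2⁻¹ := by
        rw [← div_eq_mul_inv, div_le_iff₀ (by positivity)]
        linarith
  refine ⟨ε, hε, hεc, ?_⟩
  rintro η hη S u₀ u v hu hv hI ⟨T, hT, hconc⟩
  obtain ⟨D, hD, hdec⟩ := exists_differenceDecay_three hc
  have hdec := hdec S u₀ u v hu hv hI
  set I : Set ℝ := {t | t ∈ times S ∧ t < T}
  set W : ℝ≥0∞ := ⨆ t ∈ I, ENNReal.ofReal (t ^ α) * eLpNorm (u t - v t) p volume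
  have hle : ∀ t ∈ I, ENNReal.ofReal (t ^ α) * eLpNorm (u t - v t) p volume ≤ W := fun t ht =>
    le_iSup₂ (f := fun t (_ : t ∈ I) => ENNReal.ofReal (t ^ α) * eLpNorm (u t - v t) p volume) t ht
  have hWtop : W ≠ ∞ := by
    refine ne_top_of_le_ne_top (b := ENNReal.ofReal D * japaneseIntegral (4 * q) ^ (1 / q))
      (ENNReal.mul_ne_top ENNReal.ofReal_ne_top (ENNReal.rpow_ne_top_of_nonneg (by positivity)
        (japaneseIntegral_ne_top (by linarith)))) (iSup₂_le fun t ht => ?_)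
    exact hdec.eLpNorm_le hD ht.1 hp hp'.ne
  have hone : ∀ t : ℝ, 0 < t → ENNReal.ofReal (t ^ α) * ENNReal.ofReal (t ^ (-α)) = 1 := by
    intro t ht
    rw [← ENNReal.ofReal_mul (by positivity), ← Real.rpow_add ht, add_neg_cancel, Real.rpow_zero,
      ENNReal.ofReal_one]
  have hpt : ∀ t ∈ I, eLpNorm (u t - v t) p volume ≤ ENNReal.ofReal (t ^ (-α)) * W := by
    intro t ht
    calc eLpNorm (u t - v t) p volume = ENNReal.ofReal (t ^ α) * ENNReal.ofReal (t ^ (-α)) *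
          eLpNorm (u t - v t) p volume := by rw [hone t ht.1.1, one_mul]
      _ = ENNReal.ofReal (t ^ (-α)) * (ENNReal.ofReal (t ^ α) * eLpNorm (u t - v t) p volume) := by ring
      _ ≤ _ := by gcongr; exact hle t ht
  have hWle : W ≤ 0 + ENNReal.ofReal (K * ε) * W := by
    rw [zero_add]
    refine iSup₂_le fun t ht => ?_
    have ht0 : 0 < t := ht.1.1
    have hG : ∀ r ∈ Set.Ioo 0 t, ∫⁻ y, (‖u r y - v r y‖ₑ * (‖u r y‖ₑ + ‖v r y‖ₑ)) ^ q ≤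
        (ENNReal.ofReal ((c₁ / 2 + 1) * ε) * W * ENNReal.ofReal (r ^ (-(1 / 2 + α)))) ^ q := by
      intro r hr
      have hrI : r ∈ I := ⟨mem_times_of_le ht.1 hr.1 hr.2.le, hr.2.trans ht.2⟩
      refine (lintegral_nonlinear_rpow_le hu hv hc hI hrI.1 hp hp'.ne hε hη
        (hconc r hrI.1 hrI.2)).trans (ENNReal.rpow_le_rpow ?_ hq.le)
      refine (mul_le_mul' le_rfl (hpt r hrI)).trans (le_of_eq ?_)
      have e : ENNReal.ofReal (r ^ (-(1 / 2 + α))) =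
          ENNReal.ofReal (√r)⁻¹ * ENNReal.ofReal (r ^ (-α)) := by
        rw [← ENNReal.ofReal_mul (by positivity), Real.sqrt_eq_rpow, ← Real.rpow_neg hr.1.le,
          ← Real.rpow_add hr.1]
        congr 2
        ring
      rw [e]
      ring
    have hmeas : AEMeasurable (Function.uncurry fun r y =>
        ‖u r y - v r y‖ₑ * (‖u r y‖ₑ + ‖v r y‖ₑ)) ((volume.restrict (Set.Ioo 0 t)).prod volume) := by
      have h1 := hu.aestronglyMeasurable_prod le_rfl ht.1
      have h2 := hv.aestronglyMeasurable_prod le_rfl ht.1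
      exact (h1.sub h2).enorm.mul (h1.enorm.add h2.enorm)
    have hyoung := lintegral_rpow_majorant_le (by linarith) ht0 hC hmeas hG
    have hnorm : eLpNorm (u t - v t) p volume ≤ ENNReal.ofReal bilinearConst *
        (japaneseIntegral 4 * ENNReal.ofReal (C * t ^ (1 / 2 - (1 / 2 + α))) *
          (ENNReal.ofReal ((c₁ / 2 + 1) * ε) * W)) := by
      rw [eLpNorm_eq_lintegral_rpow_enorm_toReal hp0 hp'.ne, one_div, ENNReal.rpow_inv_le_iff hq,
        ENNReal.mul_rpow_of_nonneg _ _ hq.le]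
      refine le_trans ?_ (mul_le_mul' le_rfl hyoung)
      rw [← lintegral_const_mul' _ _ (ENNReal.rpow_ne_top_of_nonneg hq.le ENNReal.ofReal_ne_top)]
      refine lintegral_mono_ae ?_
      filter_upwards [hu.enorm_sub_le_bilinearMajorant hv hc hI ht.1] with x hx
      rw [← ENNReal.mul_rpow_of_nonneg _ _ hq.le]
      exact ENNReal.rpow_le_rpow hx hq.le
    refine (mul_le_mul' le_rfl hnorm).trans (le_of_eq ?_)
    rw [show 1 / 2 - (1 / 2 + α) = -α by ring, ENNReal.ofReal_mul hC0.le, hJ]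
    calc _ = ENNReal.ofReal (t ^ α) * ENNReal.ofReal (t ^ (-α)) * (ENNReal.ofReal bilinearConst *
          ENNReal.ofReal J * ENNReal.ofReal C * ENNReal.ofReal ((c₁ / 2 + 1) * ε)) * W := by ring
      _ = _ := by
        rw [hone t ht0, one_mul, ← ENNReal.ofReal_mul (by positivity),
          ← ENNReal.ofReal_mul (by positivity), ← ENNReal.ofReal_mul (by positivity)]
        congr 2
        simp only [K]
        ring
  have hW0 : W = 0 := by simpa using le_two_mul_of_le_add_half hWtop hKε hWle
  have hsmall : ∀ t ∈ I, ∀ᵐ x : R3, u t x - v t x = 0 := by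
    intro t ht
    have h1 : eLpNorm (u t - v t) p volume = 0 := by
      simpa [hW0] using hpt t ht
    have hw : AEStronglyMeasurable (u t - v t) volume :=
      (hu.aestronglyMeasurable_slice t ht.1).sub (hv.aestronglyMeasurable_slice t ht.1)
    exact (eLpNorm_eq_zero_iff hw hp0).1 h1
  intro t ht
  rcases lt_or_ge t T with htT | htT
  · exact hsmall t ⟨ht, htT⟩
  -- For t ≥ T the solutions already agree at T/2 and are propagated forward from there.
  · have hsS : T / 2 ∈ times S := mem_times_of_le ht (by linarith) (by linarith)
    exact forall_sub_eq_zero_of_sub_eq_zero hu hv hsS ht (hsmall _ ⟨hsS, by linarith⟩) t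
      ⟨by linarith, le_rfl⟩

end

end NSError

theorem theorem1 :
    -- (1) uniqueness criterion
    (∀ c₁ : ℝ, 0 < c₁ → ∀ p : ℝ≥0∞, 3 ≤ p → p < ∞ →
      ∃ ε₁ : ℝ, 0 < ε₁ ∧ ε₁ < c₁ ∧ ∀ η : ℝ, η = ε₁ / (c₁ - ε₁) →
        ∀ (S : EReal) (u₀ : 𝓓'((⊤ : TopologicalSpace.Opens NSError.R3), NSError.R3))
          (u v : ℝ → NSError.R3 → NSError.R3),
          NSError.IsMildSolution S u₀ u → NSError.IsMildSolution S u₀ v →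
          NSError.CenteredTypeI S c₁ u v →
          (∃ T : ℝ, 0 < T ∧ ∀ t ∈ NSError.times S, t < T →
            eLpNorm ((Metric.ball 0 (η⁻¹ * √t)).indicator (u t - v t)) p volume ≤
              ENNReal.ofReal (ε₁ / 2) *
                eLpNorm ((Metric.ball 0 (η⁻¹ * √t))ᶜ.indicator (u t - v t)) p volume) →
          ∀ t ∈ NSError.times S, ∀ᵐ x : NSError.R3, u t x - v t x = 0) ∧
    -- (2) lower bound on the error
    (∀ (S : EReal) (p : ℝ≥0∞), 3 < p → ∀ c₂ : ℝ, 0 < c₂ → ∀ t ∈ NSError.times S,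
      ∀ a : ℝ, 0 ≤ a → ∀ c₃ : ℝ, 0 < c₃ → ∀ M : ℝ≥0,
      ∃ b : ℝ, 1 < b ∧
        ∀ (u₀ : 𝓓'((⊤ : TopologicalSpace.Opens NSError.R3), NSError.R3))
          (u v : ℝ → NSError.R3 → NSError.R3),
          NSError.IsMildSolution S u₀ u → NSError.IsMildSolution S u₀ v →
          NSError.CriticalLowerBound S p c₂ (fun s => u s - v s) →
          NSError.M0 u v t = M →
          ¬ ∀ᵐ x : NSError.R3,
            ‖u t x - v t x‖ < c₃ * √t ^ a / (b * ‖x‖ + √t) ^ (a + 1)) ∧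
    -- (3) upper bound on the error
    (∀ c₁ : ℝ, 0 < c₁ → ∃ C : ℝ,
      ∀ (S : EReal) (u₀ : 𝓓'((⊤ : TopologicalSpace.Opens NSError.R3), NSError.R3))
        (u v : ℝ → NSError.R3 → NSError.R3),
        NSError.IsMildSolution S u₀ u → NSError.IsMildSolution S u₀ v →
        NSError.CenteredTypeI S c₁ u v →
        ∀ t ∈ NSError.times S, ∀ᵐ x : NSError.R3,
          ‖u t x - v t x‖ * (‖x‖ + √t) ^ 4 / √t ^ 3 ≤ C) := by
  exact ⟨fun c₁ hc p hp hp' => NSError.exists_uniqueness_criterion hc hp hp',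
    fun S p hp c₂ hc₂ t ht a ha c₃ hc₃ M =>
      NSError.exists_error_lower_bound hp hc₂ ht ha hc₃ M,
    fun c₁ hc => NSError.exists_error_upper_bound hc⟩
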